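/- Let $(P,\preceq)$ be a finite poset with $|P|\ge 2$ whose Hasse diagram is connected. A *tube* is a nonempty subset $\tau\subseteq P$ that is convex ($i\prec j\prec k$ with $i,k\in\tau$ implies $j\in\tau$) and connected (the subgraph of the Hasse diagram induced on $\tau$ is connected); it is *proper* if $1<|\tau|<|P|$. A *tubing* is a collection $\mathbf T$ of tubes, any two of which are nested or disjoint, such that the directed graph with vertex set $\mathbf T$ and an edge $\tau\to\tau'$ whenever $\tau\cap\tau'=\emptyset$ and $i\prec j$ for some $i\in\tau$, $j\in\tau'$, has no directed cycle; it is *proper* if all its tubes are proper. Two polytopes are combinatorially equivalent if their face lattices are isomorphic. There exists a polytope $\mathscr A(P)^*\subset\mathbb R^{|P|-2}$ with the origin in its interior whose boundary complex is isomorphic to the simplicial complex of proper tubings (vertices: proper tubes; simplices: proper tubings). For any full-dimensional polytope $\mathscr A(P)^*\subset\mathbb R^d$ with the origin in its interior, together with such an isomorphism, let $\mathscr A(P)$ be its polar dual (the *poset associahedron*), and for a proper tubing $\mathbf T$ let $F_{\mathbf T}$ be the face of $\mathscr A(P)$ polar to the boundary face of $\mathscr A(P)^*$ labelled by $\mathbf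 T$. Then: 1. $\mathscr A(P)$ is a simple polytope of dimension $|P|-2$. 2. Its polar dual is $\mathscr A(P)^*$, and it is simplicial. In general it is not flag: there is a finite connected poset $P$ for which the boundary complex of $\mathscr A(P)^*$ is not a flag simplicial complex. 3. $\mathbf T\mapsto F_{\mathbf T}$ is a bijection from proper tubings (including $\emptyset$) onto nonempty faces of $\mathscr A(P)$, with $F_{\mathbf T}\subseteq F_{\mathbf T'}$ if and only if $\mathbf T'\subseteq\mathbf T$, and $\dim F_{\mathbf T}=|P|-|\mathbf T|-2$. 4. It restricts to a bijection from the proper tubings of size $|P|-2$ onto the vertices of $\mathscr A(P)$. 5. $\tau\mapsto F_{\{\tau\}}$ is a bijection from proper tubes onto the facets (nonempty faces of codimension one) of $\mathscr A(P)$. 6. Each nonempty face of $\mathscr A(P)$ is combinatorially equivalent to a product of finitely many poset associahedra (of finite connected posets with at least two elements). 7. If $P$ is a chain (totally ordered), then $\mathscr A(P)$ is, combinatorially, the $(|P|-2)$-dimensional associahedron: its poset of nonempty faces is isomorphic to the set of dissections of a convex $(|P|+1)$-gon by pairwise noncrossing diagonals, ordered by reverse inclusion. 8. If $P$ is a claw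 (it has a minimum $\hat 0$, and any two distinct elements other than $\hat 0$ are incomparable), then $\mathscr A(P)$ is combinatorially equivalent to the $(|P|-2)$-dimensional permutohedron, the convex hull in $\mathbb R^{n}$, $n=|P|-1$, of all vectors obtained from $(1,2,\dots,n)$ by permuting the coordinates. -/

import Mathlib

/-! ### Convex polytopes and their faces -/

section Polytopes

variable {E : Type*} [NormedAddCommGroup E] [NormedSpace ℝ E]

/-- A (convex) polytope: the convex hull of finitely many points. -/
def IsPolytope (Q : Set E) : Prop :=
  ∃ s : Finset E, Q = convexHull ℝ (s : Set E)

/-- A face of a polytope `Q`: the empty set, or the locus where a linear functional attains its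
maximum over `Q`.  In particular `∅` and `Q` itself are faces. -/
def IsFace (Q F : Set E) : Prop := IsExposed ℝ Q F

/-- The face lattice of `Q`: all faces (including `∅` and `Q`), ordered by inclusion. -/
abbrev FaceLattice (Q : Set E) : Type _ := {F : Set E // IsFace Q F}

/-- The poset of nonempty faces of `Q` (including `Q`), ordered by inclusion. -/
abbrev NonemptyFaces (Q : Set E) : Type _ := {F : Set E // IsFace Q F ∧ F.Nonempty}

/-- The poset of proper faces of `Q` (including `∅`, excluding `Q`), ordered by inclusion.
This is the face poset of the boundary complex of `Q`. -/
abbrev BoundaryFaces (Q : Set E) : Type _ := {F : Set E // IsFace Q F ∧ F ≠ Q}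

/-- The dimension of a nonempty polytope, i.e. the dimension of its affine span. -/
noncomputable def polytopeDim (F : Set E) : ℕ := Module.finrank ℝ (vectorSpan ℝ F)

/-- `v` is a vertex of `Q`. -/
def IsVertex (Q : Set E) (v : E) : Prop := IsFace Q {v}

/-- A facet of `Q`: a nonempty face of codimension one. -/
def IsFacet (Q F : Set E) : Prop :=
  IsFace Q F ∧ F.Nonempty ∧ polytopeDim F + 1 = polytopeDim Q

/-- A `d`-dimensional polytope is simple if every vertex lies on exactly `d` facets. -/
def IsSimplePolytope (Q : Set E) : Prop :=
  IsPolytope Q ∧ ∀ v, IsVertex Q v → {F | IsFacet Q F ∧ v ∈ F}.encard = polytopeDim Q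

/-- A (possibly empty) simplex: the convex hull of finitely many affinely independent points. -/
def IsSimplex (F : Set E) : Prop :=
  ∃ s : Finset E, AffineIndependent ℝ (Subtype.val : s → E) ∧ F = convexHull ℝ (s : Set E)

/-- A polytope is simplicial if every proper face is a simplex. -/
def IsSimplicialPolytope (Q : Set E) : Prop :=
  IsPolytope Q ∧ ∀ F, IsFace Q F → F ≠ Q → IsSimplex F

/-- The flag condition for (the boundary complex of) a simplicial polytope: every finite set of
vertices, any two of which span a simplex of the boundary, spans a simplex of the boundary.
(The case `v = w` of the hypothesis says that `v` is a vertex of the boundary.) -/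
def IsFlagPolytope (Q : Set E) : Prop :=
  ∀ S : Finset E,
    (∀ v ∈ S, ∀ w ∈ S, IsFace Q (convexHull ℝ {v, w}) ∧ convexHull ℝ {v, w} ≠ Q) →
      IsFace Q (convexHull ℝ (S : Set E)) ∧ convexHull ℝ (S : Set E) ≠ Q

/-- Two polytopes are combinatorially equivalent if their face lattices are isomorphic. -/
def CombEquiv {E' : Type*} [NormedAddCommGroup E'] [NormedSpace ℝ E']
    (Q : Set E) (Q' : Set E') : Prop :=
  Nonempty (FaceLattice Q ≃o FaceLattice Q')

end Polytopes

/-- The polar dual of a set in a Euclidean space. -/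
def polarDual {d : ℕ} (Q : Set (EuclideanSpace ℝ (Fin d))) : Set (EuclideanSpace ℝ (Fin d)) :=
  {y | ∀ x ∈ Q, inner ℝ x y ≤ 1}

/-! ### Tubes and tubings -/

section Tubings

variable {P : Type*} [PartialOrder P]

/-- A poset is connected if its Hasse diagram is a connected graph. -/
def PosetConnected (P : Type*) [PartialOrder P] : Prop := (SimpleGraph.hasse P).Connected

/-- A tube: a convex, connected, nonempty subset.  (`Connected` includes nonemptiness.) -/
def IsTube (τ : Finset P) : Prop :=
  Set.OrdConnected (τ : Set P) ∧ ((SimpleGraph.hasse P).induce (τ : Set P)).Connected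

/-- The edges of the directed graph `D_T` on the vertex set `T`. -/
def TubingEdge (T : Finset (Finset P)) (τ τ' : Finset P) : Prop :=
  τ ∈ T ∧ τ' ∈ T ∧ Disjoint τ τ' ∧ ∃ i ∈ τ, ∃ j ∈ τ', i < j

/-- A tubing: a collection of tubes, pairwise nested or disjoint, such that the directed graph
`D_T` has no directed cycle. -/
def IsTubing (T : Finset (Finset P)) : Prop :=
  (∀ τ ∈ T, IsTube τ) ∧
  (∀ τ ∈ T, ∀ τ' ∈ T, τ ⊆ τ' ∨ τ' ⊆ τ ∨ Disjoint τ τ') ∧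
  ∀ τ, ¬ Relation.TransGen (TubingEdge T) τ τ

variable [Fintype P]

/-- A proper tube: a tube `τ` with `1 < |τ| < |P|`. -/
def IsProperTube (τ : Finset P) : Prop :=
  IsTube τ ∧ 1 < τ.card ∧ τ.card < Fintype.card P

/-- A proper tubing: a tubing consisting of proper tubes. -/
def IsProperTubing (T : Finset (Finset P)) : Prop :=
  IsTubing T ∧ ∀ τ ∈ T, IsProperTube τ

/-- The proper tubings of `P` (including the empty one), ordered by inclusion.  This is the face
poset of the abstract simplicial complex whose vertices are the proper tubes and whose simplices
are the proper tubings. -/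
abbrev ProperTubing (P : Type*) [PartialOrder P] [Fintype P] : Type _ :=
  {T : Finset (Finset P) // IsProperTubing T}

theorem isProperTubing_singleton {τ : Finset P} (h : IsProperTube τ) :
    IsProperTubing ({τ} : Finset (Finset P)) := by
  refine ⟨⟨?_, ?_, ?_⟩, ?_⟩
  · intro σ hσ
    rw [Finset.mem_singleton.1 hσ]
    exact h.1
  · intro σ hσ σ' hσ'
    rw [Finset.mem_singleton.1 hσ, Finset.mem_singleton.1 hσ']
    exact Or.inl subset_rfl
  · intro σ hσ
    obtain ⟨ρ, hρ, -⟩ := Relation.TransGen.head'_iff.1 hσ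
    obtain ⟨h1, h2, h3, i, hi, -⟩ := hρ
    rw [Finset.mem_singleton.1 h1, Finset.mem_singleton.1 h2] at h3
    rw [Finset.mem_singleton.1 h1] at hi
    exact Finset.disjoint_left.1 h3 hi hi
  · intro σ hσ
    rw [Finset.mem_singleton.1 hσ]
    exact h

/-- The proper tubing consisting of a single proper tube. -/
def ProperTubing.single (τ : Finset P) (h : IsProperTube τ) : ProperTubing P :=
  ⟨{τ}, isProperTubing_singleton h⟩

end Tubings

/-! ### Poset associahedra -/

/-- A geometric realization, in `ℝᵈ`, of the poset associahedron of `P`.  It is given by a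
full-dimensional polytope `dual` (written `𝒜(P)*`), having the origin in its interior, together
with an isomorphism of its boundary complex with the complex of proper tubings.  The poset
associahedron itself is the polar dual of this polytope, see `PosetAssociahedron.carrier`. -/
structure PosetAssociahedron (P : Type*) [PartialOrder P] [Fintype P] (d : ℕ) where
  dual : Set (EuclideanSpace ℝ (Fin d))
  isPolytope_dual : IsPolytope dual
  zero_mem_interior : (0 : EuclideanSpace ℝ (Fin d)) ∈ interior dual
  boundaryIso : BoundaryFaces dual ≃o ProperTubing P

namespace PosetAssociahedron

variable {P : Type*} [PartialOrder P] [Fintype P] {d : ℕ}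

/-- The poset associahedron `𝒜(P)`: the polar dual of `𝒜(P)*`. -/
def carrier (A : PosetAssociahedron P d) : Set (EuclideanSpace ℝ (Fin d)) := polarDual A.dual

/-- The face of `𝒜(P)` corresponding to a proper tubing `T`, i.e. the face polar to the boundary
face of `𝒜(P)*` labelled by `T`. -/
def face (A : PosetAssociahedron P d) (T : ProperTubing P) : Set (EuclideanSpace ℝ (Fin d)) :=
  {y ∈ A.carrier | ∀ x ∈ (A.boundaryIso.symm T : Set (EuclideanSpace ℝ (Fin d))),
    inner ℝ x y = 1}

end PosetAssociahedron

/-! ### Chains, claws, associahedra and permutohedra -/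

/-- A chain: any two elements are comparable. -/
def IsChainPoset (P : Type*) [PartialOrder P] : Prop := ∀ a b : P, a ≤ b ∨ b ≤ a

/-- A claw: there is a minimum element, and any two other distinct elements are incomparable. -/
def IsClawPoset (P : Type*) [PartialOrder P] : Prop :=
  ∃ o : P, (∀ a, o ≤ a) ∧ ∀ a b : P, a ≠ o → b ≠ o → a ≤ b → a = b

/-- `e = (a, b)` with `a < b` encodes a diagonal of a convex `m`-gon with vertices `0, …, m - 1`
in cyclic order: the vertices `a`, `b` are distinct and not adjacent. -/
def IsDiagonal {m : ℕ} (e : Fin m × Fin m) : Prop :=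
  e.1.val + 1 < e.2.val ∧ ¬ (e.1.val = 0 ∧ e.2.val + 1 = m)

/-- Two diagonals cross in the interior of the polygon. -/
def DiagonalsCross {m : ℕ} (e f : Fin m × Fin m) : Prop :=
  (e.1 < f.1 ∧ f.1 < e.2 ∧ e.2 < f.2) ∨ (f.1 < e.1 ∧ e.1 < f.2 ∧ f.2 < e.2)

/-- The polygonal dissections of a convex `m`-gon: sets of pairwise noncrossing diagonals,
ordered by inclusion. -/
abbrev PolygonDissection (m : ℕ) : Type :=
  {D : Finset (Fin m × Fin m) //
    (∀ e ∈ D, IsDiagonal e) ∧ ∀ e ∈ D, ∀ f ∈ D, ¬ DiagonalsCross e f}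

/-- `Q` is (a realization of) the `d`-dimensional (Stasheff) associahedron: a `d`-dimensional
polytope whose nonempty faces, ordered by inclusion, correspond to the dissections of a convex
`(d + 3)`-gon, ordered by reverse inclusion.  (Dissections of a convex `(d + 3)`-gon are dual to
plane rooted trees with `d + 2` leaves in which every non-leaf vertex has at least two children,
and removing a diagonal is contracting an internal edge.) -/
def IsAssociahedron (d : ℕ) {E : Type*} [NormedAddCommGroup E] [NormedSpace ℝ E]
    (Q : Set E) : Prop :=
  IsPolytope Q ∧ polytopeDim Q = d ∧
    Nonempty (NonemptyFaces Q ≃o (PolygonDissection (d + 3))ᵒᵈ)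

/-- The `(n - 1)`-dimensional permutohedron in `ℝⁿ`: the convex hull of all vectors obtained from
`(1, 2, …, n)` by permuting the coordinates. -/
def permutohedron (n : ℕ) : Set (EuclideanSpace ℝ (Fin n)) :=
  convexHull ℝ (Set.range fun σ : Equiv.Perm (Fin n) =>
    WithLp.toLp 2 fun i : Fin n => ((σ i : ℕ) : ℝ) + 1)

/-!
The proof works with a polar pair: the convex hull of the origin and of points `a τ`, indexed by
the tubes, with the origin in its interior, and the polyhedron of all `y` with `⟨a τ, y⟩ ≤ 1`. The
pair realizes the complex of proper tubings if the sets of simultaneously tight inequalities are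
exactly the proper tubings (`IsRealization`). Since subsets of tubings are tubings, simultaneously
tight functionals are then linearly independent, and everything about faces, dimensions, vertices,
facets, simplicity and simpliciality follows (`Realizes.facesIso`,
`IsRealization.polytopeDim_subface`, `IsRealization.isSimplePolytope`,
`IsRealization.isSimplicialPolytope`). Conversely, the vertices of the dual of any given poset
associahedron are such points (`PosetAssociahedron.isRealization`), because a boundary face
labelled by a single tube is a point and a polytope is the hull of its vertices.

*Existence.* For a tube `τ` let `compSum τ p` be the sum of `p j - p i` over all pairs `i < j` in
`τ`. The polytope consists of the `p`, modulo constants, with `compSum τ p ≥ M ^ |τ|` for the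
tubes with at least two elements and equality for the whole poset, where `M` is huge. A strongly
connected family of tight tubes has a largest member, since otherwise the convex hull of its union
would be a tube on which `p` varies too little (`TubeFeasible.exists_top`); so tight tubes are
nested or disjoint and have no directed cycle. Conversely, acyclicity of a tubing yields, for each
of its tubes, a rank function of the quotient by the smaller tubes; a combination of these with
coefficients of rapidly growing size is tight exactly at the tubing
(`IsProperTubing.exists_tubeFeasible`).

*Faces as products.* Contracting a tube `τ` to a point gives a poset `P / τ`, and the proper
tubings containing `τ` are the pairs of a proper tubing of `τ` and one of `P / τ`
(`IsContraction.exists_link`). By induction the tubings containing a given one form a product of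
such complexes, which is the poset of faces of a product of polytopes
(`Realizes.exists_piFacesIso`).

*Examples.* In a chain and in a claw no directed cycles occur, so that tubings are sets of
pairwise compatible tubes: intervals, that is, diagonals of a polygon, in a chain; nonempty proper
subsets of the set of non-minimal elements, compatible when nested, in a claw. The faces of the
permutohedron are labelled by chains of subsets too: by the rearrangement inequality, the vertices
of the face of a functional `w` are the permutations that are monovary with `w`, and they
determine the upper level sets of `w` (`exists_permutohedron_facesIso`). In the crown with six
elements there are three pairwise compatible tubes that form a directed cycle, so that the complex
is not flag (`Crown.not_isFlagPolytope`).
-/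


/-! ### Connectedness by comparabilities -/

section Connectedness

variable {P : Type*} [PartialOrder P]

/-- A set is connected through comparabilities: it is nonempty, and a nonempty subset that is
closed under passing to a comparable element is everything.  For convex subsets of finite posets
this is connectedness of the Hasse diagram, see `connected_induce_hasse_iff`. -/
def CompConnected (s : Set P) : Prop :=
  s.Nonempty ∧ ∀ A ⊆ s, A.Nonempty → (∀ x ∈ A, ∀ y ∈ s, x ≤ y ∨ y ≤ x → y ∈ A) → s ⊆ A

theorem reachable_induce_hasse_of_le [Finite P] {s : Set P} (hs : s.OrdConnected) {y : P}
    (hy : y ∈ s) (x : P) (hx : x ∈ s) (hxy : x ≤ y) :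
    ((SimpleGraph.hasse P).induce s).Reachable ⟨x, hx⟩ ⟨y, hy⟩ := by
  induction x using WellFoundedGT.induction with
  | ind x ih =>
    rcases hxy.eq_or_lt with rfl | hlt
    · exact SimpleGraph.Reachable.refl _
    · obtain ⟨z, hxz, hzy⟩ := exists_covBy_le_of_lt hlt
      have hz : z ∈ s := hs.out hx hy ⟨hxz.le, hzy⟩
      refine SimpleGraph.Reachable.trans (SimpleGraph.Adj.reachable ?_) (ih z hxz.lt hz hzy)
      exact Or.inl hxz

/-- A reachability class is closed under comparabilities because convexity keeps a saturated chain
between two elements inside the set. -/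
theorem connected_induce_hasse_iff [Finite P] {s : Set P} (hs : s.OrdConnected) :
    ((SimpleGraph.hasse P).induce s).Connected ↔ CompConnected s := by
  constructor
  · intro h
    obtain ⟨x₀⟩ := h.nonempty
    refine ⟨⟨x₀, x₀.2⟩, fun A hA ⟨a, ha⟩ hcl y hy => ?_⟩
    have hr := h.preconnected ⟨a, hA ha⟩ ⟨y, hy⟩
    rw [SimpleGraph.reachable_iff_reflTransGen] at hr
    suffices ∀ z : s, Relation.ReflTransGen ((SimpleGraph.hasse P).induce s).Adj ⟨a, hA ha⟩ z →
        z.1 ∈ A from this _ hr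
    intro z hz
    induction hz with
    | refl => exact ha
    | tail _ hbc ih =>
      refine hcl _ ih _ (Subtype.property _) ?_
      rcases hbc with h | h
      · exact Or.inl h.le
      · exact Or.inr h.le
  · rintro ⟨⟨x₀, hx₀⟩, h⟩
    have key : ∀ x (hx : x ∈ s), ∀ y (hy : y ∈ s),
        ((SimpleGraph.hasse P).induce s).Reachable ⟨x, hx⟩ ⟨y, hy⟩ := by
      intro x hx y hy
      obtain ⟨_, hr⟩ := h
        {z | ∃ hz : z ∈ s, ((SimpleGraph.hasse P).induce s).Reachable ⟨x, hx⟩ ⟨z, hz⟩}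
        (fun z hz => hz.1) ⟨x, hx, SimpleGraph.Reachable.refl _⟩ (by
          rintro z ⟨hz, hr⟩ w hw (hle | hle)
          · exact ⟨hw, hr.trans (reachable_induce_hasse_of_le hs hw z hz hle)⟩
          · exact ⟨hw, hr.trans (reachable_induce_hasse_of_le hs hz w hw hle).symm⟩) hy
      exact hr
    have : Nonempty s := ⟨⟨x₀, hx₀⟩⟩
    exact SimpleGraph.Connected.mk fun x y => key x.1 x.2 y.1 y.2

theorem isTube_iff [Finite P] {τ : Finset P} :
    IsTube τ ↔ Set.OrdConnected (τ : Set P) ∧ CompConnected (τ : Set P) :=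
  and_congr_right fun h => connected_induce_hasse_iff h

theorem posetConnected_iff [Finite P] : PosetConnected P ↔ CompConnected (Set.univ : Set P) := by
  rw [← connected_induce_hasse_iff Set.ordConnected_univ]
  exact (SimpleGraph.induceUnivIso (SimpleGraph.hasse P)).connected_iff.symm

/-- A connected set with at least two elements has a comparable pair that is not contained in any
member of a given laminar family, unless the set itself is contained in a member. -/
theorem CompConnected.exists_lt_of_laminar {s : Set P} (hs : CompConnected s)
    (hs2 : s.Nontrivial) (T : Set (Finset P)) (hfin : T.Finite)
    (hT : ∀ σ ∈ T, ∀ ρ ∈ T, σ ⊆ ρ ∨ ρ ⊆ σ ∨ Disjoint σ ρ)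
    (hsT : ∀ σ ∈ T, ¬ s ⊆ σ) :
    ∃ i ∈ s, ∃ j ∈ s, i < j ∧ ∀ σ ∈ T, ¬ (i ∈ σ ∧ j ∈ σ) := by
  by_contra! hcon
  have hpair : ∀ x ∈ s, ∀ y ∈ s, x ≤ y ∨ y ≤ x → x ≠ y → ∃ σ ∈ T, x ∈ σ ∧ y ∈ σ := by
    rintro x hx y hy (h | h) hne
    · exact hcon x hx y hy (lt_of_le_of_ne h hne)
    · obtain ⟨σ, h1, h2, h3⟩ := hcon y hy x hx (lt_of_le_of_ne h hne.symm)
      exact ⟨σ, h1, h3, h2⟩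
  obtain ⟨x, hx⟩ := hs.1
  by_cases hxT : ∃ σ ∈ T, x ∈ σ
  · obtain ⟨σ₀, hσ₀, hxσ₀⟩ := hxT
    obtain ⟨ρ, hρ⟩ := (hfin.subset (Set.sep_subset T fun σ => x ∈ σ)).exists_maximal
      ⟨σ₀, hσ₀, hxσ₀⟩
    refine hsT ρ hρ.1.1 fun y hy => ?_
    refine (hs.2 (s ∩ ρ) Set.inter_subset_left ⟨x, hx, hρ.1.2⟩ ?_ hy).2
    rintro z ⟨hz, hzρ⟩ w hw hzw
    by_cases hne : z = w
    · exact ⟨hw, hne ▸ hzρ⟩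
    obtain ⟨σ, hσ, hzσ, hwσ⟩ := hpair z hz w hw hzw hne
    refine ⟨hw, ?_⟩
    rcases hT σ hσ ρ hρ.1.1 with h | h | h
    · exact h hwσ
    · exact hρ.2 ⟨hσ, h hρ.1.2⟩ h hwσ
    · exact absurd hzρ (Finset.disjoint_left.1 h hzσ)
  · have := hs.2 {x} (by simpa using hx) ⟨x, rfl⟩ (by
      rintro z rfl w hw hzw
      by_contra hne
      obtain ⟨σ, h1, h2, -⟩ := hpair z hx w hw hzw (fun h => hne h.symm)
      exact hxT ⟨σ, h1, h2⟩)
    obtain ⟨a, ha, b, hb, hab⟩ := hs2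
    exact hab ((this ha).trans (this hb).symm)

end Connectedness

/-! ### Faces of polyhedra given by inequalities -/

section Polyhedra

variable {E : Type*} [NormedAddCommGroup E] [NormedSpace ℝ E] {ι : Type*}

/-- The polyhedron `{y | a i y ≤ 1 for all i}`. -/
def polyhedron (a : ι → StrongDual ℝ E) : Set E := {y | ∀ i, a i y ≤ 1}

/-- The part of the polyhedron where the inequalities indexed by `S` are equalities. -/
def subface (a : ι → StrongDual ℝ E) (S : Finset ι) : Set E :=
  {y ∈ polyhedron a | ∀ i ∈ S, a i y = 1}

theorem subface_empty (a : ι → StrongDual ℝ E) : subface a ∅ = polyhedron a := by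
  simp [subface]

theorem convex_polyhedron (a : ι → StrongDual ℝ E) : Convex ℝ (polyhedron a) := by
  intro x hx y hy s t hs ht hst i
  have := hx i
  have := hy i
  simp only [map_add, map_smul, smul_eq_mul]
  nlinarith

/-- The sum of the functionals indexed by `S` exposes the corresponding face. -/
theorem isExposed_subface {a : ι → StrongDual ℝ E} {S₀ S : Finset ι} (hsub : S₀ ⊆ S) :
    IsExposed ℝ (subface a S₀) (subface a S) := by
  rintro ⟨w, hw⟩
  refine ⟨∑ i ∈ S, a i, ?_⟩
  have hle : ∀ y ∈ polyhedron a, ∑ i ∈ S, a i y ≤ ∑ i ∈ S, (1 : ℝ) := fun y hy =>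
    Finset.sum_le_sum fun i _ => hy i
  ext x
  simp only [Set.mem_ofPred_eq, FunLike.coe_sum, Finset.sum_apply]
  constructor
  · intro hx
    refine ⟨⟨hx.1, fun i hi => hx.2 i (hsub hi)⟩, fun y hy => ?_⟩
    rw [Finset.sum_congr rfl fun i hi => hx.2 i hi]
    exact hle y hy.1
  · rintro ⟨hx, hmax⟩
    refine ⟨hx.1, fun i hi => ?_⟩
    have h1 := hmax w ⟨hw.1, fun i hi => hw.2 i (hsub hi)⟩
    rw [Finset.sum_congr rfl fun i hi => hw.2 i hi] at h1
    exact (Finset.sum_eq_sum_iff_of_le fun i _ => hx.1 i).1 (le_antisymm (hle x hx.1) h1) i hi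

variable [Fintype ι]

open Classical in
/-- The set of inequalities that are equalities at `y`. -/
noncomputable def tight (a : ι → StrongDual ℝ E) (y : E) : Finset ι :=
  Finset.univ.filter fun i => a i y = 1

@[simp] theorem mem_tight {a : ι → StrongDual ℝ E} {y : E} {i : ι} :
    i ∈ tight a y ↔ a i y = 1 := by
  simp [tight]

theorem mem_subface {a : ι → StrongDual ℝ E} {y : E} {S : Finset ι} :
    y ∈ subface a S ↔ y ∈ polyhedron a ∧ S ⊆ tight a y := by
  simp [subface, Finset.subset_iff]

/-- `K` is the family of the sets of tight inequalities of the points of the polyhedron, so that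
the nonempty faces of the polyhedron are labelled by `K`. -/
def Realizes (a : ι → StrongDual ℝ E) (K : Set (Finset ι)) : Prop :=
  (∀ y ∈ polyhedron a, tight a y ∈ K) ∧ ∀ S ∈ K, ∃ y ∈ polyhedron a, tight a y = S

/-- A point of the polyhedron can be moved in any direction that keeps its tight inequalities
tight. -/
theorem exists_pos_add_smul_mem_polyhedron {a : ι → StrongDual ℝ E} {y z : E}
    (hy : y ∈ polyhedron a) (hz : ∀ i ∈ tight a y, a i z ≤ 0) :
    ∃ ε : ℝ, 0 < ε ∧ y + ε • z ∈ polyhedron a := by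
  have h : ∀ i, ∀ᶠ ε in nhdsWithin (0 : ℝ) (Set.Ioi 0), a i (y + ε • z) ≤ 1 := by
    intro i
    by_cases hi : i ∈ tight a y
    · filter_upwards [self_mem_nhdsWithin] with ε hε
      have h1 := hz i hi
      have h2 := mem_tight.1 hi
      simp only [map_add, map_smul, smul_eq_mul, h2]
      nlinarith [Set.mem_Ioi.1 hε]
    · have hlt : a i y < 1 := lt_of_le_of_ne (hy i) fun h => hi (mem_tight.2 h)
      have hc : Continuous fun ε : ℝ => a i (y + ε • z) := by fun_prop
      have h0 : a i (y + (0 : ℝ) • z) < 1 := by simpa using hlt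
      exact (((hc.tendsto 0).eventually_lt_const h0).filter_mono nhdsWithin_le_nhds).mono
        fun _ h => h.le
  obtain ⟨ε, hε, hpos⟩ := ((Filter.eventually_all.2 h).and self_mem_nhdsWithin).exists
  exact ⟨ε, hpos, hε⟩

variable {a : ι → StrongDual ℝ E} {K : Set (Finset ι)}

namespace Realizes

theorem subface_nonempty (h : Realizes a K) {S : Finset ι} (hS : S ∈ K) :
    (subface a S).Nonempty := by
  obtain ⟨y, hy, rfl⟩ := h.2 S hS
  exact ⟨y, mem_subface.2 ⟨hy, subset_rfl⟩⟩

theorem subface_subset_iff (h : Realizes a K) {S S' : Finset ι} (hS : S ∈ K) :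
    subface a S ⊆ subface a S' ↔ S' ⊆ S := by
  constructor
  · intro hsub
    obtain ⟨y, hy, rfl⟩ := h.2 S hS
    exact (mem_subface.1 (hsub (mem_subface.2 ⟨hy, subset_rfl⟩))).2
  · intro hsub y hy
    rw [mem_subface] at hy ⊢
    exact ⟨hy.1, hsub.trans hy.2⟩

theorem subface_injOn (h : Realizes a K) {S S' : Finset ι} (hS : S ∈ K) (hS' : S' ∈ K)
    (heq : subface a S = subface a S') : S = S' :=
  ((h.subface_subset_iff hS').1 heq.symm.subset).antisymm
    ((h.subface_subset_iff hS).1 heq.subset)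

/-- Every nonempty face of a face is obtained by making inequalities tight: a point of it with as
few tight inequalities as possible lies in its relative interior. -/
theorem exists_eq_subface (h : Realizes a K) {S₀ : Finset ι} {F : Set E}
    (hF : IsExposed ℝ (subface a S₀) F) (hne : F.Nonempty) :
    ∃ S ∈ K, S₀ ⊆ S ∧ F = subface a S := by
  obtain ⟨y₀, hy₀, hmin⟩ := exists_minimalFor_of_wellFoundedLT (· ∈ F)
    (fun y => (tight a y).card) hne
  obtain ⟨l, hl⟩ := hF hne
  have hFsub : F ⊆ subface a S₀ := hF.subset
  have hy₀S := mem_subface.1 (hFsub hy₀)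
  refine ⟨tight a y₀, h.1 y₀ hy₀S.1, hy₀S.2, Set.Subset.antisymm ?_ ?_⟩
  · intro y hy
    have hyS := mem_subface.1 (hFsub hy)
    refine mem_subface.2 ⟨hyS.1, ?_⟩
    -- the midpoint of `y₀` and `y` lies in `F`, so it has no fewer tight inequalities than `y₀`
    have hm : tight a ((1 / 2 : ℝ) • y₀ + (1 / 2 : ℝ) • y) ⊆ tight a y₀ ∧
        tight a ((1 / 2 : ℝ) • y₀ + (1 / 2 : ℝ) • y) ⊆ tight a y := by
      constructor <;> intro i hi <;> rw [mem_tight] at hi ⊢ <;>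
        simp only [map_add, map_smul, smul_eq_mul] at hi <;>
        linarith [hy₀S.1 i, hyS.1 i]
    have hmF : (1 / 2 : ℝ) • y₀ + (1 / 2 : ℝ) • y ∈ F := by
      have hy₀' := hy₀
      rw [hl] at hy₀' hy ⊢
      refine ⟨mem_subface.2 ⟨convex_polyhedron a hy₀S.1 hyS.1 (by norm_num) (by norm_num)
        (by norm_num), fun i hi => ?_⟩, fun z hz => ?_⟩
      · have h1 := mem_tight.1 (hy₀S.2 hi)
        have h2 := mem_tight.1 (hyS.2 hi)
        rw [mem_tight]
        simp only [map_add, map_smul, smul_eq_mul, h1, h2]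
        norm_num
      · have h1 := hy₀'.2 z hz
        have h2 := hy.2 z hz
        simp only [map_add, map_smul, smul_eq_mul]
        linarith
    have heq := Finset.eq_of_subset_of_card_le hm.1 (hmin hmF (Finset.card_le_card hm.1))
    exact heq ▸ hm.2
  · intro y hy
    have hyS := mem_subface.1 hy
    -- the segment from `y` to `y₀` can be prolonged beyond `y₀`, where `l` is already maximal
    obtain ⟨ε, hε, hmem⟩ := exists_pos_add_smul_mem_polyhedron (z := y₀ - y) hy₀S.1
      (fun i hi => by simp [mem_tight.1 hi, mem_tight.1 (hyS.2 hi)])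
    have hmS : y₀ + ε • (y₀ - y) ∈ subface a S₀ := by
      refine ⟨hmem, fun i hi => ?_⟩
      have h1 := mem_tight.1 (hy₀S.2 hi)
      have h2 := mem_tight.1 (hyS.2 (hy₀S.2 hi))
      simp [h1, h2]
    have hyS₀ : y ∈ subface a S₀ := mem_subface.2 ⟨hyS.1, hy₀S.2.trans hyS.2⟩
    rw [hl] at hy₀ ⊢
    refine ⟨hyS₀, fun z hz => (hy₀.2 z hz).trans ?_⟩
    have h1 := hy₀.2 _ hmS
    simp only [map_add, map_smul, map_sub, smul_eq_mul] at h1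
    nlinarith

/-- The nonempty faces of a face of a polyhedron are labelled by the larger sets of tight
inequalities. -/
noncomputable def facesIso (h : Realizes a K) (S₀ : Finset ι) :
    {S : Finset ι // S ∈ K ∧ S₀ ⊆ S}ᵒᵈ ≃o NonemptyFaces (subface a S₀) where
  toEquiv := Equiv.ofBijective
    (fun S => ⟨subface a (OrderDual.ofDual S).1, isExposed_subface (OrderDual.ofDual S).2.2,
      h.subface_nonempty (OrderDual.ofDual S).2.1⟩)
    ⟨fun S S' heq => by
      have := h.subface_injOn (OrderDual.ofDual S).2.1 (OrderDual.ofDual S').2.1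
        (congrArg Subtype.val heq)
      exact OrderDual.ofDual.injective (Subtype.ext this), fun F => by
      obtain ⟨S, hS, hsub, heq⟩ := h.exists_eq_subface F.2.1 F.2.2
      exact ⟨OrderDual.toDual ⟨S, hS, hsub⟩, Subtype.ext heq.symm⟩⟩
  map_rel_iff' {S S'} := h.subface_subset_iff (OrderDual.ofDual S).2.1

/-- If the labels are closed under passing to subsets, then the functionals that are
simultaneously tight are linearly independent: a point with one tight inequality less separates
that functional from the others. -/
theorem linearIndependent (h : Realizes a K) (hK : ∀ S ∈ K, ∀ S' ⊆ S, S' ∈ K) {S : Finset ι}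
    (hS : S ∈ K) : LinearIndependent ℝ (fun i : S => a i) := by
  classical
  rw [Fintype.linearIndependent_iff]
  intro g hg i
  obtain ⟨y, hy, hyS⟩ := h.2 S hS
  obtain ⟨z, hz, hzS⟩ := h.2 (S.erase i) (hK S hS _ (Finset.erase_subset _ _))
  have h1 := congrArg (fun f : StrongDual ℝ E => f (y - z)) hg
  simp only [FunLike.coe_sum, Finset.sum_apply, FunLike.coe_smul, Pi.smul_apply, smul_eq_mul,
    FunLike.coe_zero, Pi.zero_apply] at h1
  rw [Finset.sum_eq_single i] at h1
  · refine (mul_eq_zero.1 h1).resolve_right fun h0 => ?_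
    have h2 : a i y = 1 := mem_tight.1 (hyS ▸ i.2)
    have h3 : a i z = 1 := by
      rw [map_sub, sub_eq_zero] at h0
      rw [← h0, h2]
    have h4 := mem_tight.2 h3
    rw [hzS] at h4
    exact Finset.notMem_erase _ _ h4
  · intro j _ hj
    have h2 : a j y = 1 := mem_tight.1 (hyS ▸ j.2)
    have h3 : a j z = 1 := mem_tight.1 (hzS ▸ Finset.mem_erase.2
      ⟨fun h => hj (Subtype.ext h), j.2⟩)
    simp [h2, h3]
  · simp

end Realizes

/-- An isomorphism of the posets of nonempty faces extends to the face lattices. -/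
theorem combEquiv_of_nonemptyFaces {E' : Type*} [NormedAddCommGroup E'] [NormedSpace ℝ E']
    {Q : Set E} {Q' : Set E'} (e : NonemptyFaces Q ≃o NonemptyFaces Q') : CombEquiv Q Q' := by
  classical
  refine ⟨{
    toFun := fun F => if h : F.1.Nonempty then ⟨(e ⟨F.1, F.2, h⟩).1, (e ⟨F.1, F.2, h⟩).2.1⟩
      else ⟨∅, isExposed_empty⟩
    invFun := fun F => if h : F.1.Nonempty then
        ⟨(e.symm ⟨F.1, F.2, h⟩).1, (e.symm ⟨F.1, F.2, h⟩).2.1⟩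
      else ⟨∅, isExposed_empty⟩
    left_inv := fun F => ?_
    right_inv := fun F => ?_
    map_rel_iff' := fun {F G} => ?_ }⟩
  · by_cases h : F.1.Nonempty
    · simp [h, (e ⟨F.1, F.2, h⟩).2.2]
    · simp only [h, dite_false, Set.not_nonempty_empty]
      exact Subtype.ext (Set.not_nonempty_iff_eq_empty.1 h).symm
  · by_cases h : F.1.Nonempty
    · simp [h, (e.symm ⟨F.1, F.2, h⟩).2.2]
    · simp only [h, dite_false, Set.not_nonempty_empty]
      exact Subtype.ext (Set.not_nonempty_iff_eq_empty.1 h).symm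
  · by_cases h : F.1.Nonempty <;> by_cases h' : G.1.Nonempty
    · have := e.map_rel_iff (a := ⟨F.1, F.2, h⟩) (b := ⟨G.1, G.2, h'⟩)
      simp only [Equiv.coe_fn_mk, h, h', dite_true]
      exact this
    · simp only [Equiv.coe_fn_mk, h, h', dite_true, dite_false]
      have h1 : ¬ (e ⟨F.1, F.2, h⟩).1 ⊆ ∅ := fun hs =>
        Set.not_nonempty_empty ((e ⟨F.1, F.2, h⟩).2.2.mono hs)
      have h2 : ¬ F.1 ⊆ G.1 := fun hs => h' (h.mono hs)
      exact iff_of_false h1 h2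
    · simp only [Equiv.coe_fn_mk, h, h', dite_true, dite_false]
      exact iff_of_true (Set.empty_subset _)
        (by rw [← Subtype.coe_le_coe, Set.not_nonempty_iff_eq_empty.1 h]; exact Set.empty_subset _)
    · simp only [Equiv.coe_fn_mk, h, h', dite_false]
      exact iff_of_true (Set.empty_subset _)
        (by rw [← Subtype.coe_le_coe, Set.not_nonempty_iff_eq_empty.1 h]; exact Set.empty_subset _)

end Polyhedra

/-! ### Polarity -/

section Polarity

variable {E : Type*} [NormedAddCommGroup E] [NormedSpace ℝ E]

/-- Where a functional attains its maximum on a convex hull, only the points of the set at which it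
is maximal contribute. -/
theorem mem_convexHull_of_apply_eq {s : Set E} (l : StrongDual ℝ E) {m : ℝ}
    (hs : ∀ v ∈ s, l v ≤ m) {x : E} (hx : x ∈ convexHull ℝ s) (hxm : l x = m) :
    x ∈ convexHull ℝ {v ∈ s | l v = m} := by
  have key : convexHull ℝ s ⊆ {x | l x ≤ m ∧ (l x = m → x ∈ convexHull ℝ {v ∈ s | l v = m})} := by
    refine convexHull_min (fun v hv => ⟨hs v hv, fun h => subset_convexHull _ _ ⟨hv, h⟩⟩) ?_
    rintro x ⟨hx, hx'⟩ y ⟨hy, hy'⟩ b c hb hc hbc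
    have hle : l (b • x + c • y) = b * l x + c * l y := by simp
    have hbx := mul_le_mul_of_nonneg_left hx hb
    have hcy := mul_le_mul_of_nonneg_left hy hc
    have hm : b * m + c * m = m := by rw [← add_mul, hbc, one_mul]
    refine ⟨by rw [hle]; linarith, fun h => ?_⟩
    rw [hle] at h
    rcases hb.eq_or_lt with rfl | hb
    · have hc1 : c = 1 := by linarith
      subst hc1
      simpa using hy' (by linarith)
    rcases hc.eq_or_lt with rfl | hc
    · have hb1 : b = 1 := by linarith
      subst hb1
      simpa using hx' (by linarith)
    have hxe : l x = m := hx.antisymm (not_lt.1 fun hlt => by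
      have := mul_lt_mul_of_pos_left hlt hb
      linarith)
    have hye : l y = m := hy.antisymm (not_lt.1 fun hlt => by
      have := mul_lt_mul_of_pos_left hlt hc
      linarith)
    exact convex_convexHull ℝ _ (hx' hxe) (hy' hye) hb.le hc.le hbc
  exact (key hx).2 hxm

theorem convexHull_apply_le {s : Set E} (l : StrongDual ℝ E) {m : ℝ}
    (hs : ∀ v ∈ s, l v ≤ m) {x : E} (hx : x ∈ convexHull ℝ s) : l x ≤ m :=
  convexHull_min (t := {x | l x ≤ m}) hs (convex_halfSpace_le l.toLinearMap.isLinear m) hx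

theorem IsPolytope.isCompact {Q : Set E} (hQ : IsPolytope Q) : IsCompact Q := by
  obtain ⟨s, rfl⟩ := hQ
  exact s.finite_toSet.isCompact_convexHull (𝕜 := ℝ)

theorem IsPolytope.convex {Q : Set E} (hQ : IsPolytope Q) : Convex ℝ Q := by
  obtain ⟨s, rfl⟩ := hQ
  exact convex_convexHull ℝ _

/-- A face with two distinct points has a smaller nonempty face of the polytope in it, obtained by
tilting the exposing functional. -/
theorem IsPolytope.exists_ssubset_face {Q F : Set E} (hQ : IsPolytope Q) (hF : IsFace Q F)
    {x x' : E} (hx : x ∈ F) (hx' : x' ∈ F) (hne : x ≠ x') :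
    ∃ G, IsFace Q G ∧ G.Nonempty ∧ G ⊂ F := by
  obtain ⟨s, rfl⟩ := hQ
  obtain ⟨l, hl⟩ := hF ⟨x, hx⟩
  obtain ⟨g, hg⟩ := geometric_hahn_banach_point_point hne
  have hmax : ∀ y ∈ convexHull ℝ (s : Set E), l y ≤ l x := by
    rw [hl] at hx
    exact hx.2
  have hxQ : x ∈ convexHull ℝ (s : Set E) := hF.subset hx
  have hss : ∀ v ∈ s, v ∈ convexHull ℝ (s : Set E) := fun v hv => subset_convexHull ℝ _ hv
  -- `f = l + ε g` separates `x` from `x'`, and for small `ε` it is maximal only where `l` is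
  have hpos : ∀ v ∈ s, ∀ᶠ ε in nhdsWithin (0 : ℝ) (Set.Ioi 0),
      l v < l x → l v + ε * g v < l x + ε * g x := by
    intro v hv
    by_cases h : l v < l x
    · have hc : Filter.Tendsto (fun ε : ℝ => (l x + ε * g x) - (l v + ε * g v)) (nhds 0)
          (nhds ((l x + 0 * g x) - (l v + 0 * g v))) := by
        apply Continuous.tendsto (f := fun ε : ℝ => (l x + ε * g x) - (l v + ε * g v))
        fun_prop
      have h0 : 0 < (l x + 0 * g x) - (l v + 0 * g v) := by simpa using h
      exact ((hc.eventually_const_lt h0).filter_mono nhdsWithin_le_nhds).mono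
        fun ε hε _ => by linarith
    · exact Filter.Eventually.of_forall fun ε h' => absurd h' h
  obtain ⟨ε, hε, hε0⟩ := ((s.eventually_all.2 hpos).and self_mem_nhdsWithin).exists
  have hε0 : 0 < ε := hε0
  set f : StrongDual ℝ E := l + ε • g with hf
  have hfv : ∀ v, f v = l v + ε * g v := fun v => by simp [hf]
  obtain ⟨w, hwQ, hw⟩ := (s.finite_toSet.isCompact_convexHull (𝕜 := ℝ)).exists_isMaxOn ⟨x, hxQ⟩
    f.continuous.continuousOn
  have hw : ∀ y ∈ convexHull ℝ (s : Set E), f y ≤ f w := hw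
  have hG : ∀ z ∈ f.toExposed (convexHull ℝ (s : Set E)), l z = l x := by
    rintro z ⟨hzQ, hz⟩
    have h1 := mem_convexHull_of_apply_eq f (fun v hv => hz v (hss v hv)) hzQ rfl
    refine le_antisymm (hmax z hzQ) ?_
    have h2 : ∀ v ∈ {v ∈ (s : Set E) | f v = f z}, (-l) v ≤ -l x := by
      rintro v ⟨hv, hvz⟩
      by_contra hlt
      have h3 := hε v hv (by simpa using hlt)
      have h4 := hz x hxQ
      rw [← hvz, hfv, hfv] at h4
      linarith
    have h5 := convexHull_apply_le (-l) h2 h1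
    simpa using h5
  have hsub : f.toExposed (convexHull ℝ (s : Set E)) ⊆ F := by
    intro z hz
    rw [hl]
    exact ⟨hz.1, fun y hy => (hG z hz).symm ▸ hmax y hy⟩
  refine ⟨_, ContinuousLinearMap.toExposed.isExposed, ⟨w, hwQ, hw⟩, hsub, fun hFsub => ?_⟩
  have h1 := (hFsub hx).2 x' (hF.subset hx')
  have h2 := hG x' (hFsub hx')
  rw [hfv, hfv, h2] at h1
  nlinarith

variable {d : ℕ} {ι : Type*}

local notation "𝔼" => EuclideanSpace ℝ (Fin d)

/-- The bipolar theorem, by separation from a point outside. -/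
theorem polarDual_polarDual {Q : Set 𝔼} (hc : Convex ℝ Q) (hcl : IsClosed Q) (h0 : 0 ∈ Q) :
    polarDual (polarDual Q) = Q := by
  refine Set.Subset.antisymm (fun x hx => ?_) fun x hx y hy => ?_
  · by_contra hxQ
    obtain ⟨f, u, hf, hu⟩ := geometric_hahn_banach_closed_point hc hcl hxQ
    have hu0 : 0 < u := by simpa using hf 0 h0
    set y := (InnerProductSpace.toDual ℝ 𝔼).symm f
    have hy : ∀ z, inner ℝ z y = f z := fun z => by
      rw [real_inner_comm, InnerProductSpace.toDual_symm_apply]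
    have h1 : u⁻¹ • y ∈ polarDual Q := by
      intro z hz
      rw [inner_smul_right, hy, inv_mul_le_iff₀ hu0, mul_one]
      exact (hf z hz).le
    have h2 := hx _ h1
    rw [real_inner_comm, inner_smul_right, hy, inv_mul_le_iff₀ hu0, mul_one] at h2
    linarith
  · rw [real_inner_comm]
    exact hy x hx

theorem exists_pos_smul_mem {Q : Set 𝔼} (h0 : 0 ∈ interior Q) (y : 𝔼) :
    ∃ ε : ℝ, 0 < ε ∧ ε • y ∈ Q := by
  have hc : Filter.Tendsto (fun ε : ℝ => ε • y) (nhds 0) (nhds ((0 : ℝ) • y)) :=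
    (by fun_prop : Continuous fun ε : ℝ => ε • y).tendsto 0
  rw [zero_smul] at hc
  have h1 := (hc.eventually (mem_interior_iff_mem_nhds.1 h0)).filter_mono
    (nhdsWithin_le_nhds (s := Set.Ioi 0))
  obtain ⟨ε, hε, hpos⟩ := (h1.and self_mem_nhdsWithin).exists
  exact ⟨ε, hpos, hε⟩

theorem isCompact_polarDual {Q : Set 𝔼} (h0 : 0 ∈ interior Q) : IsCompact (polarDual Q) := by
  refine Metric.isCompact_of_isClosed_isBounded ?_ ?_
  · have : polarDual Q = ⋂ x ∈ Q, {y | inner ℝ x y ≤ 1} := by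
      ext; simp [polarDual]
    rw [this]
    exact isClosed_biInter fun x _ => isClosed_le (by fun_prop) continuous_const
  · obtain ⟨r, hr, hball⟩ := Metric.isOpen_iff.1 isOpen_interior 0 h0
    refine (Metric.isBounded_closedBall (x := (0 : 𝔼)) (r := 2 / r)).subset fun y hy => ?_
    rw [mem_closedBall_zero_iff]
    by_cases hy0 : y = 0
    · simp [hy0]; positivity
    have hn : 0 < ‖y‖ := norm_pos_iff.2 hy0
    have h1 := hy ((r / 2 / ‖y‖) • y) (interior_subset (hball (by
      rw [mem_ball_zero_iff, norm_smul, Real.norm_of_nonneg (by positivity),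
        div_mul_cancel₀ _ hn.ne']
      linarith)))
    rw [real_inner_smul_left, real_inner_self_eq_norm_sq] at h1
    rw [le_div_iff₀ hr]
    have h2 : r / 2 / ‖y‖ * ‖y‖ ^ 2 = r / 2 * ‖y‖ := by field_simp
    rw [h2] at h1
    linarith

/-- The boundary faces of a polytope around the origin are cut out by the points of its polar. -/
theorem isBoundaryFace_iff {Q F : Set 𝔼} (h0 : 0 ∈ interior Q) :
    (IsFace Q F ∧ F ≠ Q) ↔
      ∃ y ∈ polarDual Q, F = {x ∈ Q | inner ℝ x y = 1} := by
  have h0Q := interior_subset h0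
  constructor
  · rintro ⟨hF, hne⟩
    rcases Set.eq_empty_or_nonempty F with rfl | ⟨w, hw⟩
    · exact ⟨0, fun x _ => by simp, by simp⟩
    obtain ⟨l, hl⟩ := hF ⟨w, hw⟩
    set y := (InnerProductSpace.toDual ℝ 𝔼).symm l
    have hy : ∀ z, inner ℝ z y = l z := fun z => by
      rw [real_inner_comm, InnerProductSpace.toDual_symm_apply]
    have hw' := hw
    rw [hl] at hw'
    have hy0 : y ≠ 0 := by
      intro hy0
      refine hne (hl.trans ?_)
      have : ∀ z, l z = 0 := fun z => by rw [← hy, hy0, inner_zero_right]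
      ext z
      simp [this]
    have hm : 0 < l w := by
      obtain ⟨ε, hε, hmem⟩ := exists_pos_smul_mem h0 y
      have h1 := hw'.2 _ hmem
      rw [← hy, real_inner_smul_left, real_inner_self_eq_norm_sq] at h1
      have : 0 < ε * ‖y‖ ^ 2 := by have := norm_pos_iff.2 hy0; positivity
      linarith
    have hin : ∀ x, inner ℝ x ((l w)⁻¹ • y) = (l w)⁻¹ * l x := fun x => by
      rw [inner_smul_right, hy]
    refine ⟨(l w)⁻¹ • y, fun x hx => ?_, ?_⟩
    · rw [hin, inv_mul_le_iff₀ hm, mul_one]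
      exact hw'.2 x hx
    · rw [hl]
      ext x
      simp only [Set.mem_ofPred_eq, hin]
      refine and_congr_right fun hx => ⟨fun h => ?_, fun h z hz => ?_⟩
      · rw [le_antisymm (hw'.2 x hx) (h w hw'.1), inv_mul_cancel₀ hm.ne']
      · rw [inv_mul_eq_one₀ hm.ne'] at h
        rw [← h]
        exact hw'.2 z hz
  · rintro ⟨y, hy, rfl⟩
    refine ⟨fun ⟨w, hw⟩ => ⟨innerSL ℝ y, ?_⟩, fun h => ?_⟩
    · ext x
      simp only [Set.mem_ofPred_eq, innerSL_apply_apply]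
      refine and_congr_right fun hx => ⟨fun h z hz => ?_, fun h => ?_⟩
      · rw [real_inner_comm, real_inner_comm x, h]
        exact hy z hz
      · refine le_antisymm (hy x hx) ?_
        rw [← hw.2, real_inner_comm, real_inner_comm y x]
        exact h w hw.1
    · rw [← h] at h0Q
      simpa using h0Q.2

/-- The functionals given by the inner products with the vectors `a i`. -/
noncomputable def innerFamily (a : ι → 𝔼) (i : ι) : StrongDual ℝ 𝔼 := innerSL ℝ (a i)

@[simp] theorem innerFamily_apply (a : ι → 𝔼) (i : ι) (y : 𝔼) :
    innerFamily a i y = inner ℝ (a i) y := rfl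

/-- The convex hull of the vectors `a i` and the origin.  The origin is added for the sake of the
zero-dimensional case, where there need not be any vectors. -/
def hullZero (a : ι → 𝔼) : Set 𝔼 := convexHull ℝ (insert 0 (Set.range a))

theorem polarDual_hullZero (a : ι → 𝔼) :
    polarDual (hullZero a) = polyhedron (innerFamily a) := by
  ext y
  constructor
  · intro hy i
    exact hy _ (subset_convexHull ℝ _ (Or.inr ⟨i, rfl⟩))
  · intro hy x hx
    rw [real_inner_comm]
    refine convexHull_apply_le (innerSL ℝ y) (m := 1) ?_ hx
    rintro v (rfl | ⟨i, rfl⟩)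
    · simp
    · rw [innerSL_apply_apply, real_inner_comm]
      exact hy i

theorem isPolytope_hullZero [Finite ι] (a : ι → 𝔼) : IsPolytope (hullZero a) :=
  ⟨((Set.finite_range a).insert 0).toFinset, by simp [hullZero]⟩

/-- The origin is interior to the convex hull if no nonzero direction has nonpositive inner
product with all the vectors: by compactness of the sphere, some inner product is bounded below. -/
theorem zero_mem_interior_hullZero [Finite ι] {a : ι → 𝔼}
    (h : ∀ y, (∀ i, inner ℝ (a i) y ≤ 0) → y = 0) : 0 ∈ interior (hullZero a) := by
  have hcl := (isPolytope_hullZero a).isCompact.isClosed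
  by_contra h0
  have hfreq : ∀ n : ℕ, ∃ x : 𝔼, ‖x‖ < 1 / (n + 1) ∧ x ∉ hullZero a := by
    intro n
    by_contra! hcon
    refine h0 (mem_interior.2 ⟨Metric.ball 0 (1 / (n + 1)), fun x hx => hcon x ?_,
      Metric.isOpen_ball, Metric.mem_ball_self (by positivity)⟩)
    simpa using hx
  have hsep : ∀ n : ℕ, ∃ y : 𝔼, ‖y‖ = 1 ∧ ∀ i, inner ℝ (a i) y ≤ 1 / ((n : ℝ) + 1) := by
    intro n
    obtain ⟨x, hx, hxD⟩ := hfreq n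
    obtain ⟨f, u, hf, hu⟩ := geometric_hahn_banach_closed_point (convex_convexHull ℝ _) hcl hxD
    have hu0 : 0 < u := by simpa using hf 0 (subset_convexHull ℝ _ (Or.inl rfl))
    set y := (InnerProductSpace.toDual ℝ 𝔼).symm f
    have hy : ∀ z, inner ℝ z y = f z := fun z => by
      rw [real_inner_comm, InnerProductSpace.toDual_symm_apply]
    have hy0 : 0 < ‖y‖ := by
      rw [norm_pos_iff]
      intro hy0
      have := hy x
      rw [hy0, inner_zero_right] at this
      linarith
    refine ⟨‖y‖⁻¹ • y, by rw [norm_smul, norm_inv, norm_norm, inv_mul_cancel₀ hy0.ne'],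
      fun i => ?_⟩
    rw [inner_smul_right, inv_mul_le_iff₀ hy0]
    have h1 := hf (a i) (subset_convexHull ℝ _ (Or.inr ⟨i, rfl⟩))
    have h2 := real_inner_le_norm x y
    rw [hy] at h2
    rw [hy]
    have h3 : ‖x‖ * ‖y‖ ≤ 1 / (n + 1) * ‖y‖ := by gcongr
    linarith [hf (a i) (subset_convexHull ℝ _ (Or.inr ⟨i, rfl⟩))]
  choose y hy1 hy2 using hsep
  obtain ⟨z, hz, φ, hφ, hlim⟩ := (isCompact_sphere (0 : 𝔼) 1).tendsto_subseq
    (fun n => by simpa using hy1 n)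
  have hz0 : z = 0 := by
    refine h z fun i => ?_
    have h1 : Filter.Tendsto (fun n => inner ℝ (a i) (y (φ n))) Filter.atTop
        (nhds (inner ℝ (a i) z)) :=
      ((by fun_prop : Continuous fun y : 𝔼 => inner ℝ (a i) y).tendsto z).comp hlim
    exact le_of_tendsto_of_tendsto' h1
      (tendsto_one_div_add_atTop_nhds_zero_nat.comp hφ.tendsto_atTop) fun n => hy2 _ i
  simp [hz0] at hz

end Polarity

/-! ### Simplicial polytopes with prescribed boundary complex -/

section Realizations

variable {d : ℕ} {ι : Type*}

local notation "𝔼" => EuclideanSpace ℝ (Fin d)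

theorem zero_mem_polyhedron (a : ι → 𝔼) : (0 : 𝔼) ∈ polyhedron (innerFamily a) := by
  intro i
  simp

theorem polarDual_polyhedron [Finite ι] (a : ι → 𝔼) :
    polarDual (polyhedron (innerFamily a)) = hullZero a := by
  rw [← polarDual_hullZero]
  exact polarDual_polarDual (convex_convexHull ℝ _) (isPolytope_hullZero a).isCompact.isClosed
    (subset_convexHull ℝ _ (Or.inl rfl))

/-- The linear subspace of directions in which the inequalities of `S` stay tight. -/
noncomputable def tightSpace (a : ι → EuclideanSpace ℝ (Fin d)) (S : Finset ι) :
    Submodule ℝ (EuclideanSpace ℝ (Fin d)) :=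
  (Submodule.span ℝ (Set.range fun i : S => a i))ᗮ

theorem mem_tightSpace {a : ι → 𝔼} {S : Finset ι} {z : 𝔼} :
    z ∈ tightSpace a S ↔ ∀ i ∈ S, inner ℝ (a i) z = 0 := by
  rw [tightSpace, Submodule.mem_orthogonal]
  constructor
  · intro h i hi
    exact h _ (Submodule.subset_span ⟨⟨i, hi⟩, rfl⟩)
  · intro h u hu
    induction hu using Submodule.span_induction with
    | mem x hx => obtain ⟨i, rfl⟩ := hx; exact h i i.2
    | zero => simp
    | add x y _ _ hx hy => rw [inner_add_left, hx, hy, add_zero]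
    | smul c x _ hx => rw [real_inner_smul_left, hx, mul_zero]

theorem isFace_subface (a : ι → 𝔼) (S : Finset ι) :
    IsFace (polyhedron (innerFamily a)) (subface (innerFamily a) S) := by
  rw [← subface_empty]
  exact isExposed_subface (Finset.empty_subset S)

variable [Fintype ι]

/-- The vectors `a i` are the vertices of a simplicial polytope around the origin whose boundary
complex is the simplicial complex `K`; vertices of `K` are those `i` with `{i} ∈ K`.  The second
condition expresses this through the polar polytope. -/
structure IsRealization (a : ι → EuclideanSpace ℝ (Fin d)) (K : Set (Finset ι)) : Prop where
  zero_mem : 0 ∈ interior (hullZero a)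
  realizes : Realizes (innerFamily a) K
  downward : ∀ S ∈ K, ∀ S' ⊆ S, S' ∈ K

namespace IsRealization

variable {a : ι → EuclideanSpace ℝ (Fin d)} {K : Set (Finset ι)}

theorem empty_mem (h : IsRealization a K) : ∅ ∈ K :=
  h.downward _ (h.realizes.1 0 (zero_mem_polyhedron a)) _ (Finset.empty_subset _)

theorem isCompact_polyhedron (h : IsRealization a K) : IsCompact (polyhedron (innerFamily a)) := by
  rw [← polarDual_hullZero]
  exact isCompact_polarDual h.zero_mem

theorem linearIndependent (h : IsRealization a K) {S : Finset ι} (hS : S ∈ K) :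
    LinearIndependent ℝ (fun i : S => a i) := by
  rw [Fintype.linearIndependent_iff]
  intro g hg
  refine Fintype.linearIndependent_iff.1 (h.realizes.linearIndependent h.downward hS) g ?_
  ext y
  have h1 := congrArg (fun x => inner ℝ x y) hg
  simp only [sum_inner, real_inner_smul_left, inner_zero_left] at h1
  simpa using h1

theorem finrank_tightSpace (h : IsRealization a K) {S : Finset ι} (hS : S ∈ K) :
    Module.finrank ℝ (tightSpace a S) + S.card = d := by
  have h1 := Submodule.finrank_add_finrank_orthogonal
    (Submodule.span ℝ (Set.range fun i : S => a i))
  rw [finrank_span_eq_card (h.linearIndependent hS), finrank_euclideanSpace_fin,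
    Fintype.card_coe] at h1
  rw [tightSpace]
  omega

theorem vectorSpan_subface (h : IsRealization a K) {S : Finset ι} (hS : S ∈ K) :
    vectorSpan ℝ (subface (innerFamily a) S) = tightSpace a S := by
  apply le_antisymm
  · rw [vectorSpan_def, Submodule.span_le]
    rintro _ ⟨x, hx, y, hy, rfl⟩
    refine mem_tightSpace.2 fun i hi => ?_
    have h1 := hx.2 i hi
    have h2 := hy.2 i hi
    rw [innerFamily_apply] at h1 h2
    change inner ℝ (a i) (x - y) = 0
    rw [inner_sub_right, h1, h2, sub_self]
  · intro z hz
    rw [mem_tightSpace] at hz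
    obtain ⟨y, hy, rfl⟩ := h.realizes.2 S hS
    obtain ⟨ε, hε, hmem⟩ := exists_pos_add_smul_mem_polyhedron (z := z) hy
      (fun i hi => (hz i hi).le)
    have h1 : ε • z ∈ vectorSpan ℝ (subface (innerFamily a) (tight (innerFamily a) y)) := by
      have := vsub_mem_vectorSpan ℝ
        (s := subface (innerFamily a) (tight (innerFamily a) y)) (p₁ := y + ε • z) (p₂ := y)
        ⟨hmem, fun i hi => by
          have h2 := mem_tight.1 hi
          rw [innerFamily_apply] at h2 ⊢
          rw [inner_add_right, inner_smul_right, hz i hi, h2, mul_zero, add_zero]⟩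
        (mem_subface.2 ⟨hy, subset_rfl⟩)
      simpa using this
    exact (Submodule.smul_mem_iff _ hε.ne').1 h1

/-- Every label has linearly independent vectors, hence every tight inequality lowers the dimension
by one. -/
theorem polytopeDim_subface (h : IsRealization a K) {S : Finset ι} (hS : S ∈ K) :
    polytopeDim (subface (innerFamily a) S) + S.card = d := by
  rw [polytopeDim, h.vectorSpan_subface hS, h.finrank_tightSpace hS]

theorem polytopeDim_polyhedron (h : IsRealization a K) :
    polytopeDim (polyhedron (innerFamily a)) = d := by
  have := h.polytopeDim_subface h.empty_mem
  rwa [subface_empty, Finset.card_empty, add_zero] at this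

theorem card_le (h : IsRealization a K) {S : Finset ι} (hS : S ∈ K) : S.card ≤ d :=
  h.finrank_tightSpace hS ▸ Nat.le_add_left _ _

/-- In a nonzero direction that keeps the tight inequalities of `y` tight, one can move until
another inequality becomes tight. -/
theorem exists_tight_ssubset (h : IsRealization a K) {y z : 𝔼}
    (hy : y ∈ polyhedron (innerFamily a)) (hz : z ∈ tightSpace a (tight (innerFamily a) y))
    (hz0 : z ≠ 0) :
    ∃ y' ∈ polyhedron (innerFamily a), tight (innerFamily a) y ⊂ tight (innerFamily a) y' := by
  rw [mem_tightSpace] at hz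
  have hcl : IsCompact {t : ℝ | y + t • z ∈ polyhedron (innerFamily a)} := by
    have hemb : Topology.IsClosedEmbedding fun t : ℝ => y + t • z :=
      (Homeomorph.addLeft y).isClosedEmbedding.comp (isClosedEmbedding_smul_left hz0)
    exact hemb.isCompact_preimage h.isCompact_polyhedron
  obtain ⟨t, ht, hmax⟩ := hcl.exists_isGreatest ⟨0, by simpa using hy⟩
  have htight : tight (innerFamily a) y ⊆ tight (innerFamily a) (y + t • z) := by
    intro i hi
    have h2 := mem_tight.1 hi
    rw [mem_tight]
    rw [innerFamily_apply] at h2 ⊢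
    rw [inner_add_right, inner_smul_right, hz i hi, h2, mul_zero, add_zero]
  refine ⟨_, ht, htight, fun hsub => ?_⟩
  obtain ⟨ε, hε, hmem⟩ := exists_pos_add_smul_mem_polyhedron (z := z) ht
    (fun i hi => (hz i (hsub hi)).le)
  have h1 := hmax (a := t + ε) (by
    rw [Set.mem_ofPred_eq, add_smul, ← add_assoc]
    exact hmem)
  linarith

/-- A point with a maximal set of tight inequalities admits no direction that keeps them tight. -/
theorem exists_card_eq (h : IsRealization a K) : ∃ S ∈ K, S.card = d := by
  obtain ⟨y, hy, hmax⟩ := exists_maximalFor_of_wellFoundedGT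
    (· ∈ polyhedron (innerFamily a)) (fun y => tight (innerFamily a) y)
    ⟨0, zero_mem_polyhedron a⟩
  have hK := h.realizes.1 y hy
  refine ⟨_, hK, ?_⟩
  have hbot : tightSpace a (tight (innerFamily a) y) = ⊥ := by
    rw [Submodule.eq_bot_iff]
    intro z hz
    by_contra hz0
    obtain ⟨y', hy', hss⟩ := h.exists_tight_ssubset hy hz hz0
    exact hss.2 (hmax hy' hss.1)
  have := h.finrank_tightSpace hK
  rwa [hbot, finrank_bot, zero_add] at this

/-- At an extreme point the tight inequalities determine the point, so there are finitely many
extreme points and the polyhedron is their convex hull by the Krein-Milman theorem. -/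
theorem isPolytope_polyhedron (h : IsRealization a K) :
    IsPolytope (polyhedron (innerFamily a)) := by
  have hfin : (Set.extremePoints ℝ (polyhedron (innerFamily a))).Finite := by
    refine Set.Finite.of_finite_image (f := fun y => tight (innerFamily a) y) (Set.toFinite _) ?_
    intro y hy y' hy' heq
    by_contra hne
    have hz : y' - y ∈ tightSpace a (tight (innerFamily a) y) := by
      refine mem_tightSpace.2 fun i hi => ?_
      have h1 := mem_tight.1 hi
      have heq : tight (innerFamily a) y = tight (innerFamily a) y' := heq
      have h2 := mem_tight.1 (heq ▸ hi)
      rw [innerFamily_apply] at h1 h2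
      rw [inner_sub_right, h1, h2, sub_self]
    rw [mem_tightSpace] at hz
    obtain ⟨ε, hε, hmem⟩ := exists_pos_add_smul_mem_polyhedron (z := y - y') hy.1
      (fun i hi => by
        have := hz i hi
        rw [innerFamily_apply, ← neg_sub, inner_neg_right, this, neg_zero])
    have hseg : y ∈ openSegment ℝ y' (y + ε • (y - y')) := by
      have hpos : 0 < 1 + ε := by linarith
      refine ⟨ε / (1 + ε), 1 / (1 + ε), by positivity, by positivity, by field_simp; ring, ?_⟩
      have h1 : (1 / (1 + ε)) • (y + ε • (y - y')) = ((1 + ε) / (1 + ε)) • y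
          - (ε / (1 + ε)) • y' := by
        module
      rw [h1, div_self hpos.ne', one_smul]
      abel
    exact hne (hy.2 hy'.1 hmem hseg).symm
  refine ⟨hfin.toFinset, ?_⟩
  rw [Set.Finite.coe_toFinset]
  conv_lhs => rw [← closure_convexHull_extremePoints h.isCompact_polyhedron (convex_polyhedron _)]
  exact (hfin.isCompact_convexHull (𝕜 := ℝ)).isClosed.closure_eq

theorem exists_eq_subface (h : IsRealization a K) {F : Set 𝔼}
    (hF : IsFace (polyhedron (innerFamily a)) F) (hne : F.Nonempty) :
    ∃ S ∈ K, F = subface (innerFamily a) S := by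
  rw [← subface_empty] at hF
  obtain ⟨S, hS, -, rfl⟩ := h.realizes.exists_eq_subface hF hne
  exact ⟨S, hS, rfl⟩

theorem isFacet_iff (h : IsRealization a K) {F : Set 𝔼} :
    IsFacet (polyhedron (innerFamily a)) F ↔
      ∃ i, {i} ∈ K ∧ F = subface (innerFamily a) {i} := by
  constructor
  · rintro ⟨hF, hne, hdim⟩
    obtain ⟨S, hS, rfl⟩ := h.exists_eq_subface hF hne
    rw [h.polytopeDim_polyhedron] at hdim
    have h1 := h.polytopeDim_subface hS
    obtain ⟨i, rfl⟩ := Finset.card_eq_one.1 (show S.card = 1 by omega)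
    exact ⟨i, hS, rfl⟩
  · rintro ⟨i, hi, rfl⟩
    refine ⟨isFace_subface _ _, h.realizes.subface_nonempty hi, ?_⟩
    rw [h.polytopeDim_polyhedron]
    exact h.polytopeDim_subface hi

theorem exists_eq_singleton_iff (h : IsRealization a K) {F : Set 𝔼} :
    (∃ v, IsVertex (polyhedron (innerFamily a)) v ∧ F = {v}) ↔
      ∃ S ∈ K, S.card = d ∧ F = subface (innerFamily a) S := by
  constructor
  · rintro ⟨v, hv, rfl⟩
    obtain ⟨S, hS, heq⟩ := h.exists_eq_subface hv (Set.singleton_nonempty v)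
    refine ⟨S, hS, ?_, heq⟩
    have h1 := h.polytopeDim_subface hS
    rw [← heq, polytopeDim, vectorSpan_singleton, finrank_bot] at h1
    omega
  · rintro ⟨S, hS, hcard, rfl⟩
    have h1 := h.polytopeDim_subface hS
    rw [hcard, polytopeDim] at h1
    have h2 : vectorSpan ℝ (subface (innerFamily a) S) = ⊥ :=
      Submodule.finrank_eq_zero.1 (by omega)
    have h3 := (vectorSpan_eq_bot_iff_subsingleton ℝ).1 h2
    obtain ⟨v, hv⟩ := h.realizes.subface_nonempty hS
    have h4 := h3.eq_singleton_of_mem hv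
    exact ⟨v, (show IsFace _ {v} from h4 ▸ isFace_subface a S), h4⟩

/-- The facets through the vertex labelled by `S` are the `d` facets labelled by elements of `S`. -/
theorem isSimplePolytope (h : IsRealization a K) :
    IsSimplePolytope (polyhedron (innerFamily a)) := by
  refine ⟨h.isPolytope_polyhedron, fun v hv => ?_⟩
  obtain ⟨S, hS, hcard, heq⟩ := h.exists_eq_singleton_iff.1 ⟨v, hv, rfl⟩
  have hset : {F | IsFacet (polyhedron (innerFamily a)) F ∧ v ∈ F} =
      (fun i => subface (innerFamily a) {i}) '' (S : Set ι) := by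
    ext F
    rw [Set.mem_ofPred_eq, h.isFacet_iff, ← Set.singleton_subset_iff, heq]
    constructor
    · rintro ⟨⟨i, hi, rfl⟩, hsub⟩
      rw [h.realizes.subface_subset_iff hS, Finset.singleton_subset_iff] at hsub
      exact ⟨i, hsub, rfl⟩
    · rintro ⟨i, hi, rfl⟩
      have hsub := Finset.singleton_subset_iff.2 (Finset.mem_coe.1 hi)
      exact ⟨⟨i, h.downward S hS _ hsub, rfl⟩, (h.realizes.subface_subset_iff hS).2 hsub⟩
  rw [hset, Set.InjOn.encard_image, Set.encard_coe_eq_coe_finsetCard, hcard,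
    h.polytopeDim_polyhedron]
  intro i hi j hj hij
  have hK : ∀ k ∈ S, {k} ∈ K := fun k hk =>
    h.downward S hS _ (Finset.singleton_subset_iff.2 hk)
  simpa using h.realizes.subface_injOn (hK i hi) (hK j hj) hij

/-- The boundary face cut out by `y` is spanned by the vectors whose inequality is tight at `y`. -/
theorem hullZero_inter_eq {y : 𝔼} (hy : y ∈ polyhedron (innerFamily a)) :
    {x ∈ hullZero a | inner ℝ x y = 1} = convexHull ℝ (a '' tight (innerFamily a) y) := by
  apply Set.Subset.antisymm
  · rintro x ⟨hx, hxy⟩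
    have h1 := mem_convexHull_of_apply_eq (innerSL ℝ y) (m := 1) (by
      rintro v (rfl | ⟨i, rfl⟩)
      · simp
      · rw [innerSL_apply_apply, real_inner_comm]
        exact hy i) hx (by rw [innerSL_apply_apply, real_inner_comm, hxy])
    refine convexHull_mono ?_ h1
    rintro v ⟨rfl | ⟨i, rfl⟩, hv⟩
    · simp at hv
    · refine ⟨i, ?_, rfl⟩
      rw [innerSL_apply_apply, real_inner_comm] at hv
      exact mem_tight.2 hv
  · refine convexHull_min ?_ ?_
    · rintro _ ⟨i, hi, rfl⟩
      exact ⟨subset_convexHull ℝ _ (Or.inr ⟨i, rfl⟩), mem_tight.1 hi⟩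
    · refine (convex_convexHull ℝ _).inter (t := {x | inner ℝ x y = 1}) ?_
      have h1 := convex_hyperplane (innerSL ℝ y).toLinearMap.isLinear 1
      have h2 : {x : 𝔼 | inner ℝ x y = 1} = {x | (innerSL ℝ y).toLinearMap x = 1} := by
        ext x
        rw [Set.mem_ofPred_eq, real_inner_comm]
        rfl
      rw [h2]
      exact h1

theorem isBoundaryFace_iff (h : IsRealization a K) {F : Set 𝔼} :
    (IsFace (hullZero a) F ∧ F ≠ hullZero a) ↔ ∃ S ∈ K, F = convexHull ℝ (a '' S) := by
  rw [_root_.isBoundaryFace_iff h.zero_mem, polarDual_hullZero]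
  constructor
  · rintro ⟨y, hy, rfl⟩
    exact ⟨_, h.realizes.1 y hy, hullZero_inter_eq hy⟩
  · rintro ⟨S, hS, rfl⟩
    obtain ⟨y, hy, rfl⟩ := h.realizes.2 S hS
    exact ⟨y, hy, (hullZero_inter_eq hy).symm⟩

theorem mem_convexHull_image_iff (h : IsRealization a K) {S : Finset ι} (hS : S ∈ K) {i : ι} :
    a i ∈ convexHull ℝ (a '' S) ↔ i ∈ S := by
  refine ⟨fun hi => ?_, fun hi => subset_convexHull ℝ _ ⟨i, hi, rfl⟩⟩
  obtain ⟨y, hy, rfl⟩ := h.realizes.2 S hS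
  rw [← hullZero_inter_eq hy] at hi
  exact mem_tight.2 hi.2

theorem convexHull_image_subset_iff (h : IsRealization a K) {S S' : Finset ι} (hS' : S' ∈ K) :
    convexHull ℝ (a '' S) ⊆ convexHull ℝ (a '' S') ↔ S ⊆ S' :=
  ⟨fun hsub _ hi => (h.mem_convexHull_image_iff hS').1
    (hsub (subset_convexHull ℝ _ ⟨_, hi, rfl⟩)),
    fun hsub => convexHull_mono (Set.image_mono hsub)⟩

/-- The boundary complex of the polytope is isomorphic to `K`. -/
noncomputable def boundaryIso (h : IsRealization a K) :
    {S : Finset ι // S ∈ K} ≃o BoundaryFaces (hullZero a) where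
  toEquiv := Equiv.ofBijective
    (fun S => ⟨convexHull ℝ (a '' S.1), h.isBoundaryFace_iff.2 ⟨S.1, S.2, rfl⟩⟩)
    ⟨fun S S' heq => by
      have heq := congrArg Subtype.val heq
      exact Subtype.ext (((h.convexHull_image_subset_iff S'.2).1 heq.subset).antisymm
        ((h.convexHull_image_subset_iff S.2).1 heq.symm.subset)), fun F => by
      obtain ⟨S, hS, heq⟩ := h.isBoundaryFace_iff.1 F.2
      exact ⟨⟨S, hS⟩, Subtype.ext heq.symm⟩⟩
  map_rel_iff' {_ S'} := h.convexHull_image_subset_iff S'.2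

/-- The boundary face labelled by `S` is the simplex with vertices `a i`, `i ∈ S`. -/
theorem isSimplicialPolytope (h : IsRealization a K) : IsSimplicialPolytope (hullZero a) := by
  classical
  refine ⟨isPolytope_hullZero a, fun F hF hne => ?_⟩
  obtain ⟨S, hS, rfl⟩ := h.isBoundaryFace_iff.1 ⟨hF, hne⟩
  refine ⟨S.image a, ?_, by rw [Finset.coe_image]⟩
  refine (h.linearIndependent hS).affineIndependent.range.mono
    (s := ((S.image a : Finset 𝔼) : Set 𝔼)) ?_
  intro x hx
  obtain ⟨i, hi, rfl⟩ := Finset.mem_image.1 (Finset.mem_coe.1 hx)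
  exact ⟨⟨i, hi⟩, rfl⟩

end IsRealization

end Realizations

/-! ### Poset associahedra as realizations of the tubing complex -/

section TubingComplex

variable {P : Type*} [PartialOrder P]

theorem IsTubing.mono {T T' : Finset (Finset P)} (hT : IsTubing T) (h : T' ⊆ T) : IsTubing T' := by
  refine ⟨fun τ hτ => hT.1 τ (h hτ), fun τ hτ τ' hτ' => hT.2.1 τ (h hτ) τ' (h hτ'),
    fun τ hτ => hT.2.2 τ (Relation.TransGen.mono
      (fun σ σ' hσ => ⟨h hσ.1, h hσ.2.1, hσ.2.2⟩) _ _ hτ)⟩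

variable [Fintype P]

theorem IsProperTubing.mono {T T' : Finset (Finset P)} (hT : IsProperTubing T) (h : T' ⊆ T) :
    IsProperTubing T' :=
  ⟨hT.1.mono h, fun τ hτ => hT.2 τ (h hτ)⟩

theorem isProperTubing_empty : IsProperTubing (∅ : Finset (Finset P)) := by
  refine ⟨⟨by simp, by simp, fun τ hτ => ?_⟩, by simp⟩
  obtain ⟨ρ, hρ, -⟩ := Relation.TransGen.head'_iff.1 hτ
  simpa using hρ.1

/-- The simplicial complex of proper tubings. -/
def tubingComplex (P : Type*) [PartialOrder P] [Fintype P] : Set (Finset (Finset P)) :=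
  {T | IsProperTubing T}

@[simp] theorem mem_tubingComplex {T : Finset (Finset P)} :
    T ∈ tubingComplex P ↔ IsProperTubing T := Iff.rfl

theorem singleton_mem_tubingComplex {τ : Finset P} :
    {τ} ∈ tubingComplex P ↔ IsProperTube τ :=
  ⟨fun h => h.2 τ (Finset.mem_singleton_self τ), isProperTubing_singleton⟩

theorem ProperTubing.single_le_iff {τ : Finset P} (hτ : IsProperTube τ) {T : ProperTubing P} :
    ProperTubing.single τ hτ ≤ T ↔ τ ∈ T.1 :=
  Finset.singleton_subset_iff

variable {d : ℕ}

/-- A realization of the complex of proper tubings gives a poset associahedron. -/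
noncomputable def IsRealization.posetAssociahedron
    {a : Finset P → EuclideanSpace ℝ (Fin d)} (h : IsRealization a (tubingComplex P)) :
    PosetAssociahedron P d where
  dual := hullZero a
  isPolytope_dual := isPolytope_hullZero a
  zero_mem_interior := h.zero_mem
  boundaryIso := h.boundaryIso.symm

namespace PosetAssociahedron

variable (A : PosetAssociahedron P d)

local notation "𝔼" => EuclideanSpace ℝ (Fin d)

/-- A boundary face labelled by a single proper tube is a point: it contains no smaller nonempty
face. -/
theorem exists_boundaryIso_symm_eq_singleton {τ : Finset P} (hτ : IsProperTube τ) :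
    ∃ v, (A.boundaryIso.symm (ProperTubing.single τ hτ)).1 = {v} := by
  set F := A.boundaryIso.symm (ProperTubing.single τ hτ)
  have h0 : (0 : 𝔼) ∈ A.dual := interior_subset A.zero_mem_interior
  let B : BoundaryFaces A.dual := ⟨∅, isExposed_empty, fun h => by rw [← h] at h0; exact h0⟩
  have hB : ∀ G : BoundaryFaces A.dual, B ≤ G := fun G => Set.empty_subset _
  -- the label of a face strictly inside `F` is empty
  have hlt : ∀ G : BoundaryFaces A.dual, G < F → G = B := by
    intro G hG
    have h1 : A.boundaryIso G < ProperTubing.single τ hτ := by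
      rw [← A.boundaryIso.apply_symm_apply (ProperTubing.single τ hτ)]
      exact A.boundaryIso.lt_iff_lt.2 hG
    have h2 : (A.boundaryIso G).1 = ∅ := Finset.ssubset_singleton_iff.1 h1
    have h3 : A.boundaryIso G ≤ A.boundaryIso B := by
      rw [← Subtype.coe_le_coe, h2]
      exact Finset.empty_subset _
    exact le_antisymm (A.boundaryIso.le_iff_le.1 h3) (hB G)
  have hne : F.1.Nonempty := by
    rw [Set.nonempty_iff_ne_empty]
    intro hemp
    have h1 : F ≤ A.boundaryIso.symm ⟨∅, isProperTubing_empty⟩ := by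
      rw [← Subtype.coe_le_coe, hemp]
      exact Set.empty_subset _
    have h2 := A.boundaryIso.symm.le_iff_le.1 h1
    rw [ProperTubing.single_le_iff] at h2
    simp at h2
  obtain ⟨v, hv⟩ := hne
  refine ⟨v, Set.Subset.antisymm (fun w hw => ?_) (Set.singleton_subset_iff.2 hv)⟩
  by_contra hwv
  obtain ⟨G, hG, hGne, hGF⟩ := A.isPolytope_dual.exists_ssubset_face F.2.1 hv hw
    (fun h => hwv h.symm)
  have h1 := hlt ⟨G, hG, fun h => hGF.2 (h ▸ F.2.1.subset)⟩ hGF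
  exact hGne.ne_empty (congrArg Subtype.val h1)

open Classical in
/-- The vertex of the dual polytope labelled by a proper tube (and `0` for other sets). -/
noncomputable def tubeVertex (τ : Finset P) : EuclideanSpace ℝ (Fin d) :=
  if h : IsProperTube τ then (A.exists_boundaryIso_symm_eq_singleton h).choose else 0

theorem boundaryIso_symm_single {τ : Finset P} (hτ : IsProperTube τ) :
    (A.boundaryIso.symm (ProperTubing.single τ hτ)).1 = {A.tubeVertex τ} := by
  rw [tubeVertex, dif_pos hτ]
  exact (A.exists_boundaryIso_symm_eq_singleton hτ).choose_spec

theorem tubeVertex_mem_dual (τ : Finset P) : A.tubeVertex τ ∈ A.dual := by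
  by_cases hτ : IsProperTube τ
  · have h1 := (A.boundaryIso.symm (ProperTubing.single τ hτ)).2.1.subset
    rw [A.boundaryIso_symm_single hτ] at h1
    exact h1 rfl
  · rw [tubeVertex, dif_neg hτ]
    exact interior_subset A.zero_mem_interior

theorem tubeVertex_mem_iff {τ : Finset P} (hτ : IsProperTube τ) (F : BoundaryFaces A.dual) :
    A.tubeVertex τ ∈ F.1 ↔ τ ∈ (A.boundaryIso F).1 := by
  rw [← ProperTubing.single_le_iff hτ, ← OrderIso.symm_apply_le, ← Subtype.coe_le_coe,
    A.boundaryIso_symm_single hτ]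
  exact Set.singleton_subset_iff.symm

/-- A polytope is the convex hull of its vertices; the origin is an interior point, unless the
polytope is a point and there are no proper tubes. -/
theorem hullZero_tubeVertex : hullZero A.tubeVertex = A.dual := by
  apply Set.Subset.antisymm
  · refine convexHull_min ?_ A.isPolytope_dual.convex
    rintro v (rfl | ⟨τ, rfl⟩)
    · exact interior_subset A.zero_mem_interior
    · exact A.tubeVertex_mem_dual τ
  · intro x hx
    by_contra hxD
    obtain ⟨f, u, hf, hu⟩ := geometric_hahn_banach_closed_point (convex_convexHull ℝ _)
      (isPolytope_hullZero A.tubeVertex).isCompact.isClosed hxD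
    have hu0 : 0 < u := by simpa using hf 0 (subset_convexHull ℝ _ (Or.inl rfl))
    obtain ⟨w, hwQ, hw⟩ := A.isPolytope_dual.isCompact.exists_isMaxOn ⟨x, hx⟩
      f.continuous.continuousOn
    have hw : ∀ y ∈ A.dual, f y ≤ f w := hw
    have h0 := interior_subset A.zero_mem_interior
    let F : BoundaryFaces A.dual := ⟨f.toExposed A.dual,
      ContinuousLinearMap.toExposed.isExposed, fun h => by
        rw [← h] at h0
        have h1 := h0.2 x hx
        rw [map_zero] at h1
        linarith⟩
    -- the face maximizing `f` has a nonempty label, hence contains a vertex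
    have hlab : (A.boundaryIso F).1.Nonempty := by
      rw [Finset.nonempty_iff_ne_empty]
      intro hemp
      let B : BoundaryFaces A.dual := ⟨∅, isExposed_empty, fun h => by
        have h0 := interior_subset A.zero_mem_interior
        rw [← h] at h0; exact h0⟩
      have h1 : A.boundaryIso F ≤ A.boundaryIso B := by
        rw [← Subtype.coe_le_coe, hemp]
        exact Finset.empty_subset _
      exact (A.boundaryIso.le_iff_le.1 h1 : F.1 ⊆ ∅) (⟨hwQ, hw⟩ : w ∈ F.1)
    obtain ⟨τ, hτ⟩ := hlab
    have h1 := (A.tubeVertex_mem_iff ((A.boundaryIso F).2.2 τ hτ) F).2 hτ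
    have h2 := h1.2 x hx
    have h3 := hf _ (subset_convexHull ℝ _ (Or.inr ⟨τ, rfl⟩))
    linarith

theorem carrier_eq : A.carrier = polyhedron (innerFamily A.tubeVertex) := by
  rw [carrier, ← hullZero_tubeVertex, polarDual_hullZero]

theorem polarDual_carrier : polarDual A.carrier = A.dual := by
  rw [carrier_eq, polarDual_polyhedron, hullZero_tubeVertex]

/-- The label of a boundary face is read off from a point of the polar that cuts out the face. -/
theorem boundaryIso_eq_tight (F : BoundaryFaces A.dual) {y : 𝔼}
    (hFy : F.1 = {x ∈ A.dual | inner ℝ x y = 1}) :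
    (A.boundaryIso F).1 = tight (innerFamily A.tubeVertex) y := by
  ext τ
  rw [mem_tight, innerFamily_apply]
  by_cases hτ : IsProperTube τ
  · rw [← A.tubeVertex_mem_iff hτ, hFy]
    exact and_iff_right (A.tubeVertex_mem_dual τ)
  · refine iff_of_false (fun h => hτ ((A.boundaryIso F).2.2 τ h)) ?_
    rw [tubeVertex, dif_neg hτ]
    simp

/-- The vertices of the dual polytope realize the complex of proper tubings. -/
theorem isRealization : IsRealization A.tubeVertex (tubingComplex P) where
  zero_mem := by
    rw [hullZero_tubeVertex]
    exact A.zero_mem_interior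
  realizes := by
    constructor
    · intro y hy
      rw [← carrier_eq] at hy
      have hF := (isBoundaryFace_iff A.zero_mem_interior).2 ⟨y, hy, rfl⟩
      rw [← A.boundaryIso_eq_tight ⟨_, hF⟩ rfl]
      exact (A.boundaryIso _).2
    · intro T hT
      obtain ⟨y, hy, hFy⟩ := (isBoundaryFace_iff A.zero_mem_interior).1
        (A.boundaryIso.symm ⟨T, hT⟩).2
      refine ⟨y, A.carrier_eq ▸ hy, ?_⟩
      rw [← A.boundaryIso_eq_tight _ hFy, OrderIso.apply_symm_apply]
  downward T hT T' h := IsProperTubing.mono hT h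

/-- The face of the poset associahedron labelled by a tubing is where the inequalities of its tubes
are tight. -/
theorem face_eq (T : ProperTubing P) :
    A.face T = subface (innerFamily A.tubeVertex) T.1 := by
  obtain ⟨y₀, hy₀, hF⟩ := (isBoundaryFace_iff A.zero_mem_interior).1 (A.boundaryIso.symm T).2
  have htight := A.boundaryIso_eq_tight _ hF
  rw [OrderIso.apply_symm_apply] at htight
  have hF' : (A.boundaryIso.symm T).1 = convexHull ℝ (A.tubeVertex '' T.1) := by
    rw [hF, htight, ← IsRealization.hullZero_inter_eq (A.carrier_eq ▸ hy₀), hullZero_tubeVertex]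
  ext y
  simp only [face, subface, hF', Set.mem_ofPred_eq, ← carrier_eq]
  refine and_congr_right fun _ => ⟨fun h τ hτ => h _ (subset_convexHull ℝ _ ⟨τ, hτ, rfl⟩),
    fun h x hx => ?_⟩
  have h2 : ∀ v ∈ A.tubeVertex '' T.1, innerSL ℝ y v = 1 := by
    rintro _ ⟨τ, hτ, rfl⟩
    rw [innerSL_apply_apply, real_inner_comm]
    exact h τ hτ
  have h3 := convexHull_apply_le (innerSL ℝ y) (fun v hv => (h2 v hv).le) hx
  have h4 := convexHull_apply_le (-innerSL ℝ y) (m := -1)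
    (fun v hv => by rw [FunLike.coe_neg, Pi.neg_apply, h2 v hv]) hx
  rw [FunLike.coe_neg, Pi.neg_apply] at h4
  rw [innerSL_apply_apply, real_inner_comm] at h3 h4
  linarith

end PosetAssociahedron

end TubingComplex

/-! ### Linear inequalities whose tight sets are tubings -/

section Inequalities

variable {P : Type*}

section

variable [Fintype P]

theorem one_le_card [Nonempty P] : 1 ≤ (Fintype.card P : ℝ) := by
  exact_mod_cast Fintype.card_pos

/-- If every proper part of `X` can be left through a step that increases `p` by at most `δ`, then
the variation of `p` on `X` is at most `|P| δ`. -/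
theorem le_add_of_forall_exists_step {X : Finset P} {p : P → ℝ} {δ : ℝ}
    (hδ : 0 ≤ δ)
    (hX : ∀ A ⊆ X, A.Nonempty → A ≠ X → ∃ x ∈ A, ∃ y ∈ X, y ∉ A ∧ p y ≤ p x + δ)
    {x y : P} (hx : x ∈ X) (hy : y ∈ X) : p y ≤ p x + Fintype.card P * δ := by
  classical
  let A : ℕ → Finset P := fun k => X.filter fun y => p y ≤ p x + k * δ
  have hmono : ∀ k, A k ⊆ A (k + 1) := fun k y hy => by
    rw [Finset.mem_filter] at hy ⊢
    refine ⟨hy.1, hy.2.trans ?_⟩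
    push_cast
    linarith
  have key : ∀ k, A k = X ∨ k + 1 ≤ (A k).card := by
    intro k
    induction k with
    | zero =>
      right
      exact Finset.card_pos.2 ⟨x, Finset.mem_filter.2 ⟨hx, by simp⟩⟩
    | succ k ih =>
      rcases ih with ih | ih
      · left
        exact (Finset.filter_subset _ _).antisymm (ih.symm.subset.trans (hmono k))
      · by_cases hk : A k = X
        · left
          exact (Finset.filter_subset _ _).antisymm (hk.symm.subset.trans (hmono k))
        right
        obtain ⟨u, hu, v, hv, hvA, huv⟩ := hX (A k) (Finset.filter_subset _ _)
          (Finset.card_pos.1 (by omega)) hk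
        have hlt : A k ⊂ A (k + 1) := by
          refine ⟨hmono k, fun hsub => hvA (hsub (Finset.mem_filter.2 ⟨hv, ?_⟩))⟩
          have := (Finset.mem_filter.1 hu).2
          push_cast
          linarith
        have := Finset.card_lt_card hlt
        omega
  have hA : A (Fintype.card P) = X := by
    refine (key (Fintype.card P)).resolve_right fun h => ?_
    have := Finset.card_le_univ (A (Fintype.card P))
    omega
  rw [← hA] at hy
  exact (Finset.mem_filter.1 hy).2

variable (P) in
/-- The base of the right hand sides of the inequalities; its size makes the bound for a tube
negligible in comparison with the bound for a larger tube. -/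
noncomputable def tubeBase : ℝ := 2 ^ (Fintype.card P + 4) * (Fintype.card P : ℝ) ^ 4

theorem one_lt_tubeBase [Nonempty P] : (Fintype.card P : ℝ) ^ 4 < tubeBase P ∧ 1 < tubeBase P := by
  have h1 : (1 : ℝ) ≤ Fintype.card P := one_le_card
  have h2 : (1 : ℝ) ≤ (Fintype.card P : ℝ) ^ 4 := one_le_pow₀ h1
  have h3 : (2 : ℝ) ≤ 2 ^ (Fintype.card P + 4) :=
    le_self_pow₀ (by norm_num) (by omega)
  rw [tubeBase]
  constructor <;> nlinarith

/-- The right hand side of the inequality of a tube. -/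
noncomputable def tubeBound (σ : Finset P) : ℝ := tubeBase P ^ σ.card

theorem tubeBound_pos (σ : Finset P) [Nonempty P] : 0 < tubeBound σ := by
  have := (one_lt_tubeBase (P := P)).2
  rw [tubeBound]
  positivity

end

variable [PartialOrder P]

open Classical in
/-- The pairs `i < j` in a finite set. -/
noncomputable def ltPairs (s : Finset P) : Finset (P × P) :=
  (s ×ˢ s).filter fun q => q.1 < q.2

theorem mem_ltPairs {s : Finset P} {q : P × P} :
    q ∈ ltPairs s ↔ (q.1 ∈ s ∧ q.2 ∈ s) ∧ q.1 < q.2 := by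
  simp [ltPairs]

/-- The sum of the differences `p j - p i` over all pairs `i < j` in `s`. -/
noncomputable def compSum (s : Finset P) : (P → ℝ) →ₗ[ℝ] ℝ :=
  ∑ q ∈ ltPairs s, ((LinearMap.proj q.2 : (P → ℝ) →ₗ[ℝ] ℝ) - LinearMap.proj q.1)

theorem compSum_apply (s : Finset P) (p : P → ℝ) :
    compSum s p = ∑ q ∈ ltPairs s, (p q.2 - p q.1) := by
  simp [compSum]

theorem compSum_eq_zero {p : P → ℝ} {s : Finset P} (h : ∀ i ∈ s, ∀ j ∈ s, p i = p j) :
    compSum s p = 0 := by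
  rw [compSum_apply]
  exact Finset.sum_eq_zero fun q hq => sub_eq_zero.2
    (h _ (mem_ltPairs.1 hq).1.2 _ (mem_ltPairs.1 hq).1.1)

theorem compSum_const (s : Finset P) (t : ℝ) : compSum s (fun _ => t) = 0 :=
  compSum_eq_zero fun _ _ _ _ => rfl

theorem compSum_pair [DecidableEq P] {i j : P} (h : i < j) (p : P → ℝ) :
    compSum {i, j} p = p j - p i := by
  have hset : ltPairs ({i, j} : Finset P) = {(i, j)} := by
    ext ⟨x, y⟩
    simp only [mem_ltPairs, Finset.mem_insert, Finset.mem_singleton, Prod.mk.injEq]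
    constructor
    · rintro ⟨⟨rfl | rfl, rfl | rfl⟩, hlt⟩
      · exact absurd hlt (lt_irrefl _)
      · exact ⟨rfl, rfl⟩
      · exact absurd hlt h.asymm
      · exact absurd hlt (lt_irrefl _)
    · rintro ⟨rfl, rfl⟩
      exact ⟨⟨Or.inl rfl, Or.inr rfl⟩, h⟩
  rw [compSum_apply, hset, Finset.sum_singleton]

theorem sub_le_compSum {p : P → ℝ} (hp : Monotone p) {s : Finset P} {i j : P} (hi : i ∈ s)
    (hj : j ∈ s) (hij : i < j) : p j - p i ≤ compSum s p := by
  rw [compSum_apply]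
  exact Finset.single_le_sum (f := fun q : P × P => p q.2 - p q.1)
    (fun q hq => sub_nonneg.2 (hp (mem_ltPairs.1 hq).2.le))
    (mem_ltPairs.2 (show ((i, j).1 ∈ s ∧ (i, j).2 ∈ s) ∧ (i, j).1 < (i, j).2 from ⟨⟨hi, hj⟩, hij⟩))

theorem compSum_nonneg {p : P → ℝ} (hp : Monotone p) (s : Finset P) : 0 ≤ compSum s p := by
  rw [compSum_apply]
  exact Finset.sum_nonneg fun q hq => sub_nonneg.2 (hp (mem_ltPairs.1 hq).2.le)

variable [Fintype P]

theorem card_ltPairs_le (s : Finset P) : ((ltPairs s).card : ℝ) ≤ (Fintype.card P : ℝ) ^ 2 := by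
  have h : (ltPairs s).card ≤ Fintype.card P ^ 2 := by
    classical
    calc (ltPairs s).card ≤ (s ×ˢ s).card := Finset.card_filter_le _ _
      _ = s.card * s.card := Finset.card_product _ _
      _ ≤ Fintype.card P * Fintype.card P :=
        Nat.mul_le_mul (Finset.card_le_univ s) (Finset.card_le_univ s)
      _ = _ := (sq _).symm
  exact_mod_cast h

theorem abs_compSum_le {p : P → ℝ} {s : Finset P} {K : ℝ} (hK : 0 ≤ K)
    (h : ∀ i ∈ s, ∀ j ∈ s, |p j - p i| ≤ K) :
    |compSum s p| ≤ (Fintype.card P : ℝ) ^ 2 * K := by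
  rw [compSum_apply]
  calc |∑ q ∈ ltPairs s, (p q.2 - p q.1)| ≤ ∑ q ∈ ltPairs s, |p q.2 - p q.1| :=
        Finset.abs_sum_le_sum_abs _ _
    _ ≤ ∑ q ∈ ltPairs s, K := Finset.sum_le_sum fun q hq =>
        h _ (mem_ltPairs.1 hq).1.1 _ (mem_ltPairs.1 hq).1.2
    _ = (ltPairs s).card * K := by rw [Finset.sum_const, nsmul_eq_mul]
    _ ≤ _ := mul_le_mul_of_nonneg_right (card_ltPairs_le s) hK

/-- A monotone function varies little on a connected set if the sum of its differences over the
comparable pairs in the set is small. -/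
theorem CompConnected.le_add_compSum {p : P → ℝ} (hp : Monotone p) {σ : Finset P}
    (hσ : CompConnected (σ : Set P)) {x y : P} (hx : x ∈ σ) (hy : y ∈ σ) :
    p y ≤ p x + Fintype.card P * compSum σ p := by
  refine le_add_of_forall_exists_step (compSum_nonneg hp σ) (fun A hA hne hAσ => ?_) hx hy
  by_contra! hcon
  refine hAσ (hA.antisymm ?_)
  refine hσ.2 A hA hne fun u hu v hv huv => ?_
  by_contra hvA
  have h1 := hcon u hu v hv hvA
  have h0 := compSum_nonneg hp σ
  rcases huv with h | h
  · rcases h.eq_or_lt with rfl | h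
    · exact hvA hu
    · have := sub_le_compSum hp (hA hu) hv h
      linarith
  · have := hp h
    linarith

/-- The points of the polytope before normalization: the tubes with at least two elements give
inequalities, and that of the whole poset is an equality.  Adding a constant to `p` does not affect
the conditions. -/
structure TubeFeasible (p : P → ℝ) : Prop where
  le : ∀ σ : Finset P, IsTube σ → 1 < σ.card → tubeBound σ ≤ compSum σ p
  eq : compSum Finset.univ p = tubeBound (Finset.univ : Finset P)

theorem isTube_pair_of_covBy [DecidableEq P] {i j : P} (h : i ⋖ j) :
    IsTube ({i, j} : Finset P) := by
  rw [isTube_iff]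
  constructor
  · refine ⟨fun x hx y hy z hz => ?_⟩
    simp only [Finset.coe_insert, Finset.coe_singleton, Set.mem_insert_iff,
      Set.mem_singleton_iff] at hx hy ⊢
    by_contra! hz'
    have hxz : x < z := lt_of_le_of_ne hz.1 fun e => by
      rcases hx with rfl | rfl
      exacts [hz'.1 e.symm, hz'.2 e.symm]
    have hzy : z < y := lt_of_le_of_ne hz.2 fun e => by
      rcases hy with rfl | rfl
      exacts [hz'.1 e, hz'.2 e]
    rcases hx with rfl | rfl <;> rcases hy with rfl | rfl
    · exact absurd (hxz.trans hzy) (lt_irrefl _)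
    · exact h.2 hxz hzy
    · exact absurd (hxz.trans hzy) h.lt.asymm
    · exact absurd (hxz.trans hzy) (lt_irrefl _)
  · refine ⟨⟨i, by simp⟩, fun A hA ⟨a, ha⟩ hcl => ?_⟩
    have hmem : ∀ x y : P, x ∈ ({i, j} : Finset P) → y ∈ ({i, j} : Finset P) → x ≤ y ∨ y ≤ x := by
      intro x y hx hy
      simp only [Finset.mem_insert, Finset.mem_singleton] at hx hy
      rcases hx with rfl | rfl <;> rcases hy with rfl | rfl
      exacts [Or.inl le_rfl, Or.inl h.le, Or.inr h.le, Or.inl le_rfl]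
    exact fun y hy => hcl a ha y hy (hmem a y (hA ha) hy)

/-- The inequality of a tube with two elements makes `p` increase along a cover. -/
theorem TubeFeasible.strictMono {p : P → ℝ} (hp : TubeFeasible p) : StrictMono p := by
  classical
  have hcov : ∀ i j : P, i ⋖ j → p i < p j := by
    intro i j h
    have : Nonempty P := ⟨i⟩
    have h1 := hp.le _ (isTube_pair_of_covBy h) (by rw [Finset.card_pair h.lt.ne]; norm_num)
    rw [compSum_pair h.lt] at h1
    linarith [tubeBound_pos ({i, j} : Finset P)]
  intro x y hxy
  induction x using WellFoundedGT.induction with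
  | ind x ih =>
    obtain ⟨z, hxz, hzy⟩ := exists_covBy_le_of_lt hxy
    rcases hzy.eq_or_lt with rfl | hlt
    · exact hcov _ _ hxz
    · exact (hcov _ _ hxz).trans (ih z hxz.lt hlt)

/-- A family of tight tubes that is strongly connected, by intersections and by comparabilities,
has a largest member.  Otherwise the convex hull of the union would be a tube in which the
variation of `p` is bounded by the much smaller bounds of the tubes of the family. -/
theorem TubeFeasible.exists_top {p : P → ℝ} (hp : TubeFeasible p) {S : Set (Finset P)}
    (hne : S.Nonempty)
    (hS : ∀ σ ∈ S, IsTube σ ∧ 1 < σ.card ∧ compSum σ p = tubeBound σ)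
    (hconn : ∀ A ⊆ S, A.Nonempty → (∀ σ ∈ S, ∀ ρ ∈ A, ¬ Disjoint σ ρ → σ ∈ A) →
      (∀ σ ∈ S, ∀ ρ ∈ A, (∃ i ∈ σ, ∃ j ∈ ρ, i < j) → σ ∈ A) → S ⊆ A) :
    ∃ σ ∈ S, ∀ σ' ∈ S, σ' ⊆ σ := by
  classical
  obtain ⟨σ₀, hσ₀⟩ := hne
  obtain ⟨x₀, hx₀⟩ := Finset.card_pos.1 (zero_lt_one.trans (hS σ₀ hσ₀).2.1)
  have : Nonempty P := ⟨x₀⟩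
  have hmono := hp.strictMono.monotone
  set n : ℝ := (Fintype.card P : ℝ) with hn
  have hn1 : 1 ≤ n := one_le_card
  -- `X` is the union of the family and `ρ` is its convex hull
  let X : Finset P := Finset.univ.filter fun x => ∃ σ ∈ S, x ∈ σ
  have hX : ∀ {x}, x ∈ X ↔ ∃ σ ∈ S, x ∈ σ := by simp [X]
  let ρ : Finset P := Finset.univ.filter fun z => ∃ x ∈ X, ∃ y ∈ X, x ≤ z ∧ z ≤ y
  have hρ : ∀ {z}, z ∈ ρ ↔ ∃ x ∈ X, ∃ y ∈ X, x ≤ z ∧ z ≤ y := by simp [ρ]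
  have hXρ : X ⊆ ρ := fun x hx => hρ.2 ⟨x, hx, x, hx, le_rfl, le_rfl⟩
  have hSρ : ∀ σ ∈ S, σ ⊆ ρ := fun σ hσ x hx => hXρ (hX.2 ⟨σ, hσ, hx⟩)
  -- connectedness in terms of elements
  have hXconn : ∀ B ⊆ X, B.Nonempty → (∀ σ ∈ S, ∀ x ∈ σ, x ∈ B → σ ⊆ B) →
      (∀ j ∈ B, ∀ i ∈ X, i < j → i ∈ B) → X ⊆ B := by
    rintro B hB ⟨b, hb⟩ h1 h2 x hx
    obtain ⟨σ, hσ, hxσ⟩ := hX.1 hx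
    obtain ⟨τ, hτ, hbτ⟩ := hX.1 (hB hb)
    refine (hconn {σ ∈ S | σ ⊆ B} (Set.sep_subset _ _) ⟨τ, hτ, h1 τ hτ b hbτ hb⟩ ?_ ?_ hσ).2 hxσ
    · rintro σ hσ τ ⟨hτ, hτB⟩ hdis
      obtain ⟨z, hz1, hz2⟩ := Finset.not_disjoint_iff.1 hdis
      exact ⟨hσ, h1 σ hσ z hz1 (hτB hz2)⟩
    · rintro σ hσ τ ⟨hτ, hτB⟩ ⟨i, hi, j, hj, hij⟩
      exact ⟨hσ, h1 σ hσ i hi (h2 j (hτB hj) i (hX.2 ⟨σ, hσ, hi⟩) hij)⟩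
  have htube : IsTube ρ := by
    rw [isTube_iff]
    refine ⟨⟨fun x hx y hy z hz => ?_⟩, ⟨x₀, hSρ σ₀ hσ₀ hx₀⟩, fun A hA ⟨a, ha⟩ hcl => ?_⟩
    · obtain ⟨u, hu, -, -, hux, -⟩ := hρ.1 hx
      obtain ⟨-, -, v, hv, -, hyv⟩ := hρ.1 hy
      exact hρ.2 ⟨u, hu, v, hv, hux.trans hz.1, hz.2.trans hyv⟩
    · have hXA : ∀ x ∈ X, x ∈ A := by
        obtain ⟨u, hu, -, -, hua, -⟩ := hρ.1 (hA ha)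
        have := hXconn (X.filter fun x => x ∈ A) (Finset.filter_subset _ _)
          ⟨u, Finset.mem_filter.2 ⟨hu, hcl a ha u (hXρ hu) (Or.inr hua)⟩⟩ ?_ ?_
        · exact fun x hx => (Finset.mem_filter.1 (this hx)).2
        · intro σ hσ x hx hxB y hy
          refine Finset.mem_filter.2 ⟨hX.2 ⟨σ, hσ, hy⟩, ?_⟩
          refine (((isTube_iff.1 (hS σ hσ).1).2.2 (A ∩ σ) Set.inter_subset_right
            ⟨x, (Finset.mem_filter.1 hxB).2, hx⟩ ?_) hy).1
          rintro z ⟨hz, hzσ⟩ w hw hzw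
          exact ⟨hcl z hz w (hSρ σ hσ hw) hzw, hw⟩
        · intro j hj i hi hij
          exact Finset.mem_filter.2
            ⟨hi, hcl j (Finset.mem_filter.1 hj).2 i (hXρ hi) (Or.inr hij.le)⟩
      intro z hz
      obtain ⟨u, hu, -, -, huz, -⟩ := hρ.1 hz
      exact hcl u (hXA u hu) z hz (Or.inl huz)
  by_cases htop : ∃ σ ∈ S, σ = ρ
  · obtain ⟨σ, hσ, rfl⟩ := htop
    exact ⟨ρ, hσ, hSρ⟩
  exfalso
  push Not at htop
  have hcard : ∀ σ ∈ S, σ.card + 1 ≤ ρ.card := fun σ hσ =>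
    Finset.card_lt_card ((hSρ σ hσ).ssubset_of_ne (htop σ hσ))
  have hρ2 : 1 < ρ.card := (hS σ₀ hσ₀).2.1.trans (hcard σ₀ hσ₀)
  obtain ⟨k, hk⟩ : ∃ k, ρ.card = k + 1 := ⟨ρ.card - 1, by omega⟩
  set M := tubeBase P with hM
  have hM1 : 1 < M := one_lt_tubeBase.2
  have hMk : 0 < M ^ k := by positivity
  -- the variation on each tube
  have hvar : ∀ σ ∈ S, ∀ x ∈ σ, ∀ y ∈ σ, p y ≤ p x + n * M ^ k := by
    intro σ hσ x hx y hy
    have h1 := (isTube_iff.1 (hS σ hσ).1).2.le_add_compSum hmono hx hy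
    rw [(hS σ hσ).2.2] at h1
    have h2 : tubeBound σ ≤ M ^ k := pow_le_pow_right₀ hM1.le (by have := hcard σ hσ; omega)
    have h3 := mul_le_mul_of_nonneg_left h2 (zero_le_one.trans hn1)
    linarith
  -- the variation on the union: a comparability `i < j` leads down from `j` to `i`
  have hvarX : ∀ x ∈ X, ∀ y ∈ X, p y ≤ p x + n * (n * M ^ k) := by
    intro x hx y hy
    refine le_add_of_forall_exists_step (by positivity) (fun A hA hAne hAX => ?_) hx hy
    by_contra! hcon
    refine hAX (hA.antisymm (hXconn A hA hAne ?_ ?_))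
    · intro σ hσ u hu huA v hv
      by_contra hvA
      exact absurd (hvar σ hσ u hu v hv)
        (not_le.2 (hcon u huA v (hX.2 ⟨σ, hσ, hv⟩) hvA))
    · intro j hj i hi hij
      by_contra hiA
      have h1 := hcon j hj i hi hiA
      have h2 := hmono hij.le
      have : 0 < n * M ^ k := by positivity
      linarith
  have hvarρ : ∀ x ∈ ρ, ∀ y ∈ ρ, |p y - p x| ≤ n * (n * M ^ k) := by
    have : ∀ x ∈ ρ, ∀ y ∈ ρ, p y - p x ≤ n * (n * M ^ k) := by
      intro x hx y hy
      obtain ⟨u, hu, -, -, hux, -⟩ := hρ.1 hx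
      obtain ⟨-, -, v, hv, -, hyv⟩ := hρ.1 hy
      have h1 := hvarX u hu v hv
      have h2 := hmono hux
      have h3 := hmono hyv
      linarith
    intro x hx y hy
    exact abs_sub_le_iff.2 ⟨this x hx y hy, this y hy x hx⟩
  have h1 := (le_abs_self _).trans (abs_compSum_le (by positivity) hvarρ)
  have h2 := hp.le ρ htube hρ2
  rw [tubeBound, hk, ← hM, pow_succ] at h2
  have h3 : n ^ 4 * M ^ k < M * M ^ k := mul_lt_mul_of_pos_right one_lt_tubeBase.1 hMk
  nlinarith

open Classical in
/-- The proper tubes whose inequality is tight. -/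
noncomputable def tightTubes (p : P → ℝ) : Finset (Finset P) :=
  Finset.univ.filter fun σ => IsProperTube σ ∧ compSum σ p = tubeBound σ

theorem mem_tightTubes {p : P → ℝ} {σ : Finset P} :
    σ ∈ tightTubes p ↔ IsProperTube σ ∧ compSum σ p = tubeBound σ := by
  simp [tightTubes]

/-- The tight tubes of a feasible point form a tubing: two of them that intersect, as well as those
on a directed cycle, are a strongly connected family and have a largest member. -/
theorem TubeFeasible.isProperTubing_tightTubes {p : P → ℝ} (hp : TubeFeasible p) :
    IsProperTubing (tightTubes p) := by
  have htight : ∀ σ ∈ tightTubes p, IsTube σ ∧ 1 < σ.card ∧ compSum σ p = tubeBound σ :=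
    fun σ hσ => ⟨(mem_tightTubes.1 hσ).1.1, (mem_tightTubes.1 hσ).1.2.1, (mem_tightTubes.1 hσ).2⟩
  refine ⟨⟨fun σ hσ => (htight σ hσ).1, fun σ hσ τ hτ => ?_, fun σ₀ hcyc => ?_⟩,
    fun σ hσ => (mem_tightTubes.1 hσ).1⟩
  · by_cases hdis : Disjoint σ τ
    · exact Or.inr (Or.inr hdis)
    obtain ⟨ρ, hρ, htop⟩ := hp.exists_top (S := {σ, τ}) ⟨σ, Or.inl rfl⟩ (by
      rintro _ (rfl | rfl)
      exacts [htight _ hσ, htight _ hτ]) (by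
      rintro A hA ⟨α, hα⟩ hint - β hβ
      refine hint β hβ α hα ?_
      have hself : ∀ γ ∈ tightTubes p, ¬ Disjoint γ γ := fun γ hγ h => by
        have := (htight γ hγ).2.1
        rw [disjoint_self.1 h] at this
        simp at this
      rcases hA hα with rfl | rfl <;> rcases hβ with rfl | rfl
      exacts [hself _ hσ, fun h => hdis h.symm, hdis, hself _ hτ])
    rcases hρ with rfl | rfl
    · exact Or.inr (Or.inl (htop τ (Or.inr rfl)))
    · exact Or.inl (htop σ (Or.inl rfl))
  · -- the strong component of `σ₀`; its largest member cannot be disjoint from the next one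
    set r := TubingEdge (tightTubes p)
    have hmem : ∀ σ, Relation.TransGen r σ₀ σ → σ ∈ tightTubes p := by
      intro σ hσ
      obtain ⟨ρ, -, hρ⟩ := Relation.TransGen.tail'_iff.1 hσ
      exact hρ.2.1
    obtain ⟨ρ, hρ, htop⟩ := hp.exists_top
      (S := {σ | Relation.TransGen r σ₀ σ ∧ Relation.TransGen r σ σ₀}) ⟨σ₀, hcyc, hcyc⟩
      (fun σ hσ => htight σ (hmem σ hσ.1)) (by
        rintro A hA ⟨α, hα⟩ - hpred β hβ
        have hβα : Relation.ReflTransGen r β α := (hβ.2.trans (hA hα).1).to_reflTransGen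
        have hβ0 := hβ.1
        clear hβ
        induction hβα using Relation.ReflTransGen.head_induction_on with
        | refl => exact hα
        | head hstep hrest ih =>
          have hc := hβ0.tail hstep
          exact hpred _ ⟨hβ0, (Relation.TransGen.head' hstep hrest).trans (hA hα).2⟩ _ (ih hc)
            hstep.2.2.2)
    obtain ⟨ρ', hstep, hrest⟩ := Relation.TransGen.head'_iff.1 hρ.2
    have hsub := htop ρ' ⟨hρ.1.tail hstep, Relation.TransGen.trans_right hrest hcyc⟩
    have h1 := (htight ρ' hstep.2.1).2.1
    rw [Finset.disjoint_of_subset_left hsub hstep.2.2.1 |> disjoint_self.1] at h1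
    simp at h1

end Inequalities

/-! ### Every tubing is the tight set of a point -/

section TightPoints

variable {P : Type*} [PartialOrder P]

/-- Stepping along `≤` and inside the members of a family that lie strictly inside `τ`. -/
def BlockStep (T : Finset (Finset P)) (τ : Finset P) (x y : P) : Prop :=
  x ∈ τ ∧ y ∈ τ ∧ (x ≤ y ∨ ∃ σ ∈ T, σ ⊂ τ ∧ x ∈ σ ∧ y ∈ σ)

theorem IsTubing.disjoint_of_maximal {T : Finset (Finset P)} (hT : IsTubing T) {τ σ ρ : Finset P}
    (hσ : Maximal (fun ρ => ρ ∈ T ∧ ρ ⊂ τ) σ) (hρ : Maximal (fun ρ => ρ ∈ T ∧ ρ ⊂ τ) ρ)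
    (hne : σ ≠ ρ) : Disjoint σ ρ := by
  rcases hT.2.1 σ hσ.1.1 ρ hρ.1.1 with h | h | h
  · exact absurd (h.antisymm (hσ.2 hρ.1 h)) hne
  · exact absurd ((hρ.2 hσ.1 h).antisymm h) hne
  · exact h

/-- A chain of block steps is an inequality or passes through a chain of edges between maximal
tubes of the tubing inside `τ`. -/
theorem IsTubing.le_or_exists_of_blockStep {T : Finset (Finset P)} (hT : IsTubing T)
    {τ : Finset P} {x y : P} (hxy : Relation.ReflTransGen (BlockStep T τ) x y) :
    x ≤ y ∨ ∃ σ σ' : Finset P, Maximal (fun ρ => ρ ∈ T ∧ ρ ⊂ τ) σ ∧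
      Maximal (fun ρ => ρ ∈ T ∧ ρ ⊂ τ) σ' ∧
      Relation.ReflTransGen (TubingEdge T) σ σ' ∧ (∃ a ∈ σ, x ≤ a) ∧ ∃ b ∈ σ', b ≤ y := by
  have hmax : ∀ ρ ∈ T, ρ ⊂ τ → ∃ ρ', ρ ⊆ ρ' ∧ Maximal (fun ρ => ρ ∈ T ∧ ρ ⊂ τ) ρ' := by
    intro ρ hρ hρτ
    have hfin : {ρ | ρ ∈ T ∧ ρ ⊂ τ}.Finite := T.finite_toSet.subset fun ρ h => h.1
    obtain ⟨ρ', h1, h2⟩ := hfin.exists_le_maximal (a := ρ) ⟨hρ, hρτ⟩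
    exact ⟨ρ', h1, h2⟩
  induction hxy with
  | refl => exact Or.inl le_rfl
  | @tail b c _ hbc ih =>
    rcases hbc.2.2 with hle | ⟨ρ₀, hρ₀, hρ₀τ, hbρ₀, hcρ₀⟩
    · rcases ih with ih | ⟨σ, σ', h1, h2, h3, h4, v, hv, hvb⟩
      · exact Or.inl (ih.trans hle)
      · exact Or.inr ⟨σ, σ', h1, h2, h3, h4, v, hv, hvb.trans hle⟩
    · obtain ⟨ρ, hρ₀ρ, hρ⟩ := hmax ρ₀ hρ₀ hρ₀τ
      have hbρ := hρ₀ρ hbρ₀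
      have hcρ := hρ₀ρ hcρ₀
      right
      rcases ih with ih | ⟨σ, σ', h1, h2, h3, h4, v, hv, hvb⟩
      · exact ⟨ρ, ρ, hρ, hρ, .refl, ⟨b, hbρ, ih⟩, c, hcρ, le_rfl⟩
      · refine ⟨σ, ρ, h1, hρ, ?_, h4, c, hcρ, le_rfl⟩
        by_cases heq : σ' = ρ
        · exact heq ▸ h3
        have hdis := hT.disjoint_of_maximal h2 hρ heq
        have hvb' : v < b := lt_of_le_of_ne hvb fun e =>
          Finset.disjoint_left.1 hdis hv (e ▸ hbρ)
        exact h3.tail ⟨h2.1.1, hρ.1.1, hdis, v, hv, b, hbρ, hvb'⟩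

/-- Since the graph of a tubing is acyclic, a chain of block steps cannot lead back from `j` to
`i < j` unless both lie in a tube strictly inside `τ`. -/
theorem IsTubing.exists_mem_of_blockStep {T : Finset (Finset P)} (hT : IsTubing T)
    {τ : Finset P} {i j : P} (hij : i < j) (hji : Relation.ReflTransGen (BlockStep T τ) j i) :
    ∃ σ ∈ T, σ ⊂ τ ∧ i ∈ σ ∧ j ∈ σ := by
  rcases hT.le_or_exists_of_blockStep hji with h | ⟨σ, σ', h1, h2, h3, ⟨a, ha, hja⟩, b, hb, hbi⟩
  · exact absurd hij h.not_gt
  by_cases heq : σ = σ'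
  · subst heq
    have hcv := (hT.1 σ h1.1.1).1
    exact ⟨σ, h1.1.1, h1.1.2, hcv.out hb ha ⟨hbi, hij.le.trans hja⟩,
      hcv.out hb ha ⟨hbi.trans hij.le, hja⟩⟩
  · have hedge : TubingEdge T σ' σ := ⟨h2.1.1, h1.1.1, (hT.disjoint_of_maximal h1 h2 heq).symm,
      b, hb, a, ha, hbi.trans_lt (hij.trans_le hja)⟩
    exact absurd (Relation.TransGen.tail' h3 hedge) (hT.2.2 σ)

variable [Fintype P]

/-- A rank function of the quotient of `τ` by the tubes strictly inside it: the number of elements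
from which one can get to `x` by block steps. -/
theorem IsTubing.exists_blockRank {T : Finset (Finset P)} (hT : IsTubing T) (τ : Finset P) :
    ∃ r : P → ℝ, (∀ x, 0 ≤ r x ∧ r x ≤ Fintype.card P) ∧ (∀ x ∉ τ, r x = 0) ∧
      (∀ σ ∈ T, σ ⊂ τ → ∀ x ∈ σ, ∀ y ∈ σ, r x = r y) ∧
      ∀ i ∈ τ, ∀ j ∈ τ, i < j → (∀ σ ∈ T, σ ⊂ τ → ¬ (i ∈ σ ∧ j ∈ σ)) → r i + 1 ≤ r j := by
  classical
  let D : P → Finset P := fun x =>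
    Finset.univ.filter fun y => Relation.ReflTransGen (BlockStep T τ) y x
  have hD : ∀ {x y}, y ∈ D x ↔ Relation.ReflTransGen (BlockStep T τ) y x := by simp [D]
  have hDmono : ∀ {x y}, BlockStep T τ x y → D x ⊆ D y := fun hxy z hz =>
    hD.2 ((hD.1 hz).tail hxy)
  refine ⟨fun x => if x ∈ τ then ((D x).card : ℝ) else 0, fun x => ?_, fun x hx => if_neg hx,
    fun σ hσ hστ x hx y hy => ?_, fun i hi j hj hij hno => ?_⟩
  · dsimp only
    split_ifs
    · exact ⟨by positivity, by exact_mod_cast Finset.card_le_univ _⟩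
    · exact ⟨le_rfl, by positivity⟩
  · have hxτ := hστ.1 hx
    have hyτ := hστ.1 hy
    have h : D x = D y := (hDmono ⟨hxτ, hyτ, Or.inr ⟨σ, hσ, hστ, hx, hy⟩⟩).antisymm
      (hDmono ⟨hyτ, hxτ, Or.inr ⟨σ, hσ, hστ, hy, hx⟩⟩)
    simp only [hxτ, hyτ, if_true, h]
  · simp only [hi, hj, if_true]
    have hlt : D i ⊂ D j := by
      refine ⟨hDmono ⟨hi, hj, Or.inl hij.le⟩, fun hsub => ?_⟩
      obtain ⟨σ, hσ, hστ, h1, h2⟩ := hT.exists_mem_of_blockStep hij (hD.1 (hsub (hD.2 .refl)))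
      exact hno σ hσ hστ ⟨h1, h2⟩
    exact_mod_cast Finset.card_lt_card hlt

/-- A system of linear equations that is triangular for the inclusion order has a solution. -/
theorem exists_triangular_solution {α : Type*} [DecidableEq α] (S : Finset (Finset α))
    (g : Finset α → Finset α → ℝ) (c : Finset α → ℝ) (hg : ∀ τ ∈ S, g τ τ ≠ 0) :
    ∃ L : Finset α → ℝ, ∀ τ ∈ S,
      L τ * g τ τ + ∑ τ' ∈ S with τ' ⊂ τ, L τ' * g τ τ' = c τ := by
  let L : Finset α → ℝ := Finset.strongInduction fun τ ih =>
    (c τ - ∑ τ' ∈ (S.filter (· ⊂ τ)).attach,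
      ih τ'.1 (Finset.mem_filter.1 τ'.2).2 * g τ τ'.1) / g τ τ
  refine ⟨L, fun τ hτ => ?_⟩
  have h : L τ = (c τ - ∑ τ' ∈ S with τ' ⊂ τ, L τ' * g τ τ') / g τ τ := by
    rw [← Finset.sum_attach]
    exact Finset.strongInduction_eq _ _
  rw [h, div_mul_cancel₀ _ (hg τ hτ)]
  ring

/-- Every tubing is the set of tight tubes of a feasible point.  The point is a combination of rank
functions, whose coefficients grow fast with the size of the tube, so that two comparable elements
are as far apart as the smallest tube of the tubing containing them dictates. -/
theorem IsProperTubing.exists_tubeFeasible (hP : PosetConnected P) (hcard : 2 ≤ Fintype.card P)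
    {T : Finset (Finset P)} (hT : IsProperTubing T) :
    ∃ p : P → ℝ, TubeFeasible p ∧ tightTubes p = T := by
  classical
  have hne : Nonempty P := Fintype.card_pos_iff.1 (by omega)
  set n : ℝ := (Fintype.card P : ℝ) with hn
  have hn1 : 1 ≤ n := one_le_card
  set M := tubeBase P with hM
  have hM1 : 1 < M := one_lt_tubeBase.2
  set N : ℝ := 2 ^ Fintype.card P with hN
  have hN1 : 1 ≤ N := one_le_pow₀ (by norm_num)
  have hMN : M = 16 * N * n ^ 4 := by
    rw [hM, tubeBase, pow_add]
    ring
  have hn34 : n ^ 3 ≤ n ^ 4 := pow_le_pow_right₀ hn1 (by norm_num)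
  choose r hr01 hr0 hrconst hrlt using fun τ => hT.1.exists_blockRank τ
  -- the whole poset is treated like a tube of the tubing
  let S : Finset (Finset P) := insert Finset.univ T
  have hunivT : Finset.univ ∉ T := fun h => (hT.2 _ h).2.2.ne Finset.card_univ
  have hTS : ∀ τ ∈ S, ∀ σ ∈ S, σ ⊂ τ → σ ∈ T := by
    intro τ _ σ hσ hστ
    rcases Finset.mem_insert.1 hσ with rfl | h
    · exact absurd (Finset.subset_univ τ) hστ.2
    · exact h
  have hlam : ∀ τ ∈ S, ∀ σ ∈ S, τ ⊆ σ ∨ σ ⊆ τ ∨ Disjoint τ σ := by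
    intro τ hτ σ hσ
    rcases Finset.mem_insert.1 hτ with rfl | hτ
    · exact Or.inr (Or.inl (Finset.subset_univ _))
    rcases Finset.mem_insert.1 hσ with rfl | hσ
    · exact Or.inl (Finset.subset_univ _)
    exact hT.1.2.1 τ hτ σ hσ
  have hconn : ∀ τ ∈ S, CompConnected (τ : Set P) ∧ 1 < τ.card := by
    intro τ hτ
    rcases Finset.mem_insert.1 hτ with rfl | hτ
    · rw [Finset.coe_univ, Finset.card_univ]
      exact ⟨posetConnected_iff.1 hP, hcard⟩
    · exact ⟨(isTube_iff.1 (hT.1.1 τ hτ)).2, (hT.2 τ hτ).2.1⟩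
  -- a comparable pair of `σ` that is not inside a smaller tube
  have hpair : ∀ τ ∈ S, ∀ σ : Finset P, CompConnected (σ : Set P) → 1 < σ.card →
      (∀ τ' ∈ S, τ' ⊂ τ → ¬ σ ⊆ τ') →
      ∃ i ∈ σ, ∃ j ∈ σ, i < j ∧ ∀ τ' ∈ T, τ' ⊂ τ → ¬ (i ∈ τ' ∧ j ∈ τ') := by
    intro τ hτ σ hσ hσ1 hmin
    obtain ⟨i, hi, j, hj, hij, hno⟩ := hσ.exists_lt_of_laminar
      (Finset.one_lt_card_iff_nontrivial.1 hσ1) {τ' | τ' ∈ T ∧ τ' ⊂ τ}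
      (T.finite_toSet.subset fun ρ h => h.1)
      (fun σ h ρ h' => hT.1.2.1 σ h.1 ρ h'.1)
      (fun ρ h => fun hsub => hmin ρ (Finset.mem_insert_of_mem h.1) h.2 (Finset.coe_subset.1 hsub))
    exact ⟨i, hi, j, hj, hij, fun ρ h1 h2 => hno ρ ⟨h1, h2⟩⟩
  have hrabs : ∀ τ x y, |r τ y - r τ x| ≤ n := fun τ x y => by
    have h1 := hr01 τ x
    have h2 := hr01 τ y
    rw [abs_le]
    constructor <;> linarith
  set g : Finset P → Finset P → ℝ := fun τ τ' => compSum τ (r τ') with hg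
  have hgabs : ∀ τ τ', |g τ τ'| ≤ n ^ 3 := fun τ τ' => by
    have := abs_compSum_le (p := r τ') (s := τ) (K := n) (by positivity)
      (fun i _ j _ => hrabs τ' i j)
    calc |g τ τ'| ≤ n ^ 2 * n := this
      _ = n ^ 3 := by ring
  have hr_mono : ∀ τ ∈ S, ∀ i ∈ τ, ∀ j ∈ τ, i < j → r τ i ≤ r τ j := by
    intro τ hτ i hi j hj hij
    by_cases hno : ∀ σ ∈ T, σ ⊂ τ → ¬ (i ∈ σ ∧ j ∈ σ)
    · linarith [hrlt τ i hi j hj hij hno]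
    · push Not at hno
      obtain ⟨σ, h1, h2, h3, h4⟩ := hno
      exact (hrconst τ σ h1 h2 i h3 j h4).le
  have hg1 : ∀ τ ∈ S, 1 ≤ g τ τ := by
    intro τ hτ
    obtain ⟨i, hi, j, hj, hij, hno⟩ := hpair τ hτ τ (hconn τ hτ).1 (hconn τ hτ).2
      (fun τ' _ h hsub => h.2 hsub)
    have h1 := hrlt τ i hi j hj hij hno
    have h2 : r τ j - r τ i ≤ g τ τ := by
      rw [hg]
      simp only
      rw [compSum_apply]
      exact Finset.single_le_sum (f := fun q : P × P => r τ q.2 - r τ q.1)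
        (fun q hq => sub_nonneg.2 (hr_mono τ hτ _ (mem_ltPairs.1 hq).1.1 _ (mem_ltPairs.1 hq).1.2
          (mem_ltPairs.1 hq).2))
        (mem_ltPairs.2 (show ((i, j).1 ∈ τ ∧ (i, j).2 ∈ τ) ∧ (i, j).1 < (i, j).2
          from ⟨⟨hi, hj⟩, hij⟩))
    linarith
  obtain ⟨L, hL⟩ := exists_triangular_solution S g tubeBound fun τ hτ => by
    linarith [hg1 τ hτ]
  have hScard : ∀ s : Finset (Finset P), (s.card : ℝ) ≤ N := by
    intro s
    have h : s.card ≤ 2 ^ Fintype.card P := by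
      rw [← Fintype.card_finset]
      exact Finset.card_le_univ s
    rw [hN]
    exact_mod_cast h
  have hbound : ∀ τ ∈ S, ∀ τ', τ' ⊂ τ → tubeBound τ' * M ≤ tubeBound τ := by
    intro τ _ τ' h
    rw [tubeBound, tubeBound, ← pow_succ]
    exact pow_le_pow_right₀ hM1.le (Finset.card_lt_card h)
  -- the coefficients have the order of magnitude of the bounds
  have hLbound : ∀ τ ∈ S, tubeBound τ ≤ 2 * n ^ 3 * L τ ∧ 0 ≤ L τ ∧ L τ ≤ 2 * tubeBound τ := by
    intro τ
    induction τ using Finset.strongInduction with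
    | H τ ih =>
      intro hτ
      have hpos := tubeBound_pos τ
      have hterm : ∀ τ' ∈ S.filter (· ⊂ τ), |L τ' * g τ τ'| ≤ 2 * (tubeBound τ / M) * n ^ 3 := by
        intro τ' hτ'
        rw [Finset.mem_filter] at hτ'
        obtain ⟨-, h1, h2⟩ := ih τ' hτ'.2 hτ'.1
        have h3 := hbound τ hτ τ' hτ'.2
        have h4 : tubeBound τ' ≤ tubeBound τ / M := (le_div_iff₀ (by linarith)).2 h3
        rw [abs_mul, abs_of_nonneg h1]
        exact mul_le_mul (by linarith) (hgabs τ τ') (abs_nonneg _) (by positivity)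
      have hsum : |∑ τ' ∈ S with τ' ⊂ τ, L τ' * g τ τ'| ≤ tubeBound τ / 8 := by
        calc |∑ τ' ∈ S with τ' ⊂ τ, L τ' * g τ τ'|
            ≤ ∑ τ' ∈ S with τ' ⊂ τ, |L τ' * g τ τ'| := Finset.abs_sum_le_sum_abs _ _
          _ ≤ ∑ τ' ∈ S with τ' ⊂ τ, 2 * (tubeBound τ / M) * n ^ 3 := Finset.sum_le_sum hterm
          _ = (S.filter (· ⊂ τ)).card * (2 * (tubeBound τ / M) * n ^ 3) := by
            rw [Finset.sum_const, nsmul_eq_mul]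
          _ ≤ N * (2 * (tubeBound τ / M) * n ^ 3) :=
            mul_le_mul_of_nonneg_right (hScard _) (by positivity)
          _ = tubeBound τ / 8 * (n ^ 3 / n ^ 4) := by rw [hMN]; field_simp; norm_num
          _ ≤ tubeBound τ / 8 := by
            have : n ^ 3 / n ^ 4 ≤ 1 := (div_le_one (by positivity)).2 hn34
            exact mul_le_of_le_one_right (by positivity) this
      have hs := abs_le.1 hsum
      have heq := hL τ hτ
      have hgτ := hg1 τ hτ
      have hgn := (le_abs_self _).trans (hgabs τ τ)
      have hLpos : 0 ≤ L τ := by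
        by_contra hneg
        push Not at hneg
        nlinarith
      refine ⟨?_, hLpos, ?_⟩
      · have := mul_le_mul_of_nonneg_left hgn hLpos
        linarith
      · have := mul_le_mul_of_nonneg_left hgτ hLpos
        linarith
  set p : P → ℝ := ∑ τ ∈ S, L τ • r τ with hp
  have hpx : ∀ x, p x = ∑ τ ∈ S, L τ * r τ x := fun x => by simp [hp, Finset.sum_apply]
  -- the tubes of the tubing are tight: a rank function of a larger or disjoint tube is constant
  -- on `τ`, and the remaining terms are the left hand side of the equation for `τ`
  have htight : ∀ τ ∈ S, compSum τ p = tubeBound τ := by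
    intro τ hτ
    have h1 : compSum τ p = ∑ τ' ∈ S, L τ' * g τ τ' := by simp [hp, hg, map_sum]
    rw [h1, ← hL τ hτ, ← Finset.sum_filter_add_sum_filter_not S (· ⊂ τ), add_comm]
    congr 1
    rw [Finset.sum_eq_single τ]
    · intro τ' hτ' hne'
      rw [Finset.mem_filter] at hτ'
      refine mul_eq_zero_of_right _ (compSum_eq_zero fun x hx y hy => ?_)
      rcases hlam τ hτ τ' hτ'.1 with h | h | h
      · have hss := h.ssubset_of_ne hne'.symm
        exact hrconst τ' τ (hTS τ' hτ'.1 τ hτ hss) hss x hx y hy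
      · exact absurd (h.ssubset_of_ne hne') hτ'.2
      · rw [hr0 τ' x (Finset.disjoint_left.1 h hx), hr0 τ' y (Finset.disjoint_left.1 h hy)]
    · intro h
      exact absurd (Finset.mem_filter.2 ⟨hτ, fun h => h.2 subset_rfl⟩) h
  -- the distance of two elements is dictated by the smallest tube containing both
  have hdist : ∀ τ ∈ S, ∀ i ∈ τ, ∀ j ∈ τ, i < j → (∀ σ ∈ T, σ ⊂ τ → ¬ (i ∈ σ ∧ j ∈ σ)) →
      tubeBound τ / M < p j - p i := by
    intro τ hτ i hi j hj hij hno
    have hpos := tubeBound_pos τ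
    have h1 : p j - p i = ∑ τ' ∈ S, L τ' * (r τ' j - r τ' i) := by
      rw [hpx, hpx, ← Finset.sum_sub_distrib]
      exact Finset.sum_congr rfl fun τ' _ => by ring
    rw [h1, ← Finset.add_sum_erase S _ hτ]
    have h2 : L τ ≤ L τ * (r τ j - r τ i) :=
      le_mul_of_one_le_right (hLbound τ hτ).2.1 (by linarith [hrlt τ i hi j hj hij hno])
    have h3 : ∀ τ' ∈ S.erase τ, -(2 * (tubeBound τ / M) * n) ≤ L τ' * (r τ' j - r τ' i) := by
      intro τ' hτ'
      obtain ⟨hne', hτ'⟩ := Finset.mem_erase.1 hτ'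
      have hrw : r τ' j = r τ' i → -(2 * (tubeBound τ / M) * n) ≤ L τ' * (r τ' j - r τ' i) := by
        intro h
        rw [h, sub_self, mul_zero]
        have : 0 ≤ 2 * (tubeBound τ / M) * n := by positivity
        linarith
      rcases hlam τ hτ τ' hτ' with h | h | h
      · have hss := h.ssubset_of_ne hne'.symm
        exact hrw (hrconst τ' τ (hTS τ' hτ' τ hτ hss) hss j hj i hi)
      · obtain ⟨-, h4, h5⟩ := hLbound τ' hτ'
        have h6 : tubeBound τ' ≤ tubeBound τ / M :=
          (le_div_iff₀ (by linarith)).2 (hbound τ hτ τ' (h.ssubset_of_ne hne'))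
        have h7 : |L τ' * (r τ' j - r τ' i)| ≤ 2 * (tubeBound τ / M) * n := by
          rw [abs_mul, abs_of_nonneg h4]
          exact mul_le_mul (by linarith) (hrabs τ' i j) (abs_nonneg _) (by positivity)
        exact (abs_le.1 h7).1
      · exact hrw (by rw [hr0 τ' i (Finset.disjoint_left.1 h hi),
          hr0 τ' j (Finset.disjoint_left.1 h hj)])
    have h4 : -(N * (2 * (tubeBound τ / M) * n)) ≤
        ∑ τ' ∈ S.erase τ, L τ' * (r τ' j - r τ' i) := by
      calc -(N * (2 * (tubeBound τ / M) * n))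
          ≤ -((S.erase τ).card * (2 * (tubeBound τ / M) * n)) :=
            neg_le_neg (mul_le_mul_of_nonneg_right (hScard _) (by positivity))
        _ = ∑ τ' ∈ S.erase τ, -(2 * (tubeBound τ / M) * n) := by
            rw [Finset.sum_const, nsmul_eq_mul]
            ring
        _ ≤ _ := Finset.sum_le_sum h3
    -- compare with the lower bound of the leading coefficient
    set B := tubeBound τ / M with hB
    have hBpos : 0 < B := by positivity
    have h5 : 16 * N * n ^ 4 * B ≤ 2 * n ^ 3 * L τ := by
      have : tubeBound τ = 16 * N * n ^ 4 * B := by rw [hB, ← hMN]; field_simp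
      rw [← this]
      exact (hLbound τ hτ).1
    have h6 : 8 * N * n * B ≤ L τ := by
      have h7 : 0 < 2 * n ^ 3 := by positivity
      refine le_of_mul_le_mul_left (le_trans (le_of_eq ?_) h5) h7
      ring
    have h8 : 1 * B ≤ N * n * B := by
      refine mul_le_mul_of_nonneg_right ?_ hBpos.le
      exact one_le_mul_of_one_le_of_one_le hN1 hn1
    linarith
  have hmono : Monotone p := by
    intro i j hij
    rcases hij.eq_or_lt with rfl | hij
    · exact le_rfl
    obtain ⟨τ, hτ⟩ := (S.filter fun τ => i ∈ τ ∧ j ∈ τ).exists_minimal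
      ⟨Finset.univ, by simp [S]⟩
    have hτ' := Finset.mem_filter.1 hτ.1
    have h1 := hdist τ hτ'.1 i hτ'.2.1 j hτ'.2.2 hij fun σ hσ hστ hmem =>
      hστ.2 (hτ.2 (Finset.mem_filter.2 ⟨Finset.mem_insert_of_mem hσ, hmem⟩) hστ.1)
    have h2 := tubeBound_pos τ
    have : 0 < tubeBound τ / M := by positivity
    linarith
  have hstrict : ∀ σ : Finset P, IsTube σ → 1 < σ.card → σ ∉ S → tubeBound σ < compSum σ p := by
    intro σ hσ hσ1 hσS
    obtain ⟨τ, hτ⟩ := (S.filter fun τ => σ ⊆ τ).exists_minimal ⟨Finset.univ, by simp [S]⟩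
    have hτ' := Finset.mem_filter.1 hτ.1
    have hστ : σ ⊂ τ := hτ'.2.ssubset_of_ne fun h => hσS (h ▸ hτ'.1)
    obtain ⟨i, hi, j, hj, hij, hno⟩ := hpair τ hτ'.1 σ (isTube_iff.1 hσ).2 hσ1
      fun τ' hτ'S h hsub => h.2 (hτ.2 (Finset.mem_filter.2 ⟨hτ'S, hsub⟩) h.1)
    calc tubeBound σ ≤ tubeBound τ / M := (le_div_iff₀ (by linarith)).2 (hbound τ hτ'.1 σ hστ)
      _ < p j - p i := hdist τ hτ'.1 i (hτ'.2 hi) j (hτ'.2 hj) hij hno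
      _ ≤ compSum σ p := sub_le_compSum hmono hi hj hij
  refine ⟨p, ⟨fun σ hσ hσ1 => ?_, htight _ (Finset.mem_insert_self _ _)⟩, ?_⟩
  · by_cases hσS : σ ∈ S
    · exact (htight σ hσS).ge
    · exact (hstrict σ hσ hσ1 hσS).le
  · ext σ
    rw [mem_tightTubes]
    constructor
    · rintro ⟨hσ, heq⟩
      by_contra hσT
      have hσS : σ ∉ S := fun h => by
        rcases Finset.mem_insert.1 h with rfl | h
        · exact hσ.2.2.ne Finset.card_univ
        · exact hσT h
      exact (hstrict σ hσ.1 hσ.2.1 hσS).ne heq.symm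
    · exact fun hσ => ⟨hT.2 σ hσ, htight σ (Finset.mem_insert_of_mem hσ)⟩

end TightPoints

/-! ### Existence of poset associahedra -/

section Existence

variable {P : Type*} [PartialOrder P] [Fintype P]

theorem monotone_of_forall_covBy {q : P → ℝ} (h : ∀ i j : P, i ⋖ j → q i ≤ q j) : Monotone q := by
  intro x y hxy
  induction x using WellFoundedGT.induction with
  | ind x ih =>
    rcases hxy.eq_or_lt with rfl | hlt
    · exact le_rfl
    obtain ⟨z, hxz, hzy⟩ := exists_covBy_le_of_lt hlt
    exact (h _ _ hxz).trans (ih z hxz.lt hzy)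

theorem isProperTube_or_eq_univ {τ : Finset P} (hτ : IsTube τ) (h1 : 1 < τ.card) :
    IsProperTube τ ∨ τ = Finset.univ := by
  by_cases h : τ = Finset.univ
  · exact Or.inr h
  · exact Or.inl ⟨hτ, h1, (Finset.card_lt_iff_ne_univ τ).2 h⟩

/-- A direction in which no tube sum decreases is constant. -/
theorem eq_of_forall_compSum_nonneg (hP : PosetConnected P) {q : P → ℝ}
    (hq : ∀ τ : Finset P, IsProperTube τ → 0 ≤ compSum τ q)
    (hq0 : compSum Finset.univ q = 0) (x y : P) : q x = q y := by
  classical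
  have hmono : Monotone q := by
    refine monotone_of_forall_covBy fun i j h => ?_
    have h1 : 0 ≤ compSum {i, j} q := by
      rcases isProperTube_or_eq_univ (isTube_pair_of_covBy h)
        (by rw [Finset.card_pair h.lt.ne]; norm_num) with h' | h'
      · exact hq _ h'
      · rw [h', hq0]
    rw [compSum_pair h.lt] at h1
    linarith
  have hlt : ∀ i j : P, i < j → q i = q j := fun i j hij => by
    have h1 := sub_le_compSum hmono (Finset.mem_univ i) (Finset.mem_univ j) hij
    have h2 := hmono hij.le
    linarith
  have h := (posetConnected_iff.1 hP).2 {z | q z = q y} (Set.subset_univ _) ⟨y, rfl⟩ (by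
    rintro u hu v - (h | h)
    · rcases h.eq_or_lt with rfl | h
      · exact hu
      · exact (hlt _ _ h).symm.trans hu
    · rcases h.eq_or_lt with rfl | h
      · exact hu
      · exact (hlt _ _ h).trans hu)
  exact h (Set.mem_univ x)

/-- The complex of proper tubings is realized by the normals of the tube inequalities, in
coordinates on the affine space of the polytope centred at the point `p₀` with no tight tubes,
scaled by the slack of the inequalities at `p₀`. -/
theorem exists_isRealization (hP : PosetConnected P) (hcard : 2 ≤ Fintype.card P) :
    ∃ a : Finset P → EuclideanSpace ℝ (Fin (Fintype.card P - 2)),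
      IsRealization a (tubingComplex P) := by
  classical
  have hne : Nonempty P := Fintype.card_pos_iff.1 (by omega)
  have hcard0 : (Fintype.card P : ℝ) ≠ 0 := by
    have : (1 : ℝ) ≤ Fintype.card P := one_le_card
    linarith
  obtain ⟨p₀, hp₀, hp₀T⟩ := isProperTubing_empty.exists_tubeFeasible hP hcard
  -- the kernel of `φ` is the direction space of the polytope; the sum of the values is fixed in
  -- order to divide out the constant functions
  let sumL : (P → ℝ) →ₗ[ℝ] ℝ := ∑ x : P, LinearMap.proj x
  have hsumL : ∀ q, sumL q = ∑ x, q x := fun q => by simp [sumL]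
  let φ : (P → ℝ) →ₗ[ℝ] ℝ × ℝ := sumL.prod (compSum Finset.univ)
  have hφx : ∀ q, φ q = (sumL q, compSum Finset.univ q) := fun _ => rfl
  have hφ : Function.Surjective φ := by
    have hc : compSum Finset.univ p₀ ≠ 0 := by
      rw [hp₀.eq]
      exact (tubeBound_pos _).ne'
    rintro ⟨u, v⟩
    let w := v / compSum Finset.univ p₀
    refine ⟨w • p₀ + fun _ => (u - w * sumL p₀) / Fintype.card P, ?_⟩
    have h1 : sumL (fun _ : P => (u - w * sumL p₀) / Fintype.card P) = u - w * sumL p₀ := by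
      rw [hsumL, Finset.sum_const, Finset.card_univ, nsmul_eq_mul]
      field_simp
    have h2 : w * compSum Finset.univ p₀ = v := div_mul_cancel₀ _ hc
    rw [hφx, map_add, map_add, map_smul, map_smul, h1, compSum_const, smul_eq_mul, smul_eq_mul, h2,
      add_zero, add_sub_cancel]
  have hdim : Module.finrank ℝ (LinearMap.ker φ) = Fintype.card P - 2 := by
    have h1 := φ.finrank_range_add_finrank_ker
    rw [LinearMap.range_eq_top.2 hφ, finrank_top, Module.finrank_prod, Module.finrank_self,
      Module.finrank_fintype_fun_eq_card] at h1
    omega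
  have e : EuclideanSpace ℝ (Fin (Fintype.card P - 2)) ≃ₗ[ℝ] LinearMap.ker φ :=
    LinearEquiv.ofFinrankEq _ _ (by rw [finrank_euclideanSpace_fin, hdim])
  have he : ∀ y, ∑ x, (e y).1 x = 0 ∧ compSum Finset.univ (e y).1 = 0 := fun y => by
    have h1 := LinearMap.mem_ker.1 (e y).2
    rwa [hφx, Prod.mk_eq_zero, hsumL] at h1
  have hker : ∀ q : P → ℝ, ∑ x, q x = 0 → compSum Finset.univ q = 0 → ∃ y, (e y).1 = q := by
    intro q h1 h2
    refine ⟨e.symm ⟨q, ?_⟩, by simp⟩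
    rw [LinearMap.mem_ker, hφx, hsumL, h1, h2, Prod.mk_zero_zero]
  -- the inequality `tubeBound τ ≤ compSum τ (p₀ + q)` reads `-compSum τ q / slack τ ≤ 1`
  let slack : Finset P → ℝ := fun τ => compSum τ p₀ - tubeBound τ
  have hslack : ∀ τ, IsProperTube τ → 0 < slack τ := fun τ hτ => by
    refine sub_pos.2 (lt_of_le_of_ne (hp₀.le τ hτ.1 hτ.2.1) fun h => ?_)
    have h1 := mem_tightTubes.2 ⟨hτ, h.symm⟩
    rw [hp₀T] at h1
    simp at h1
  let ψ : Finset P → (EuclideanSpace ℝ (Fin (Fintype.card P - 2)) →ₗ[ℝ] ℝ) := fun τ =>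
    if IsProperTube τ then
      -(slack τ)⁻¹ • (compSum τ ∘ₗ (LinearMap.ker φ).subtype ∘ₗ e.toLinearMap)
    else 0
  let a : Finset P → EuclideanSpace ℝ (Fin (Fintype.card P - 2)) := fun τ =>
    (InnerProductSpace.toDual ℝ _).symm (LinearMap.toContinuousLinearMap (ψ τ))
  have ha : ∀ τ y, IsProperTube τ → inner ℝ (a τ) y = -(slack τ)⁻¹ * compSum τ (e y).1 := by
    intro τ y hτ
    simp only [a, InnerProductSpace.toDual_symm_apply]
    simp [ψ, hτ]
  have ha0 : ∀ τ y, ¬ IsProperTube τ → inner ℝ (a τ) y = 0 := by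
    intro τ y hτ
    simp only [a, InnerProductSpace.toDual_symm_apply]
    simp [ψ, hτ]
  have hle : ∀ τ y, IsProperTube τ →
      (inner ℝ (a τ) y ≤ 1 ↔ tubeBound τ ≤ compSum τ (p₀ + (e y).1)) := by
    intro τ y hτ
    have hs := hslack τ hτ
    rw [ha τ y hτ, map_add, neg_mul, inv_mul_eq_div, ← neg_div, div_le_one hs]
    simp only [slack]
    constructor <;> intro h <;> linarith
  have heq : ∀ τ y, IsProperTube τ →
      (inner ℝ (a τ) y = 1 ↔ compSum τ (p₀ + (e y).1) = tubeBound τ) := by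
    intro τ y hτ
    have hs := hslack τ hτ
    rw [ha τ y hτ, map_add, neg_mul, inv_mul_eq_div, ← neg_div, div_eq_one_iff_eq hs.ne']
    simp only [slack]
    constructor <;> intro h <;> linarith
  have hmem : ∀ y, y ∈ polyhedron (innerFamily a) ↔ TubeFeasible (p₀ + (e y).1) := by
    intro y
    constructor
    · intro hy
      have huniv : compSum Finset.univ (p₀ + (e y).1) = tubeBound (Finset.univ : Finset P) := by
        rw [map_add, (he y).2, add_zero, hp₀.eq]
      refine ⟨fun τ hτ h1 => ?_, huniv⟩
      rcases isProperTube_or_eq_univ hτ h1 with h | rfl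
      · exact (hle τ y h).1 (hy τ)
      · exact huniv.ge
    · intro hp τ
      rw [innerFamily_apply]
      by_cases hτ : IsProperTube τ
      · exact (hle τ y hτ).2 (hp.le τ hτ.1 hτ.2.1)
      · rw [ha0 τ y hτ]
        exact zero_le_one
  have htight : ∀ y, tight (innerFamily a) y = tightTubes (p₀ + (e y).1) := by
    intro y
    ext τ
    rw [mem_tight, mem_tightTubes, innerFamily_apply]
    by_cases hτ : IsProperTube τ
    · rw [heq τ y hτ, and_iff_right hτ]
    · simp [ha0 τ y hτ, hτ]
  refine ⟨a, ⟨zero_mem_interior_hullZero fun y hy => ?_, ⟨fun y hy => ?_, fun T hT => ?_⟩,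
    fun T hT T' h => IsProperTubing.mono hT h⟩⟩
  · have hconst := eq_of_forall_compSum_nonneg hP (q := (e y).1) (fun τ hτ => by
      have h1 := hy τ
      rw [ha τ y hτ] at h1
      have h2 := inv_pos.2 (hslack τ hτ)
      by_contra hneg
      push Not at hneg
      nlinarith) (he y).2
    have h0 : (e y).1 = 0 := by
      ext x
      have h1 := (he y).1
      rw [Finset.sum_congr rfl fun z _ => hconst z x, Finset.sum_const, Finset.card_univ,
        nsmul_eq_mul] at h1
      exact (mul_eq_zero.1 h1).resolve_left hcard0
    exact e.map_eq_zero_iff.1 (Subtype.ext h0)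
  · rw [htight]
    exact ((hmem y).1 hy).isProperTubing_tightTubes
  · obtain ⟨p, hp, rfl⟩ := IsProperTubing.exists_tubeFeasible hP hcard hT
    -- shift `p` by a constant so that it has the same sum of values as `p₀`
    let t : ℝ := (∑ x, (p x - p₀ x)) / Fintype.card P
    obtain ⟨y, hy⟩ := hker (p - p₀ - fun _ => t) (by
      simp only [Pi.sub_apply, Finset.sum_sub_distrib (s := Finset.univ) (g := fun _ : P => t),
        Finset.sum_const, Finset.card_univ, nsmul_eq_mul, t]
      field_simp
      simp) (by rw [map_sub, map_sub, hp.eq, hp₀.eq, compSum_const]; ring)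
    have hshift : ∀ s, compSum s (p₀ + (e y).1) = compSum s p := fun s => by
      rw [hy, map_add, map_sub, map_sub, compSum_const]
      ring
    refine ⟨y, (hmem y).2 ⟨fun τ h1 h2 => ?_, ?_⟩, ?_⟩
    · rw [hshift]
      exact hp.le τ h1 h2
    · rw [hshift]
      exact hp.eq
    · rw [htight]
      ext τ
      rw [mem_tightTubes, mem_tightTubes, hshift]

/-- In every realization the ambient dimension is `|P| - 2`, the largest size of a proper
tubing. -/
theorem IsRealization.dim_add_two (hP : PosetConnected P) (hcard : 2 ≤ Fintype.card P) {d : ℕ}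
    {a : Finset P → EuclideanSpace ℝ (Fin d)} (h : IsRealization a (tubingComplex P)) :
    d + 2 = Fintype.card P := by
  obtain ⟨b, hb⟩ := exists_isRealization hP hcard
  obtain ⟨S, hS, hSd⟩ := h.exists_card_eq
  obtain ⟨S', hS', hS'd⟩ := hb.exists_card_eq
  have h1 := h.card_le hS'
  have h2 := hb.card_le hS
  omega

end Existence

/-! ### Contraction of a tube -/

section Contraction

variable {P : Type*} [PartialOrder P]

/-- `π : P → R` contracts the set `τ` to the point `o` and is injective elsewhere; the order of `R`
is the one generated by the order of `P`. -/
structure IsContraction {R : Type*} [PartialOrder R] (τ : Finset P) (π : P → R) (o : R) :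
    Prop where
  surj : Function.Surjective π
  eq_iff : ∀ x, π x = o ↔ x ∈ τ
  inj : ∀ x y, π x = π y → x ∉ τ → x = y
  le_iff : ∀ x y, π x ≤ π y ↔ x ≤ y ∨ (∃ t ∈ τ, x ≤ t) ∧ ∃ t ∈ τ, t ≤ y

open Classical in
/-- Nonempty convex sets can be contracted. -/
theorem exists_isContraction.{u} {P : Type u} [PartialOrder P] [Fintype P] {τ : Finset P}
    (hτ : Set.OrdConnected (τ : Set P)) (hne : τ.Nonempty) :
    ∃ (R : Type u) (_ : PartialOrder R) (_ : Fintype R) (π : P → R) (o : R),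
      IsContraction τ π o := by
  obtain ⟨t₀, ht₀⟩ := hne
  let rel : P → P → Prop := fun x y => x ≤ y ∨ (∃ t ∈ τ, x ≤ t) ∧ ∃ t ∈ τ, t ≤ y
  have htrans : ∀ {x y z}, rel x y → rel y z → rel x z := by
    rintro x y z (h | ⟨⟨t, ht, hxt⟩, t', ht', hty⟩) (h' | ⟨⟨s, hs, hys⟩, s', hs', hsz⟩)
    · exact Or.inl (h.trans h')
    · exact Or.inr ⟨⟨s, hs, h.trans hys⟩, s', hs', hsz⟩
    · exact Or.inr ⟨⟨t, ht, hxt⟩, t', ht', hty.trans h'⟩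
    · exact Or.inr ⟨⟨t, ht, hxt⟩, s', hs', hsz⟩
  have hmem : ∀ {x y}, rel x y → rel y x → x = y ∨ x ∈ τ ∧ y ∈ τ := by
    rintro x y (h | ⟨⟨t, ht, hxt⟩, t', ht', hty⟩) (h' | ⟨⟨s, hs, hys⟩, s', hs', hsz⟩)
    · exact Or.inl (h.antisymm h')
    · exact Or.inr ⟨hτ.out hs' hs ⟨hsz, h.trans hys⟩, hτ.out hs' hs ⟨hsz.trans h, hys⟩⟩
    · exact Or.inr ⟨hτ.out ht' ht ⟨hty.trans h', hxt⟩, hτ.out ht' ht ⟨hty, h'.trans hxt⟩⟩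
    · exact Or.inr ⟨hτ.out hs' ht ⟨hsz, hxt⟩, hτ.out ht' hs ⟨hty, hys⟩⟩
  have hττ : ∀ {x y}, x ∈ τ → y ∈ τ → rel x y := fun hx hy =>
    Or.inr ⟨⟨_, hx, le_rfl⟩, _, hy, le_rfl⟩
  -- representatives: the points outside `τ`, and `t₀`
  let c : P → {x : P // x ∉ τ ∨ x = t₀} := fun x =>
    if h : x ∈ τ then ⟨t₀, Or.inr rfl⟩ else ⟨x, Or.inl h⟩
  have hc : ∀ x, rel x (c x).1 ∧ rel (c x).1 x := by
    intro x
    by_cases h : x ∈ τ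
    · simp only [c, h, dite_true]
      exact ⟨hττ h ht₀, hττ ht₀ h⟩
    · simp only [c, h, dite_false]
      exact ⟨Or.inl le_rfl, Or.inl le_rfl⟩
  let ord : PartialOrder {x : P // x ∉ τ ∨ x = t₀} :=
    { le := fun x y => rel x.1 y.1
      lt := fun x y => rel x.1 y.1 ∧ ¬ rel y.1 x.1
      lt_iff_le_not_ge := fun _ _ => Iff.rfl
      le_refl := fun x => Or.inl le_rfl
      le_trans := fun x y z => htrans
      le_antisymm := by
        rintro ⟨x, hx⟩ ⟨y, hy⟩ h h'
        rcases hmem h h' with h | ⟨h1, h2⟩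
        · exact Subtype.ext h
        · exact Subtype.ext ((hx.resolve_left (not_not.2 h1)).trans
            (hy.resolve_left (not_not.2 h2)).symm) }
  refine ⟨{x : P // x ∉ τ ∨ x = t₀}, ord, inferInstance, c, ⟨t₀, Or.inr rfl⟩, ?_, fun x => ?_,
    fun x y hxy hx => ?_, fun x y => ⟨fun h => htrans (htrans (hc x).1 h) (hc y).2,
      fun h => htrans (htrans (hc x).2 h) (hc y).1⟩⟩
  · rintro ⟨x, hx⟩
    refine ⟨x, ?_⟩
    by_cases h : x ∈ τ
    · simp only [c, h, dite_true]
      exact Subtype.ext (hx.resolve_left (not_not.2 h)).symm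
    · simp [c, h]
  · by_cases h : x ∈ τ
    · simp [c, h]
    · simp only [c, h, dite_false, iff_false]
      intro he
      have he' : x = t₀ := congrArg Subtype.val he
      exact h (he' ▸ ht₀)
  · by_cases h : y ∈ τ
    · simp only [c, h, hx, dite_true, dite_false] at hxy
      have he' : x = t₀ := congrArg Subtype.val hxy
      exact absurd (he' ▸ ht₀) hx
    · simpa [c, h, hx] using hxy

namespace IsContraction

variable {R : Type*}

open Classical in
/-- The preimage of a finite set under the contraction. -/
noncomputable def pre {P : Type*} [Fintype P] (π : P → R) (ρ : Finset R) : Finset P :=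
  Finset.univ.filter fun x => π x ∈ ρ

@[simp] theorem mem_pre {P : Type*} [Fintype P] {π : P → R} {ρ : Finset R} {x : P} :
    x ∈ pre π ρ ↔ π x ∈ ρ := by simp [pre]

variable [PartialOrder R] {τ : Finset P} {π : P → R} {o : R}

theorem mono (h : IsContraction τ π o) {x y : P} (hxy : x ≤ y) : π x ≤ π y :=
  (h.le_iff x y).2 (Or.inl hxy)

variable [Fintype P]

theorem pre_subset_pre (h : IsContraction τ π o) {ρ ρ' : Finset R} :
    pre π ρ ⊆ pre π ρ' ↔ ρ ⊆ ρ' := by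
  refine ⟨fun hs r hr => ?_, fun hs x hx => mem_pre.2 (hs (mem_pre.1 hx))⟩
  obtain ⟨x, rfl⟩ := h.surj r
  exact mem_pre.1 (hs (mem_pre.2 hr))

theorem pre_injective (h : IsContraction τ π o) : Function.Injective (pre π) := fun _ _ he =>
  (h.pre_subset_pre.1 he.subset).antisymm (h.pre_subset_pre.1 he.symm.subset)

theorem disjoint_pre (h : IsContraction τ π o) {ρ ρ' : Finset R} :
    Disjoint (pre π ρ) (pre π ρ') ↔ Disjoint ρ ρ' := by
  simp only [Finset.disjoint_left, mem_pre]
  exact ⟨fun hd r hr hr' => by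
    obtain ⟨x, rfl⟩ := h.surj r
    exact hd hr hr', fun hd x => @hd (π x)⟩

theorem subset_pre_or_disjoint (h : IsContraction τ π o) (ρ : Finset R) :
    τ ⊆ pre π ρ ∨ Disjoint τ (pre π ρ) := by
  by_cases ho : o ∈ ρ
  · exact Or.inl fun x hx => mem_pre.2 (((h.eq_iff x).2 hx).symm ▸ ho)
  · exact Or.inr (Finset.disjoint_left.2 fun x hx hx' =>
      ho ((h.eq_iff x).2 hx ▸ mem_pre.1 hx'))

theorem card_le_card_pre (h : IsContraction τ π o) (ρ : Finset R) : ρ.card ≤ (pre π ρ).card := by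
  classical
  refine le_trans (Finset.card_le_card fun r hr => ?_) (Finset.card_image_le (f := π))
  obtain ⟨x, rfl⟩ := h.surj r
  exact Finset.mem_image_of_mem π (mem_pre.2 hr)

theorem not_pre_subset (h : IsContraction τ π o) {ρ : Finset R} (hρ : 1 < ρ.card) :
    ¬ pre π ρ ⊆ τ := by
  intro hsub
  obtain ⟨a, ha, b, hb, hab⟩ := Finset.one_lt_card.1 hρ
  obtain ⟨x, rfl⟩ := h.surj a
  obtain ⟨y, rfl⟩ := h.surj b
  exact hab (((h.eq_iff x).2 (hsub (mem_pre.2 ha))).trans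
    ((h.eq_iff y).2 (hsub (mem_pre.2 hb))).symm)

theorem isTube_pre [Finite R] (h : IsContraction τ π o) (hτ : IsTube τ) {ρ : Finset R}
    (hρ : IsTube ρ) : IsTube (pre π ρ) := by
  rw [isTube_iff] at hτ hρ ⊢
  refine ⟨⟨fun x hx y hy z hz => ?_⟩, ?_, fun A hA ⟨a, ha⟩ hcl => ?_⟩
  · exact mem_pre.2 (hρ.1.out (mem_pre.1 hx) (mem_pre.1 hy) ⟨h.mono hz.1, h.mono hz.2⟩)
  · obtain ⟨r, hr⟩ := hρ.2.1
    obtain ⟨x, rfl⟩ := h.surj r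
    exact ⟨x, mem_pre.2 hr⟩
  · -- a part closed under comparabilities contains `τ` or is disjoint from it
    have hτA : o ∈ ρ → ∀ t ∈ τ, t ∈ A → ∀ t' ∈ τ, t' ∈ A := by
      intro ho t ht htA t' ht'
      have hτρ : τ ⊆ pre π ρ := fun x hx => mem_pre.2 (((h.eq_iff x).2 hx).symm ▸ ho)
      refine (hτ.2.2 (τ ∩ A) Set.inter_subset_left ⟨t, ht, htA⟩ ?_ ht').2
      rintro z ⟨hz, hzA⟩ w hw hzw
      exact ⟨hw, hcl z hzA w (hτρ hw) hzw⟩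
    have himg : (ρ : Set R) ⊆ π '' A := by
      refine hρ.2.2 (π '' A) ?_ ⟨π a, a, ha, rfl⟩ ?_
      · rintro _ ⟨x, hx, rfl⟩
        exact mem_pre.1 (hA hx)
      · rintro _ ⟨x, hx, rfl⟩ r hr hle
        obtain ⟨y, rfl⟩ := h.surj r
        have hxρ : π x ∈ ρ := mem_pre.1 (hA hx)
        refine ⟨y, ?_, rfl⟩
        have hthrough : ∀ {t t'}, t ∈ τ → t' ∈ τ → (x ≤ t ∨ t ≤ x) → (t' ≤ y ∨ y ≤ t') →
            o ∈ ρ → y ∈ A := by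
          intro t t' ht ht' hxt hty ho
          have hto : ∀ s ∈ τ, s ∈ pre π ρ := fun s hs =>
            mem_pre.2 (((h.eq_iff s).2 hs).symm ▸ ho)
          have h1 := hcl x hx t (hto t ht) hxt
          exact hcl t' (hτA ho t ht h1 t' ht') y (mem_pre.2 hr) hty
        rcases hle with hle | hle
        · rcases (h.le_iff x y).1 hle with h' | ⟨⟨t, ht, hxt⟩, t', ht', hty⟩
          · exact hcl x hx y (mem_pre.2 hr) (Or.inl h')
          · refine hthrough ht ht' (Or.inl hxt) (Or.inl hty) (hρ.1.out hxρ hr ⟨?_, ?_⟩)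
            · rw [← (h.eq_iff t).2 ht]
              exact h.mono hxt
            · rw [← (h.eq_iff t').2 ht']
              exact h.mono hty
        · rcases (h.le_iff y x).1 hle with h' | ⟨⟨t, ht, hyt⟩, t', ht', htx⟩
          · exact hcl x hx y (mem_pre.2 hr) (Or.inr h')
          · refine hthrough ht' ht (Or.inr htx) (Or.inr hyt) (hρ.1.out hr hxρ ⟨?_, ?_⟩)
            · rw [← (h.eq_iff t).2 ht]
              exact h.mono hyt
            · rw [← (h.eq_iff t').2 ht']
              exact h.mono htx
    intro x hx
    obtain ⟨z, hz, hzx⟩ := himg (mem_pre.1 hx)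
    by_cases hxτ : x ∈ τ
    · have hzτ : z ∈ τ := (h.eq_iff z).1 (hzx.trans ((h.eq_iff x).2 hxτ))
      exact hτA ((h.eq_iff x).2 hxτ ▸ mem_pre.1 hx) z hzτ hz x hxτ
    · exact h.inj x z hzx.symm hxτ ▸ hz

/-- A set whose preimage is a tube that contains `τ`, or is disjoint from `τ` and forms no directed
cycle with it, is a tube. -/
theorem isTube_of_pre [Finite R] (h : IsContraction τ π o) {ρ : Finset R}
    (hρ : IsTube (pre π ρ))
    (hcyc : Disjoint (pre π ρ) τ → ¬ ((∃ x ∈ pre π ρ, ∃ t ∈ τ, x ≤ t) ∧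
      ∃ y ∈ pre π ρ, ∃ t ∈ τ, t ≤ y)) : IsTube ρ := by
  rw [isTube_iff] at hρ ⊢
  refine ⟨⟨?_⟩, ?_, fun B hB ⟨b, hb⟩ hcl r hr => ?_⟩
  · intro a ha c hc b hb
    obtain ⟨x, rfl⟩ := h.surj a
    obtain ⟨z, rfl⟩ := h.surj c
    obtain ⟨y, rfl⟩ := h.surj b
    have hx := mem_pre.2 (Finset.mem_coe.1 ha)
    have hz := mem_pre.2 (Finset.mem_coe.1 hc)
    have hcyc' : ∀ {t t'}, t ∈ τ → t' ∈ τ → x ≤ t → t' ≤ z → τ ⊆ pre π ρ := by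
      intro t t' ht ht' hxt htz
      refine (h.subset_pre_or_disjoint ρ).resolve_right fun hd => ?_
      exact hcyc hd.symm ⟨⟨x, hx, t, ht, hxt⟩, z, hz, t', ht', htz⟩
    refine mem_pre.1 (?_ : y ∈ pre π ρ)
    rcases (h.le_iff x y).1 hb.1 with h1 | ⟨⟨t, ht, hxt⟩, t', ht', hty⟩ <;>
      rcases (h.le_iff y z).1 hb.2 with h2 | ⟨⟨s, hs, hys⟩, s', hs', hsz⟩
    · exact hρ.1.out hx hz ⟨h1, h2⟩
    · exact hρ.1.out hx (hcyc' hs hs' (h1.trans hys) hsz hs) ⟨h1, hys⟩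
    · exact hρ.1.out (hcyc' ht ht' hxt (hty.trans h2) ht') hz ⟨hty, h2⟩
    · have hsub := hcyc' ht hs' hxt hsz
      exact hρ.1.out (hsub ht') (hsub hs) ⟨hty, hys⟩
  · obtain ⟨x, hx⟩ := hρ.2.1
    exact ⟨π x, mem_pre.1 hx⟩
  · obtain ⟨x, rfl⟩ := h.surj r
    obtain ⟨y, rfl⟩ := h.surj b
    refine (hρ.2.2 {z | z ∈ pre π ρ ∧ π z ∈ B} (fun z hz => hz.1)
      ⟨y, mem_pre.2 (hB hb), hb⟩ ?_ (mem_pre.2 hr)).2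
    rintro z ⟨hz, hzB⟩ w hw hzw
    exact ⟨hw, hcl _ hzB _ (mem_pre.1 hw) (hzw.imp h.mono h.mono)⟩

theorem posetConnected [Finite R] (h : IsContraction τ π o) (hP : PosetConnected P) :
    PosetConnected R := by
  rw [posetConnected_iff] at hP ⊢
  obtain ⟨⟨x₀, -⟩, hP⟩ := hP
  refine ⟨⟨π x₀, trivial⟩, fun B _ ⟨b, hb⟩ hcl r _ => ?_⟩
  obtain ⟨x, rfl⟩ := h.surj r
  obtain ⟨y, rfl⟩ := h.surj b
  exact hP (π ⁻¹' B) (Set.subset_univ _) ⟨y, hb⟩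
    (fun z hz w _ hzw => hcl _ hz _ trivial (hzw.imp h.mono h.mono)) (Set.mem_univ x)

theorem card_lt [Fintype R] (h : IsContraction τ π o) (hτ : 1 < τ.card) :
    Fintype.card R < Fintype.card P := by
  refine Fintype.card_lt_of_surjective_not_injective π h.surj fun hinj => ?_
  obtain ⟨a, ha, b, hb, hab⟩ := Finset.one_lt_card.1 hτ
  exact hab (hinj (((h.eq_iff a).2 ha).trans ((h.eq_iff b).2 hb).symm))

theorem two_le_card [Fintype R] (h : IsContraction τ π o) (hτ : IsProperTube τ) :
    2 ≤ Fintype.card R := by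
  obtain ⟨t, ht⟩ := Finset.card_pos.1 (zero_lt_one.trans hτ.2.1)
  obtain ⟨x, hx⟩ : ∃ x, x ∉ τ := by
    by_contra! hall
    exact hτ.2.2.ne (Finset.card_eq_iff_eq_univ τ |>.2 (Finset.eq_univ_of_forall hall))
  refine Fintype.one_lt_card_iff.2 ⟨π x, o, fun he => hx ((h.eq_iff x).1 he)⟩

end IsContraction

end Contraction

/-! ### The link of a tube -/

section Transport

variable {P Q : Type*} [PartialOrder P] [PartialOrder Q]

theorem compConnected_map_iff (f : Q ↪o P) {σ : Finset Q} :
    CompConnected (σ.map f.toEmbedding : Set P) ↔ CompConnected (σ : Set Q) := by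
  rw [Finset.coe_map]
  constructor
  · rintro ⟨⟨_, x₀, hx₀, rfl⟩, h⟩
    refine ⟨⟨x₀, hx₀⟩, fun A hA ⟨a, ha⟩ hcl y hy => ?_⟩
    obtain ⟨z, hz, hzy⟩ := h (f '' A) (Set.image_mono hA) ⟨f a, a, ha, rfl⟩ (by
      rintro _ ⟨x, hx, rfl⟩ _ ⟨y, hy, rfl⟩ hxy
      exact ⟨y, hcl x hx y hy (hxy.imp f.le_iff_le.1 f.le_iff_le.1), rfl⟩) ⟨y, hy, rfl⟩
    exact f.injective hzy ▸ hz
  · rintro ⟨⟨x₀, hx₀⟩, h⟩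
    refine ⟨⟨f x₀, x₀, hx₀, rfl⟩, fun A hA ⟨a, ha⟩ hcl => ?_⟩
    rintro _ ⟨y, hy, rfl⟩
    obtain ⟨x, hx, rfl⟩ := hA ha
    exact (h {z | z ∈ σ ∧ f z ∈ A} (fun z hz => hz.1) ⟨x, hx, ha⟩ (fun z hz w hw hzw =>
      ⟨hw, hcl _ hz.2 _ ⟨w, hw, rfl⟩ (hzw.imp f.monotone.imp f.monotone.imp)⟩) hy).2

/-- Tubes of a convex subposet are the tubes of the poset contained in it. -/
theorem isTube_map_iff [Finite P] [Finite Q] (f : Q ↪o P) (hf : (Set.range f).OrdConnected)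
    {σ : Finset Q} : IsTube (σ.map f.toEmbedding) ↔ IsTube σ := by
  rw [isTube_iff, isTube_iff, compConnected_map_iff]
  refine and_congr_left fun _ => ⟨fun h => ⟨fun x hx y hy z hz => ?_⟩,
    fun h => ⟨fun x hx y hy z hz => ?_⟩⟩
  · have := h.out (Finset.mem_coe.2 (Finset.mem_map_of_mem f.toEmbedding hx))
      (Finset.mem_coe.2 (Finset.mem_map_of_mem f.toEmbedding hy))
      (⟨f.monotone hz.1, f.monotone hz.2⟩ : f z ∈ Set.Icc _ _)
    exact (Finset.mem_map' f.toEmbedding).1 this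
  · obtain ⟨u, hu, rfl⟩ := Finset.mem_map.1 (Finset.mem_coe.1 hx)
    obtain ⟨v, hv, rfl⟩ := Finset.mem_map.1 (Finset.mem_coe.1 hy)
    obtain ⟨w, rfl⟩ := hf.out ⟨u, rfl⟩ ⟨v, rfl⟩ hz
    exact Finset.mem_coe.2 (Finset.mem_map_of_mem f.toEmbedding
      (h.out hu hv ⟨f.le_iff_le.1 hz.1, f.le_iff_le.1 hz.2⟩))

theorem TubingEdge.map (f : Q ↪o P) {T : Finset (Finset Q)} {T' : Finset (Finset P)}
    {σ σ' : Finset Q} (h : ∀ ρ, ρ ∈ T → ρ.map f.toEmbedding ∈ T')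
    (he : TubingEdge T σ σ') : TubingEdge T' (σ.map f.toEmbedding) (σ'.map f.toEmbedding) := by
  obtain ⟨h1, h2, h3, i, hi, j, hj, hij⟩ := he
  exact ⟨h _ h1, h _ h2, (Finset.disjoint_map _).2 h3, f i, Finset.mem_map_of_mem _ hi,
    f j, Finset.mem_map_of_mem _ hj, f.lt_iff_lt.2 hij⟩

/-- A set of tubes of a convex subposet is a tubing if it is mapped into a tubing. -/
theorem IsTubing.of_map [Finite P] [Finite Q] (f : Q ↪o P) (hf : (Set.range f).OrdConnected)
    {T : Finset (Finset Q)} {T' : Finset (Finset P)} (hT' : IsTubing T')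
    (h : ∀ ρ, ρ ∈ T → ρ.map f.toEmbedding ∈ T') : IsTubing T := by
  refine ⟨fun σ hσ => (isTube_map_iff f hf).1 (hT'.1 _ (h σ hσ)), fun σ hσ σ' hσ' => ?_,
    fun σ hσ => ?_⟩
  · have := hT'.2.1 _ (h σ hσ) _ (h σ' hσ')
    rwa [Finset.map_subset_map, Finset.map_subset_map, Finset.disjoint_map] at this
  · exact hT'.2.2 _ (Relation.TransGen.lift (fun σ => σ.map f.toEmbedding)
      (fun _ _ he => TubingEdge.map f h he) _ _ hσ)

theorem map_symm_map (e : Q ≃o P) (σ : Finset P) :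
    (σ.map e.symm.toEquiv.toEmbedding).map e.toEquiv.toEmbedding = σ := by
  ext x
  simp only [Finset.mem_map]
  constructor
  · rintro ⟨_, ⟨y, hy, rfl⟩, rfl⟩
    simpa using hy
  · exact fun hx => ⟨e.symm x, ⟨x, hx, rfl⟩, by simp⟩

theorem map_mapEmbedding_symm (e : Q ≃o P) (T : Finset (Finset P)) :
    (T.map (Finset.mapEmbedding e.symm.toEquiv.toEmbedding).toEmbedding).map
      (Finset.mapEmbedding e.toEquiv.toEmbedding).toEmbedding = T := by
  ext σ
  simp only [Finset.mem_map]
  constructor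
  · rintro ⟨_, ⟨ρ, hρ, rfl⟩, rfl⟩
    exact (congrArg (· ∈ T) (map_symm_map e ρ)).mpr hρ
  · exact fun hσ => ⟨_, ⟨σ, hσ, rfl⟩, map_symm_map e σ⟩

variable [Fintype P] [Fintype Q]

theorem IsProperTubing.comap_orderIso (e : Q ≃o P) {T' : Finset (Finset P)}
    (hT' : IsProperTubing T') :
    IsProperTubing (T'.map (Finset.mapEmbedding e.symm.toEquiv.toEmbedding).toEmbedding) := by
  have hcard : Fintype.card P = Fintype.card Q := Fintype.card_congr e.symm.toEquiv
  have hmap : ∀ ρ ∈ T'.map (Finset.mapEmbedding e.symm.toEquiv.toEmbedding).toEmbedding,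
      ρ.map e.toOrderEmbedding.toEmbedding ∈ T' := by
    intro ρ hρ
    obtain ⟨σ, hσ, rfl⟩ := Finset.mem_map.1 hρ
    exact (congrArg (· ∈ T') (map_symm_map e σ)).mpr hσ
  have hrange : (Set.range e.toOrderEmbedding).OrdConnected := by
    have : Set.range e.toOrderEmbedding = Set.univ := e.surjective.range_eq
    rw [this]
    exact Set.ordConnected_univ
  refine ⟨hT'.1.of_map e.toOrderEmbedding hrange hmap, fun ρ hρ => ?_⟩
  have h1 := hT'.2 _ (hmap ρ hρ)
  refine ⟨(isTube_map_iff _ hrange).1 h1.1, ?_, ?_⟩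
  · simpa using h1.2.1
  · rw [← hcard]
    simpa using h1.2.2

/-- Isomorphic posets have isomorphic complexes of proper tubings. -/
noncomputable def ProperTubing.congr (e : Q ≃o P) : ProperTubing P ≃o ProperTubing Q where
  toFun T := ⟨_, T.2.comap_orderIso e⟩
  invFun T := ⟨_, T.2.comap_orderIso e.symm⟩
  left_inv T := Subtype.ext (map_mapEmbedding_symm e T.1)
  right_inv T := Subtype.ext (map_mapEmbedding_symm e.symm T.1)
  map_rel_iff' := by
    intro T T'
    exact Finset.map_subset_map

theorem PosetConnected.congr (e : Q ≃o P) (h : PosetConnected P) : PosetConnected Q := by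
  rw [posetConnected_iff] at h ⊢
  rw [← Finset.coe_univ, ← compConnected_map_iff e.toOrderEmbedding]
  have : (Finset.univ : Finset Q).map e.toOrderEmbedding.toEmbedding = Finset.univ := by
    ext x
    simp only [Finset.mem_map, Finset.mem_univ, true_and, iff_true]
    exact e.surjective x
  rwa [this, Finset.coe_univ]

end Transport

section Link

open IsContraction

/-- A tube of `τ`, as a subset of `P`. -/
def liftTube {P : Type*} {τ : Finset P} (σ : Finset τ) : Finset P :=
  σ.map (Function.Embedding.subtype fun x => x ∈ τ)

theorem liftTube_subset {P : Type*} {τ : Finset P} (σ : Finset τ) : liftTube σ ⊆ τ := fun x hx => by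
  obtain ⟨y, -, rfl⟩ := Finset.mem_map.1 hx
  exact y.2

theorem liftTube_ne {P : Type*} {τ : Finset P} {σ : Finset τ} (hσ : σ.card < Fintype.card τ) :
    liftTube σ ≠ τ := fun h => by
  have := congrArg Finset.card h
  rw [liftTube, Finset.card_map] at this
  rw [Fintype.card_coe] at hσ
  omega

theorem exists_liftTube_eq {P : Type*} {τ : Finset P} {σ : Finset P} (h : σ ⊆ τ) :
    ∃ σ' : Finset τ, liftTube σ' = σ := by
  classical
  refine ⟨Finset.univ.filter fun x => x.1 ∈ σ, ?_⟩
  ext x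
  simp only [liftTube, Finset.mem_map, Finset.mem_filter, Finset.mem_univ, true_and]
  exact ⟨fun ⟨y, hy, he⟩ => he ▸ hy, fun hx => ⟨⟨x, h hx⟩, hx, rfl⟩⟩

theorem tubingEdge_of_le {R : Type*} [PartialOrder R] {T2 : Finset (Finset R)} {ρ ρ' : Finset R}
    (hρ : ρ ∈ T2) (hρ' : ρ' ∈ T2) (hd : Disjoint ρ ρ') {a b : R} (ha : a ∈ ρ) (hb : b ∈ ρ')
    (hab : a ≤ b) : TubingEdge T2 ρ ρ' :=
  ⟨hρ, hρ', hd, a, ha, b, hb, lt_of_le_of_ne hab fun he =>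
    Finset.disjoint_left.1 hd ha (he ▸ hb)⟩

/-- A set that contains the contracted set or is disjoint from it is a preimage. -/
theorem IsContraction.exists_pre_eq {P R : Type*} [PartialOrder P] [Fintype P]
    [PartialOrder R] {τ : Finset P} {π : P → R} {o : R} (h : IsContraction τ π o) {σ : Finset P}
    (hσ : τ ⊆ σ ∨ Disjoint τ σ) : ∃ ρ, pre π ρ = σ := by
  classical
  refine ⟨σ.image π, ?_⟩
  ext x
  rw [mem_pre, Finset.mem_image]
  constructor
  · rintro ⟨y, hy, hyx⟩
    by_cases hyτ : y ∈ τ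
    · rcases hσ with hσ | hσ
      · exact hσ ((h.eq_iff x).1 (hyx.symm.trans ((h.eq_iff y).2 hyτ)))
      · exact absurd hy (Finset.disjoint_left.1 hσ hyτ)
    · exact h.inj y x hyx hyτ ▸ hy
  · exact fun hx => ⟨x, hx, rfl⟩

variable {P : Type*} [PartialOrder P] [Fintype P] {R : Type*} [PartialOrder R] [Fintype R]
  {τ : Finset P} {π : P → R} {o : R}

theorem isTube_liftTube_iff (hτ : IsTube τ) {σ : Finset τ} : IsTube (liftTube σ) ↔ IsTube σ :=
  isTube_map_iff (OrderEmbedding.subtype fun x => x ∈ τ) (by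
    have : Set.range (OrderEmbedding.subtype fun x => x ∈ τ) = (τ : Set P) := by
      ext x; simp
    rw [this]
    exact hτ.1)

/-- The tubes of `T` strictly inside `τ` form a tubing of `τ`. -/
theorem IsProperTubing.restrict {T : Finset (Finset P)} (hT : IsProperTubing T) (hτ : τ ∈ T)
    {T1 : Finset (Finset τ)} (hT1 : ∀ σ ∈ T1, liftTube σ ∈ T ∧ σ ≠ Finset.univ) :
    IsProperTubing T1 := by
  have hτt := (hT.2 τ hτ).1
  refine ⟨hT.1.of_map (OrderEmbedding.subtype fun x => x ∈ τ) (by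
    have : Set.range (OrderEmbedding.subtype fun x => x ∈ τ) = (τ : Set P) := by
      ext x; simp
    rw [this]
    exact hτt.1) fun σ hσ => (hT1 σ hσ).1, fun σ hσ => ?_⟩
  have h1 := hT.2 _ (hT1 σ hσ).1
  refine ⟨(isTube_liftTube_iff hτt).1 h1.1, ?_, (Finset.card_lt_iff_ne_univ σ).2 (hT1 σ hσ).2⟩
  have := h1.2.1
  rwa [liftTube, Finset.card_map] at this

/-- The images of the tubes of `T` not contained in `τ` form a tubing of the contraction. -/
theorem IsContraction.isProperTubing_image (h : IsContraction τ π o) {T : Finset (Finset P)}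
    (hT : IsProperTubing T) (hτ : τ ∈ T)
    {T2 : Finset (Finset R)} (hT2 : ∀ ρ ∈ T2, pre π ρ ∈ T ∧ ρ ≠ {o}) : IsProperTubing T2 := by
  have hτt := hT.2 τ hτ
  have htube : ∀ ρ ∈ T2, IsTube ρ := by
    intro ρ hρ
    refine h.isTube_of_pre (hT.1.1 _ (hT2 ρ hρ).1) ?_
    rintro hd ⟨⟨x, hx, t, ht, hxt⟩, y, hy, s, hs, hsy⟩
    have hne : ∀ {u v}, u ∈ pre π ρ → v ∈ τ → u ≠ v := fun hu hv he =>
      Finset.disjoint_left.1 hd hu (he ▸ hv)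
    have e1 : TubingEdge T (pre π ρ) τ :=
      ⟨(hT2 ρ hρ).1, hτ, hd, x, hx, t, ht, lt_of_le_of_ne hxt (hne hx ht)⟩
    have e2 : TubingEdge T τ (pre π ρ) :=
      ⟨hτ, (hT2 ρ hρ).1, hd.symm, s, hs, y, hy, lt_of_le_of_ne hsy (hne hy hs).symm⟩
    exact hT.1.2.2 _ ((Relation.TransGen.single e1).tail e2)
  refine ⟨⟨htube, fun ρ hρ ρ' hρ' => ?_, fun ρ₀ hcyc => ?_⟩, fun ρ hρ => ⟨htube ρ hρ, ?_, ?_⟩⟩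
  · have := hT.1.2.1 _ (hT2 ρ hρ).1 _ (hT2 ρ' hρ').1
    rwa [h.pre_subset_pre, h.pre_subset_pre, h.disjoint_pre] at this
  · -- an edge of the contraction is an edge of `T` or a path through `τ`
    refine hT.1.2.2 (pre π ρ₀) (Relation.TransGen.lift' (pre π) ?_ _ _ hcyc)
    rintro ρ ρ' ⟨hρ, hρ', hd, a, ha, b, hb, hab⟩
    obtain ⟨x, rfl⟩ := h.surj a
    obtain ⟨y, rfl⟩ := h.surj b
    have hd' := h.disjoint_pre.2 hd
    have hx := (mem_pre (π := π)).2 ha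
    have hy := (mem_pre (π := π)).2 hb
    have hne : ∀ {σ σ' : Finset P} {u v}, Disjoint σ σ' → u ∈ σ → v ∈ σ' → u ≠ v :=
      fun hd hu hv he => Finset.disjoint_left.1 hd hu (he ▸ hv)
    rcases (h.le_iff x y).1 hab.le with hxy | ⟨⟨t, ht, hxt⟩, s, hs, hsy⟩
    · exact .single ⟨(hT2 ρ hρ).1, (hT2 ρ' hρ').1, hd', x, hx, y, hy,
        lt_of_le_of_ne hxy (hne hd' hx hy)⟩
    · rcases h.subset_pre_or_disjoint ρ with h1 | h1
      · exact .single ⟨(hT2 ρ hρ).1, (hT2 ρ' hρ').1, hd', s, h1 hs, y, hy,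
          lt_of_le_of_ne hsy (hne hd' (h1 hs) hy)⟩
      rcases h.subset_pre_or_disjoint ρ' with h2 | h2
      · exact .single ⟨(hT2 ρ hρ).1, (hT2 ρ' hρ').1, hd', x, hx, t, h2 ht,
          lt_of_le_of_ne hxt (hne hd' hx (h2 ht))⟩
      · have e1 : TubingEdge T (pre π ρ) τ := ⟨(hT2 ρ hρ).1, hτ, h1.symm, x, hx, t, ht,
          lt_of_le_of_ne hxt (hne h1.symm hx ht)⟩
        have e2 : TubingEdge T τ (pre π ρ') := ⟨hτ, (hT2 ρ' hρ').1, h2, s, hs, y, hy,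
          lt_of_le_of_ne hsy (hne h2 hs hy)⟩
        exact (Relation.TransGen.single e1).tail e2
  · by_contra hcard
    obtain ⟨x, hx⟩ := Finset.card_pos.1 (zero_lt_one.trans (hT.2 _ (hT2 ρ hρ).1).2.1)
    have h1 : ρ = {π x} := by
      obtain ⟨r, hr⟩ := Finset.card_eq_one.1 (le_antisymm (not_lt.1 hcard)
        (Finset.card_pos.2 ⟨π x, mem_pre.1 hx⟩))
      have := mem_pre.1 hx
      rw [hr, Finset.mem_singleton] at this
      rw [hr, this]
    have hxτ : x ∉ τ := fun hxτ => (hT2 ρ hρ).2 (h1.trans (by rw [(h.eq_iff x).2 hxτ]))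
    have h2 := (hT.2 _ (hT2 ρ hρ).1).2.1
    obtain ⟨u, hu, v, hv, huv⟩ := Finset.one_lt_card.1 h2
    rw [mem_pre, h1, Finset.mem_singleton] at hu hv
    exact huv ((h.inj x u hu.symm hxτ).symm.trans (h.inj x v hv.symm hxτ))
  · rw [Finset.card_lt_iff_ne_univ]
    rintro rfl
    have h1 := (hT.2 _ (hT2 _ hρ).1).2.2
    rw [Finset.card_lt_iff_ne_univ] at h1
    exact h1 (by ext; simp)

/-- If the tubes of `T` come from tubings of `τ` and of the contraction, then `T` has no directed
cycle: a cycle stays inside `τ` or can be pushed to the contraction, where parts inside `τ` become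
the point `o`, through which it can be short-cut. -/
theorem IsContraction.acyclic (h : IsContraction τ π o) {T : Finset (Finset P)}
    {T1 : Finset (Finset τ)} {T2 : Finset (Finset R)} (hT1 : IsProperTubing T1)
    (hT2 : IsProperTubing T2)
    (hT : ∀ σ ∈ T, σ = τ ∨ (∃ σ' ∈ T1, liftTube σ' = σ) ∨ ∃ ρ ∈ T2, pre π ρ = σ)
    (σ₀ : Finset P) : ¬ Relation.TransGen (TubingEdge T) σ₀ σ₀ := by
  have hcases : ∀ σ ∈ T, σ ⊆ τ ∨ ∃ ρ ∈ T2, pre π ρ = σ := by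
    intro σ hσ
    rcases hT σ hσ with rfl | ⟨σ', -, rfl⟩ | h'
    · exact Or.inl subset_rfl
    · exact Or.inl (liftTube_subset σ')
    · exact Or.inr h'
  have hnot : ∀ ρ ∈ T2, ¬ pre π ρ ⊆ τ := fun ρ hρ => h.not_pre_subset (hT2.2 ρ hρ).2.1
  -- a small tube disjoint from `pre π ρ` shows that `o ∉ ρ`
  have ho : ∀ {ρ : Finset R} {σ : Finset P} {j : P}, σ ⊆ τ → j ∈ σ → Disjoint (pre π ρ) σ →
      o ∉ ρ := by
    intro ρ σ j hσ hj hd ho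
    exact Finset.disjoint_right.1 hd hj (mem_pre.2 (((h.eq_iff j).2 (hσ hj)).symm ▸ ho))
  -- `Small σ`: the path from `pre π ρ₀` has entered `τ`; the last preceding member of `T2` lies
  -- below `o`
  have hA : ∀ ρ₀ ∈ T2, ¬ Relation.TransGen (TubingEdge T) (pre π ρ₀) (pre π ρ₀) := by
    intro ρ₀ hρ₀ hcyc
    let r₂ := TubingEdge T2
    let Small : Finset P → Prop := fun σ => σ ⊆ τ ∧
      ∃ ρ ∈ T2, Relation.ReflTransGen r₂ ρ₀ ρ ∧ o ∉ ρ ∧ ∃ x ∈ ρ, x ≤ o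
    have hstep : ∀ σ σ', ((∃ ρ ∈ T2, pre π ρ = σ ∧ Relation.ReflTransGen r₂ ρ₀ ρ) ∨ Small σ) →
        TubingEdge T σ σ' →
        (∃ ρ ∈ T2, pre π ρ = σ' ∧ Relation.TransGen r₂ ρ₀ ρ) ∨ Small σ' := by
      rintro σ σ' hσ ⟨-, hσ'T, hd, i, hi, j, hj, hij⟩
      rcases hσ with ⟨ρ, hρ, rfl, hreach⟩ | ⟨hστ, ρ, hρ, hreach, hoρ, x, hx, hxo⟩
      · rcases hcases σ' hσ'T with hσ' | ⟨ρ', hρ', rfl⟩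
        · refine Or.inr ⟨hσ', ρ, hρ, hreach, ho hσ' hj hd, π i, mem_pre.1 hi, ?_⟩
          rw [← (h.eq_iff j).2 (hσ' hj)]
          exact h.mono hij.le
        · exact Or.inl ⟨ρ', hρ', rfl, Relation.TransGen.tail' hreach
            (tubingEdge_of_le hρ hρ' (h.disjoint_pre.1 hd) (mem_pre.1 hi) (mem_pre.1 hj)
              (h.mono hij.le))⟩
      · rcases hcases σ' hσ'T with hσ' | ⟨ρ', hρ', rfl⟩
        · exact Or.inr ⟨hσ', ρ, hρ, hreach, hoρ, x, hx, hxo⟩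
        · have hoj : o ≤ π j := by
            rw [← (h.eq_iff i).2 (hστ hi)]
            exact h.mono hij.le
          have hoρ' := ho hστ hi hd.symm
          have hd2 : Disjoint ρ ρ' := by
            rcases hT2.1.2.1 ρ hρ ρ' hρ' with h1 | h1 | h1
            · exact absurd ((hT2.2 ρ' hρ').1.1.out (h1 hx) (mem_pre.1 hj) ⟨hxo, hoj⟩) hoρ'
            · exact absurd ((hT2.2 ρ hρ).1.1.out hx (h1 (mem_pre.1 hj)) ⟨hxo, hoj⟩) hoρ
            · exact h1
          exact Or.inl ⟨ρ', hρ', rfl, Relation.TransGen.tail' hreach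
            (tubingEdge_of_le hρ hρ' hd2 hx (mem_pre.1 hj) (hxo.trans hoj))⟩
    have hall : ∀ σ, Relation.TransGen (TubingEdge T) (pre π ρ₀) σ →
        (∃ ρ ∈ T2, pre π ρ = σ ∧ Relation.TransGen r₂ ρ₀ ρ) ∨ Small σ := by
      intro σ hσ
      induction hσ with
      | single he => exact hstep _ _ (Or.inl ⟨ρ₀, hρ₀, rfl, .refl⟩) he
      | tail _ he ih =>
        refine hstep _ _ (ih.imp_left ?_) he
        rintro ⟨ρ, h1, h2, h3⟩
        exact ⟨ρ, h1, h2, h3.to_reflTransGen⟩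
    rcases hall _ hcyc with ⟨ρ, hρ, heq, hreach⟩ | ⟨hsub, -⟩
    · rw [h.pre_injective heq] at hreach
      exact hT2.1.2.2 _ hreach
    · exact hnot ρ₀ hρ₀ hsub
  intro hcyc
  have hstart : σ₀ ⊆ τ := by
    obtain ⟨σ, he, -⟩ := Relation.TransGen.head'_iff.1 hcyc
    rcases hcases σ₀ he.1 with h1 | ⟨ρ, hρ, rfl⟩
    · exact h1
    · exact absurd hcyc (hA ρ hρ)
  -- two disjoint members of `T` inside `τ` come from `T1`
  have hin : ∀ σ σ', σ ⊆ τ → σ' ⊆ τ → TubingEdge T σ σ' →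
      ∃ ρ ∈ T1, ∃ ρ' ∈ T1, liftTube ρ = σ ∧ liftTube ρ' = σ' ∧ TubingEdge T1 ρ ρ' := by
    rintro σ σ' hσ hσ' ⟨hσT, hσ'T, hd, i, hi, j, hj, hij⟩
    have h1 : ∃ ρ ∈ T1, liftTube ρ = σ := by
      rcases hT σ hσT with rfl | h1 | ⟨ρ, hρ, rfl⟩
      · exact absurd (hσ' hj) (Finset.disjoint_right.1 hd hj)
      · exact h1
      · exact absurd hσ (hnot ρ hρ)
    have h2 : ∃ ρ ∈ T1, liftTube ρ = σ' := by
      rcases hT σ' hσ'T with rfl | h1 | ⟨ρ, hρ, rfl⟩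
      · exact absurd (hσ hi) (Finset.disjoint_left.1 hd hi)
      · exact h1
      · exact absurd hσ' (hnot ρ hρ)
    obtain ⟨ρ, hρ, rfl⟩ := h1
    obtain ⟨ρ', hρ', rfl⟩ := h2
    obtain ⟨u, hu, rfl⟩ := Finset.mem_map.1 hi
    obtain ⟨v, hv, rfl⟩ := Finset.mem_map.1 hj
    exact ⟨ρ, hρ, ρ', hρ', rfl, rfl, hρ, hρ', (Finset.disjoint_map _).1 hd, u, hu, v, hv, hij⟩
  -- a path from `σ₀` stays inside `τ` or meets the preimage of a member of `T2`
  have hall : ∀ σ, Relation.TransGen (TubingEdge T) σ₀ σ →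
      (σ ⊆ τ ∧ ∃ ρ ρ', liftTube ρ = σ₀ ∧ liftTube ρ' = σ ∧
        Relation.TransGen (TubingEdge T1) ρ ρ') ∨
      ∃ ρ ∈ T2, Relation.TransGen (TubingEdge T) σ₀ (pre π ρ) ∧
        Relation.ReflTransGen (TubingEdge T) (pre π ρ) σ := by
    intro σ hσ
    induction hσ with
    | @single σ he =>
      rcases hcases σ he.2.1 with h1 | ⟨ρ, hρ, rfl⟩
      · obtain ⟨ρ, -, ρ', -, h2, h3, h4⟩ := hin _ _ hstart h1 he
        exact Or.inl ⟨h1, ρ, ρ', h2, h3, .single h4⟩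
      · exact Or.inr ⟨ρ, hρ, .single he, .refl⟩
    | @tail σ σ' hσ he ih =>
      rcases ih with ⟨h1, ρ, ρ', h2, h3, h4⟩ | ⟨ρ, hρ, h1, h2⟩
      · rcases hcases σ' he.2.1 with h5 | ⟨ρ, hρ, rfl⟩
        · obtain ⟨μ, -, μ', -, h6, h7, h8⟩ := hin _ _ h1 h5 he
          have : ρ' = μ := Finset.map_injective _ (h3.trans h6.symm)
          subst this
          exact Or.inl ⟨h5, ρ, μ', h2, h7, h4.tail h8⟩
        · exact Or.inr ⟨ρ, hρ, hσ.tail he, .refl⟩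
      · exact Or.inr ⟨ρ, hρ, h1, h2.tail he⟩
  rcases hall _ hcyc with ⟨-, ρ, ρ', h1, h2, h3⟩ | ⟨ρ, hρ, h1, h2⟩
  · have : ρ = ρ' := Finset.map_injective _ (h1.trans h2.symm)
    subst this
    exact hT1.1.2.2 _ h3
  · exact hA ρ hρ (Relation.TransGen.trans_right h2 h1)

/-- The tubings containing `τ` are the pairs of a tubing of `τ` and a tubing of the contraction. -/
theorem IsContraction.exists_link (h : IsContraction τ π o) (hτ : IsProperTube τ) :
    Nonempty ({T : ProperTubing P // τ ∈ T.1} ≃o ProperTubing τ × ProperTubing R) := by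
  classical
  let φ : {T : ProperTubing P // τ ∈ T.1} → ProperTubing τ × ProperTubing R := fun T =>
    (⟨Finset.univ.filter fun σ => liftTube σ ∈ T.1.1 ∧ σ ≠ Finset.univ,
      T.1.2.restrict T.2 fun σ hσ => (Finset.mem_filter.1 hσ).2⟩,
    ⟨Finset.univ.filter fun ρ => pre π ρ ∈ T.1.1 ∧ ρ ≠ {o},
      h.isProperTubing_image T.1.2 T.2 fun ρ hρ => (Finset.mem_filter.1 hρ).2⟩)
  have hpo : pre π {o} = τ := by
    ext x
    rw [mem_pre, Finset.mem_singleton, h.eq_iff]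
  have hlu : liftTube (Finset.univ : Finset τ) = τ := by
    ext x
    simp [liftTube]
  have hφ : ∀ T T', φ T ≤ φ T' ↔ T ≤ T' := by
    intro T T'
    constructor
    · rintro ⟨h1, h2⟩ σ hσ
      rcases T.1.2.1.2.1 σ hσ τ T.2 with hs | hs
      · obtain ⟨σ', rfl⟩ := exists_liftTube_eq hs
        by_cases hu : σ' = Finset.univ
        · rw [hu, hlu]
          exact T'.2
        · exact (Finset.mem_filter.1 (h1 (Finset.mem_filter.2 ⟨Finset.mem_univ _, hσ, hu⟩))).2.1
      · obtain ⟨ρ, rfl⟩ := h.exists_pre_eq (hs.imp_right fun hd => hd.symm)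
        by_cases hu : ρ = {o}
        · rw [hu, hpo]
          exact T'.2
        · exact (Finset.mem_filter.1 (h2 (Finset.mem_filter.2 ⟨Finset.mem_univ _, hσ, hu⟩))).2.1
    · intro hTT'
      exact ⟨fun σ hσ => Finset.mem_filter.2 ⟨Finset.mem_univ _,
        hTT' (Finset.mem_filter.1 hσ).2.1, (Finset.mem_filter.1 hσ).2.2⟩,
        fun σ hσ => Finset.mem_filter.2 ⟨Finset.mem_univ _,
        hTT' (Finset.mem_filter.1 hσ).2.1, (Finset.mem_filter.1 hσ).2.2⟩⟩
  refine ⟨RelIso.ofSurjective (OrderEmbedding.ofMapLEIff φ hφ) ?_⟩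
  rintro ⟨⟨T1, hT1⟩, ⟨T2, hT2⟩⟩
  let T : Finset (Finset P) := insert τ (T1.image liftTube ∪ T2.image (pre π))
  have hmem : ∀ σ, σ ∈ T ↔
      σ = τ ∨ (∃ σ' ∈ T1, liftTube σ' = σ) ∨ ∃ ρ ∈ T2, pre π ρ = σ := by
    intro σ
    simp [T]
  have hT : IsProperTubing T := by
    have hproper : ∀ σ ∈ T, IsProperTube σ := by
      intro σ hσ
      rcases (hmem σ).1 hσ with rfl | ⟨σ', hσ', rfl⟩ | ⟨ρ, hρ, rfl⟩
      · exact hτ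
      · have h1 := hT1.2 σ' hσ'
        refine ⟨(isTube_liftTube_iff hτ.1).2 h1.1, ?_,
          (Finset.card_le_card (liftTube_subset σ')).trans_lt hτ.2.2⟩
        rw [liftTube, Finset.card_map]
        exact h1.2.1
      · have h1 := hT2.2 ρ hρ
        refine ⟨h.isTube_pre hτ.1 h1.1, h1.2.1.trans_le (h.card_le_card_pre ρ), ?_⟩
        rw [Finset.card_lt_iff_ne_univ]
        intro hu
        refine (Finset.card_lt_iff_ne_univ ρ).1 h1.2.2 (Finset.eq_univ_of_forall fun r => ?_)
        obtain ⟨x, rfl⟩ := h.surj r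
        exact mem_pre.1 (hu ▸ Finset.mem_univ x)
    refine ⟨⟨fun σ hσ => (hproper σ hσ).1, fun σ hσ σ' hσ' => ?_,
      h.acyclic hT1 hT2 fun σ hσ => (hmem σ).1 hσ⟩, hproper⟩
    -- a subset of `τ` is contained in a preimage or disjoint from it
    have hsmall : ∀ {μ : Finset P} (ρ : Finset R), μ ⊆ τ →
        μ ⊆ pre π ρ ∨ Disjoint μ (pre π ρ) := fun ρ hμ =>
      (h.subset_pre_or_disjoint ρ).imp hμ.trans fun hd => Finset.disjoint_of_subset_left hμ hd
    rcases (hmem σ).1 hσ with rfl | ⟨μ, hμ, rfl⟩ | ⟨ρ, hρ, rfl⟩ <;>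
      rcases (hmem σ').1 hσ' with rfl | ⟨μ', hμ', rfl⟩ | ⟨ρ', hρ', rfl⟩
    · exact Or.inl subset_rfl
    · exact Or.inr (Or.inl (liftTube_subset μ'))
    · exact (hsmall ρ' subset_rfl).imp_right Or.inr
    · exact Or.inl (liftTube_subset μ)
    · have := hT1.1.2.1 μ hμ μ' hμ'
      rw [liftTube, liftTube, Finset.map_subset_map, Finset.map_subset_map, Finset.disjoint_map]
      exact this
    · exact (hsmall ρ' (liftTube_subset μ)).imp_right Or.inr
    · exact Or.inr ((hsmall ρ subset_rfl).imp_right fun hd => hd.symm)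
    · exact Or.inr ((hsmall ρ (liftTube_subset μ')).imp_right fun hd => hd.symm)
    · rw [h.pre_subset_pre, h.pre_subset_pre, h.disjoint_pre]
      exact hT2.1.2.1 ρ hρ ρ' hρ'
  refine ⟨⟨⟨T, hT⟩, (hmem τ).2 (Or.inl rfl)⟩, ?_⟩
  have hsub : ∀ ρ ∈ T2, ¬ pre π ρ ⊆ τ := fun ρ hρ => h.not_pre_subset (hT2.2 ρ hρ).2.1
  refine Prod.ext (Subtype.ext ?_) (Subtype.ext ?_)
  · ext σ
    change σ ∈ Finset.univ.filter (fun σ => liftTube σ ∈ T ∧ σ ≠ Finset.univ) ↔ σ ∈ T1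
    rw [Finset.mem_filter, hmem]
    constructor
    · rintro ⟨-, he | ⟨σ', hσ', he⟩ | ⟨ρ, hρ, he⟩, hne⟩
      · exact absurd (Finset.map_injective _ (he.trans hlu.symm)) hne
      · exact (Finset.map_injective _ he : σ' = σ) ▸ hσ'
      · exact absurd (he ▸ liftTube_subset σ) (hsub ρ hρ)
    · exact fun hσ => ⟨Finset.mem_univ _, Or.inr (Or.inl ⟨σ, hσ, rfl⟩),
        (Finset.card_lt_iff_ne_univ σ).1 (hT1.2 σ hσ).2.2⟩
  · ext ρ
    change ρ ∈ Finset.univ.filter (fun ρ => pre π ρ ∈ T ∧ ρ ≠ {o}) ↔ ρ ∈ T2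
    rw [Finset.mem_filter, hmem]
    constructor
    · rintro ⟨-, he | ⟨σ', hσ', he⟩ | ⟨ρ', hρ', he⟩, hne⟩
      · exact absurd (h.pre_injective (he.trans hpo.symm)) hne
      · -- a subset of `τ` that is a preimage is empty or `τ`
        exfalso
        have hlt := hT1.2 σ' hσ'
        obtain ⟨y, hy⟩ := Finset.card_pos.1 (zero_lt_one.trans hlt.2.1)
        have hy' : y.1 ∈ pre π ρ := he ▸ Finset.mem_map_of_mem _ hy
        rcases h.subset_pre_or_disjoint ρ with h1 | h1
        · exact liftTube_ne hlt.2.2 ((liftTube_subset σ').antisymm (he ▸ h1))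
        · exact Finset.disjoint_left.1 h1 y.2 hy'
      · exact h.pre_injective he ▸ hρ'
    · intro hρ
      refine ⟨Finset.mem_univ _, Or.inr (Or.inr ⟨ρ, hρ, rfl⟩), ?_⟩
      rintro rfl
      have := (hT2.2 _ hρ).2.1
      simp at this

end Link

/-! ### Faces as products -/

section Products

theorem IsTube.posetConnected {P : Type*} [PartialOrder P] [Finite P] {τ : Finset P}
    (hτ : IsTube τ) : PosetConnected τ := by
  rw [posetConnected_iff, ← Finset.coe_univ,
    ← compConnected_map_iff (OrderEmbedding.subtype fun x => x ∈ τ)]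
  have : (Finset.univ : Finset τ).map (OrderEmbedding.subtype fun x => x ∈ τ).toEmbedding = τ := by
    ext x
    simp
  rw [this]
  exact (isTube_iff.1 hτ).2

/-- The tubings containing `T` are the tuples of tubings of certain posets, obtained by contracting
the tubes of `T` one after the other. -/
theorem exists_upperSet_orderIso_pi.{u} (N : ℕ) : ∀ (P : Type u) [PartialOrder P] [Fintype P],
    PosetConnected P → 2 ≤ Fintype.card P → Fintype.card P ≤ N → ∀ T : ProperTubing P,
    ∃ (κ : Type) (_ : Fintype κ) (R : κ → Type) (_ : ∀ i, PartialOrder (R i))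
      (_ : ∀ i, Fintype (R i)), (∀ i, PosetConnected (R i) ∧ 2 ≤ Fintype.card (R i)) ∧
      Nonempty ({T' // T ≤ T'} ≃o ∀ i, ProperTubing (R i)) := by
  induction N with
  | zero =>
    intro P _ _ _ h2 h0
    omega
  | succ N ih =>
    intro P _ _ hP h2 hN T
    rcases T.1.eq_empty_or_nonempty with hT | ⟨τ, hτ⟩
    · let e := Fintype.equivFin P
      let o : PartialOrder (Fin (Fintype.card P)) := PartialOrder.lift e.symm e.symm.injective
      let f : @OrderIso (Fin (Fintype.card P)) P o.toLE _ :=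
        @RelIso.mk _ _ _ _ e.symm Iff.rfl
      refine ⟨Unit, inferInstance, fun _ => Fin (Fintype.card P), fun _ => o, inferInstance,
        fun _ => ⟨@PosetConnected.congr _ _ _ o _ _ f hP, by simpa using h2⟩, ⟨?_⟩⟩
      let g := @ProperTubing.congr _ _ _ o _ _ f
      exact {
        toFun := fun T' _ => g T'.1
        invFun := fun T' => ⟨g.symm (T' ()), by
          rw [← Subtype.coe_le_coe, hT]
          exact Finset.empty_subset _⟩
        left_inv := fun T' => Subtype.ext (g.symm_apply_apply _)
        right_inv := fun T' => funext fun _ => g.apply_symm_apply _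
        map_rel_iff' := by
          intro T' T''
          exact ⟨fun h => g.le_iff_le.1 (h ()), fun h _ => g.le_iff_le.2 h⟩ }
    · have hτP := T.2.2 τ hτ
      obtain ⟨R, _, _, π, o, hR⟩ := exists_isContraction hτP.1.1
        (Finset.card_pos.1 (zero_lt_one.trans hτP.2.1))
      obtain ⟨Φ⟩ := hR.exists_link hτP
      let T₀ : {T' : ProperTubing P // τ ∈ T'.1} := ⟨T, hτ⟩
      have hτN : Fintype.card τ ≤ N := by
        have := hτP.2.2
        rw [Fintype.card_coe]
        omega
      have hRN : Fintype.card R ≤ N := by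
        have := hR.card_lt hτP.2.1
        omega
      obtain ⟨κ₁, _, R₁, _, _, h₁, ⟨e₁⟩⟩ := ih τ hτP.1.posetConnected
        (by rw [Fintype.card_coe]; exact hτP.2.1) hτN (Φ T₀).1
      obtain ⟨κ₂, _, R₂, _, _, h₂, ⟨e₂⟩⟩ := ih R (hR.posetConnected hP)
        (hR.two_le_card hτP) hRN (Φ T₀).2
      let Ψ : {T' // T ≤ T'} ≃o {T' // (Φ T₀).1 ≤ T'} × {T' // (Φ T₀).2 ≤ T'} := {
        toFun := fun T' =>
          let h : Φ T₀ ≤ Φ ⟨T'.1, T'.2 hτ⟩ := Φ.monotone (Subtype.coe_le_coe.1 T'.2)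
          (⟨_, h.1⟩, ⟨_, h.2⟩)
        invFun := fun T' => ⟨(Φ.symm (T'.1.1, T'.2.1)).1, by
          have h : T₀ ≤ Φ.symm (T'.1.1, T'.2.1) := Φ.le_symm_apply.2 ⟨T'.1.2, T'.2.2⟩
          exact h⟩
        left_inv := fun T' =>
          Subtype.ext (show (Φ.symm (Φ ⟨T'.1, T'.2 hτ⟩)).1 = T'.1 by
            rw [Φ.symm_apply_apply])
        right_inv := fun T' => Prod.ext
          (Subtype.ext (congrArg Prod.fst (Φ.apply_symm_apply (T'.1.1, T'.2.1))))
          (Subtype.ext (congrArg Prod.snd (Φ.apply_symm_apply (T'.1.1, T'.2.1))))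
        map_rel_iff' := by
          intro T' T''
          exact Φ.le_iff_le (x := ⟨T'.1, T'.2 hτ⟩) (y := ⟨T''.1, T''.2 hτ⟩) }
      let ord : ∀ i, PartialOrder (Sum.elim R₁ R₂ i) := fun i =>
        Sum.rec (fun i => (inferInstance : PartialOrder (R₁ i)))
          (fun i => (inferInstance : PartialOrder (R₂ i))) i
      let fin : ∀ i, Fintype (Sum.elim R₁ R₂ i) := fun i =>
        Sum.rec (fun i => (inferInstance : Fintype (R₁ i)))
          (fun i => (inferInstance : Fintype (R₂ i))) i
      refine ⟨κ₁ ⊕ κ₂, inferInstance, Sum.elim R₁ R₂, ord, fin,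
        fun i => Sum.rec (fun i => h₁ i) (fun i => h₂ i) i, ⟨?_⟩⟩
      refine Ψ.trans (OrderIso.trans (β := (∀ i, ProperTubing (R₁ i)) × ∀ i, ProperTubing (R₂ i))
        { e₁.toEquiv.prodCongr e₂.toEquiv with
          map_rel_iff' := and_congr e₁.le_iff_le e₂.le_iff_le } ?_)
      exact {
        toEquiv := (Equiv.sumPiEquivProdPi fun i : κ₁ ⊕ κ₂ =>
          ProperTubing (Sum.elim R₁ R₂ i)).symm
        map_rel_iff' := by
          intro x y
          exact Sum.forall }

variable {κ : Type*} [Fintype κ] {E : κ → Type*} [∀ i, NormedAddCommGroup (E i)]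
  [∀ i, NormedSpace ℝ (E i)] {ι : κ → Type*}

/-- The inequalities of a product of polyhedra: those of the factors. -/
noncomputable def piFamily (a : ∀ i, ι i → StrongDual ℝ (E i)) (p : Σ i, ι i) :
    StrongDual ℝ (∀ i, E i) :=
  (a p.1 p.2).comp (ContinuousLinearMap.proj p.1)

theorem polyhedron_piFamily (a : ∀ i, ι i → StrongDual ℝ (E i)) :
    polyhedron (piFamily a) = Set.pi Set.univ fun i => polyhedron (a i) := by
  ext y
  exact ⟨fun h i _ j => h ⟨i, j⟩, fun h p => h p.1 (Set.mem_univ _) p.2⟩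

section Slice

variable {κ : Type*} {ι : κ → Type*}

/-- The part of a subset of a disjoint union that lies in a given summand. -/
noncomputable def sigmaSlice (S : Finset (Σ i, ι i)) (i : κ) : Finset (ι i) :=
  S.preimage (Sigma.mk i) sigma_mk_injective.injOn

theorem mem_sigmaSlice {S : Finset (Σ i, ι i)} {i : κ} {j : ι i} :
    j ∈ sigmaSlice S i ↔ ⟨i, j⟩ ∈ S :=
  Finset.mem_preimage

theorem sigmaSlice_sigma [Fintype κ] (S : ∀ i, Finset (ι i)) (i : κ) :
    sigmaSlice (Finset.univ.sigma S) i = S i := by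
  ext j
  simp [mem_sigmaSlice]

theorem sigma_sigmaSlice [Fintype κ] (S : Finset (Σ i, ι i)) :
    Finset.univ.sigma (sigmaSlice S) = S := by
  ext ⟨i, j⟩
  simp [mem_sigmaSlice]

end Slice

theorem Realizes.pi [∀ i, Fintype (ι i)] {a : ∀ i, ι i → StrongDual ℝ (E i)}
    {K : ∀ i, Set (Finset (ι i))} (h : ∀ i, Realizes (a i) (K i)) :
    Realizes (piFamily a) {S | ∀ i, sigmaSlice S i ∈ K i} := by
  have hslice : ∀ y i, sigmaSlice (tight (piFamily a) y) i = tight (a i) (y i) := by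
    intro y i
    ext j
    rw [mem_sigmaSlice, mem_tight, mem_tight]
    rfl
  constructor
  · intro y hy i
    rw [hslice]
    rw [polyhedron_piFamily] at hy
    exact (h i).1 _ (hy i (Set.mem_univ i))
  · intro S hS
    choose y hy hyS using fun i => (h i).2 _ (hS i)
    refine ⟨y, ?_, ?_⟩
    · rw [polyhedron_piFamily]
      exact fun i _ => hy i
    · rw [← sigma_sigmaSlice (tight (piFamily a) y), ← sigma_sigmaSlice S]
      exact congrArg _ (funext fun i => (hslice y i).trans (hyS i))

/-- The nonempty faces of a product correspond to the tuples of index sets of faces of the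
factors. -/
theorem Realizes.exists_piFacesIso [∀ i, Fintype (ι i)] {a : ∀ i, ι i → StrongDual ℝ (E i)}
    {K : ∀ i, Set (Finset (ι i))} (h : ∀ i, Realizes (a i) (K i)) :
    Nonempty ((∀ i, {S // S ∈ K i})ᵒᵈ ≃o
      NonemptyFaces (Set.pi Set.univ fun i => polyhedron (a i))) := by
  have e := Realizes.facesIso (Realizes.pi h) ∅
  rw [subface_empty, polyhedron_piFamily] at e
  refine ⟨(OrderIso.dual ?_).trans e⟩
  exact {
    toFun := fun S => ⟨Finset.univ.sigma fun i => (S i).1,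
      fun i => (sigmaSlice_sigma _ i).symm ▸ (S i).2, Finset.empty_subset _⟩
    invFun := fun S i => ⟨sigmaSlice S.1 i, S.2.1 i⟩
    left_inv := fun S => funext fun i => Subtype.ext (sigmaSlice_sigma _ i)
    right_inv := fun S => Subtype.ext (sigma_sigmaSlice S.1)
    map_rel_iff' := by
      intro S S'
      refine ⟨fun h i j hj => ?_, fun h => Finset.sigma_mono subset_rfl h⟩
      have := h (Finset.mem_sigma.2 (⟨Finset.mem_univ i, hj⟩ :
        (⟨i, j⟩ : Σ i, ι i).1 ∈ Finset.univ ∧ _))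
      exact (Finset.mem_sigma.1 this).2 }

end Products

namespace PosetAssociahedron

variable {P : Type*} [PartialOrder P] [Fintype P] {d : ℕ} (A : PosetAssociahedron P d)

/-- The faces of a nonempty face are the faces with a larger tubing. -/
theorem exists_faceIso (T : ProperTubing P) :
    Nonempty ({T' // T ≤ T'}ᵒᵈ ≃o NonemptyFaces (A.face T)) := by
  rw [A.face_eq]
  refine ⟨(OrderIso.dual ?_).trans (A.isRealization.realizes.facesIso T.1)⟩
  exact {
    toFun := fun T' => ⟨T'.1.1, T'.1.2, T'.2⟩
    invFun := fun S => ⟨⟨S.1, S.2.1⟩, S.2.2⟩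
    left_inv := fun _ => rfl
    right_inv := fun _ => rfl
    map_rel_iff' := Iff.rfl }

theorem exists_combEquiv_pi (hP : PosetConnected P) (hcard : 2 ≤ Fintype.card P)
    (T : ProperTubing P) :
    ∃ (m : ℕ) (R : Fin m → Type) (_ : ∀ i, PartialOrder (R i)) (_ : ∀ i, Fintype (R i))
      (e : Fin m → ℕ) (B : ∀ i, PosetAssociahedron (R i) (e i)),
      (∀ i, PosetConnected (R i) ∧ 2 ≤ Fintype.card (R i)) ∧
      CombEquiv (A.face T) (Set.pi Set.univ fun i => (B i).carrier) := by
  obtain ⟨κ, _, R, _, _, hR, ⟨e⟩⟩ := exists_upperSet_orderIso_pi _ P hP hcard le_rfl T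
  let f := Fintype.equivFin κ
  choose a ha using fun i => exists_isRealization (hR i).1 (hR i).2
  let B : ∀ i, PosetAssociahedron (R i) (Fintype.card (R i) - 2) := fun i =>
    (ha i).posetAssociahedron
  refine ⟨Fintype.card κ, fun i => R (f.symm i), inferInstance, inferInstance, _,
    fun i => B (f.symm i), fun i => hR _, ?_⟩
  obtain ⟨e'⟩ := A.exists_faceIso T
  obtain ⟨g⟩ := Realizes.exists_piFacesIso fun i => (B (f.symm i)).isRealization.realizes
  simp only [carrier_eq]
  refine combEquiv_of_nonemptyFaces (e'.symm.trans ((OrderIso.dual ?_).trans g))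
  refine e.trans {
    toEquiv := Equiv.piCongrLeft' _ f
    map_rel_iff' := by
      intro x y
      exact f.forall_congr_left (p := fun i => x i ≤ y i) |>.symm }

end PosetAssociahedron

/-! ### Chains and associahedra -/

section Parametrized

variable {P : Type*} [PartialOrder P] [Fintype P]

/-- If no set of tubes has a directed cycle, then the proper tubings are the sets of pairwise
compatible proper tubes.  The proper tubes are here parametrized by a subset of a type `J`. -/
theorem exists_properTubing_orderIso {J : Type*} [Fintype J] {c : J → Finset P} {good : J → Prop}
    {compat : J → J → Prop} (hinj : ∀ i j, good i → good j → c i = c j → i = j)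
    (htube : ∀ σ, IsProperTube σ ↔ ∃ j, good j ∧ c j = σ)
    (hcompat : ∀ i j, good i → good j →
      (compat i j ↔ c i ⊆ c j ∨ c j ⊆ c i ∨ Disjoint (c i) (c j)))
    (hacyclic : ∀ T : Finset (Finset P), (∀ σ ∈ T, IsProperTube σ) →
      ∀ σ, ¬ Relation.TransGen (TubingEdge T) σ σ) :
    Nonempty (ProperTubing P ≃o
      {D : Finset J // (∀ e ∈ D, good e) ∧ ∀ e ∈ D, ∀ f ∈ D, compat e f}) := by
  classical
  let φ : ProperTubing P → {D : Finset J // (∀ e ∈ D, good e) ∧ ∀ e ∈ D, ∀ f ∈ D, compat e f} :=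
    fun T => ⟨Finset.univ.filter fun j => good j ∧ c j ∈ T.1,
      fun e he => (Finset.mem_filter.1 he).2.1, fun e he f hf => by
        have he := (Finset.mem_filter.1 he).2
        have hf := (Finset.mem_filter.1 hf).2
        exact (hcompat e f he.1 hf.1).2 (T.2.1.2.1 _ he.2 _ hf.2)⟩
  have hφ : ∀ T T', φ T ≤ φ T' ↔ T ≤ T' := by
    intro T T'
    constructor
    · intro h σ hσ
      obtain ⟨j, hj, rfl⟩ := (htube σ).1 (T.2.2 σ hσ)
      exact (Finset.mem_filter.1 (h (Finset.mem_filter.2 ⟨Finset.mem_univ j, hj, hσ⟩))).2.2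
    · exact fun h j hj => Finset.mem_filter.2 ⟨Finset.mem_univ _, (Finset.mem_filter.1 hj).2.1,
        h (Finset.mem_filter.1 hj).2.2⟩
  refine ⟨RelIso.ofSurjective (OrderEmbedding.ofMapLEIff φ hφ) ?_⟩
  rintro ⟨D, hD1, hD2⟩
  have hproper : ∀ σ ∈ D.image c, IsProperTube σ := by
    intro σ hσ
    obtain ⟨j, hj, rfl⟩ := Finset.mem_image.1 hσ
    exact (htube _).2 ⟨j, hD1 j hj, rfl⟩
  refine ⟨⟨D.image c, ⟨fun σ hσ => (hproper σ hσ).1, fun σ hσ σ' hσ' => ?_,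
    hacyclic _ hproper⟩, hproper⟩, Subtype.ext ?_⟩
  · obtain ⟨i, hi, rfl⟩ := Finset.mem_image.1 hσ
    obtain ⟨j, hj, rfl⟩ := Finset.mem_image.1 hσ'
    exact (hcompat i j (hD1 i hi) (hD1 j hj)).1 (hD2 i hi j hj)
  · ext j
    change j ∈ Finset.univ.filter (fun j => good j ∧ c j ∈ D.image c) ↔ j ∈ D
    simp only [Finset.mem_filter, Finset.mem_univ, true_and, Finset.mem_image]
    constructor
    · rintro ⟨hj, i, hi, he⟩
      exact hinj i j (hD1 i hi) hj he ▸ hi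
    · exact fun hj => ⟨hD1 j hj, j, hj, rfl⟩

end Parametrized

/-- In a chain, an edge between disjoint tubes separates them completely. -/
theorem not_transGen_tubingEdge_self {P : Type*} [LinearOrder P] {T : Finset (Finset P)}
    (hT : ∀ σ ∈ T, IsTube σ) (σ : Finset P) : ¬ Relation.TransGen (TubingEdge T) σ σ := by
  have hedge : ∀ σ σ', TubingEdge T σ σ' → ∀ i ∈ σ, ∀ j ∈ σ', i < j := by
    rintro σ σ' ⟨hσ, hσ', hd, i₀, hi₀, j₀, hj₀, h⟩ i hi j hj
    by_contra hij
    rcases le_or_gt j i₀ with h1 | h1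
    · exact Finset.disjoint_left.1 hd hi₀ ((hT σ' hσ').1.out hj hj₀ ⟨h1, h.le⟩)
    · exact Finset.disjoint_left.1 hd ((hT σ hσ).1.out hi₀ hi ⟨h1.le, not_lt.1 hij⟩) hj
  have htrans : ∀ σ', Relation.TransGen (TubingEdge T) σ σ' → ∀ i ∈ σ, ∀ j ∈ σ', i < j := by
    intro σ' h
    induction h with
    | single h => exact hedge _ _ h
    | @tail ρ ρ' _ h ih =>
      intro i hi j hj
      obtain ⟨k, hk⟩ := h.2.2.2
      exact (ih i hi k hk.1).trans (hedge _ _ h k hk.1 j hj)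
  intro h
  obtain ⟨ρ, he, -⟩ := Relation.TransGen.head'_iff.1 h
  obtain ⟨k, hk, -⟩ := he.2.2.2
  exact lt_irrefl k (htrans σ h k hk k hk)

section Chain

variable {n : ℕ}

/-- The tube of a chain corresponding to a diagonal: the vertices `a < b` of the polygon cut out
the elements at the positions `a, …, b - 1`. -/
def diagonalTube (e : Fin (n + 1) × Fin (n + 1)) : Finset (Fin n) :=
  Finset.univ.filter fun x => e.1.val ≤ x.val ∧ x.val < e.2.val

theorem mem_diagonalTube {e : Fin (n + 1) × Fin (n + 1)} {x : Fin n} :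
    x ∈ diagonalTube e ↔ e.1.val ≤ x.val ∧ x.val < e.2.val := by
  simp [diagonalTube]

theorem diagonalTube_subset_iff {e f : Fin (n + 1) × Fin (n + 1)} (he : IsDiagonal e) :
    diagonalTube e ⊆ diagonalTube f ↔ f.1.val ≤ e.1.val ∧ e.2.val ≤ f.2.val := by
  have h1 := he.1
  have h2 := e.2.isLt
  constructor
  · intro h
    have ha : (⟨e.1.val, by omega⟩ : Fin n) ∈ diagonalTube e :=
      mem_diagonalTube.2 ⟨le_rfl, by simp only; omega⟩
    have hb : (⟨e.2.val - 1, by omega⟩ : Fin n) ∈ diagonalTube e :=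
      mem_diagonalTube.2 ⟨by simp only; omega, by simp only; omega⟩
    have h3 := mem_diagonalTube.1 (h ha)
    have h4 := mem_diagonalTube.1 (h hb)
    simp only at h3 h4
    omega
  · intro h x hx
    rw [mem_diagonalTube] at hx ⊢
    omega

theorem disjoint_diagonalTube_iff {e f : Fin (n + 1) × Fin (n + 1)} (he : IsDiagonal e)
    (hf : IsDiagonal f) :
    Disjoint (diagonalTube e) (diagonalTube f) ↔
      e.2.val ≤ f.1.val ∨ f.2.val ≤ e.1.val := by
  have h1 := he.1
  have h2 := e.2.isLt
  have h3 := hf.1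
  have h4 := f.2.isLt
  rw [Finset.disjoint_left]
  constructor
  · intro h
    by_contra hc
    refine h (a := ⟨max e.1.val f.1.val, by omega⟩) ?_ ?_ <;> rw [mem_diagonalTube] <;>
      simp only <;> omega
  · intro h x hx hx'
    rw [mem_diagonalTube] at hx hx'
    omega

theorem isProperTube_fin_iff {σ : Finset (Fin n)} :
    IsProperTube σ ↔ ∃ e, IsDiagonal e ∧ diagonalTube e = σ := by
  constructor
  · rintro ⟨hσ, h1, h2⟩
    have hne : σ.Nonempty := Finset.card_pos.1 (zero_lt_one.trans h1)
    have hmin := σ.min'_mem hne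
    have hmax := σ.max'_mem hne
    have hlt := (σ.max' hne).isLt
    have heq : diagonalTube (⟨(σ.min' hne).val, by omega⟩, ⟨(σ.max' hne).val + 1, by omega⟩) =
        σ := by
      ext x
      rw [mem_diagonalTube]
      constructor
      · rintro ⟨h3, h4⟩
        exact hσ.1.out hmin hmax ⟨h3, Nat.lt_succ_iff.1 h4⟩
      · intro hx
        have h3 : (σ.min' hne).val ≤ x.val := σ.min'_le x hx
        have h4 : x.val ≤ (σ.max' hne).val := σ.le_max' x hx
        exact ⟨h3, Nat.lt_succ_iff.2 h4⟩
    refine ⟨_, ⟨?_, ?_⟩, heq⟩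
    · have := σ.min'_lt_max'_of_card h1
      simp only
      have h5 : (σ.min' hne).val < (σ.max' hne).val := this
      omega
    · rintro ⟨h3, h4⟩
      refine (Finset.card_lt_iff_ne_univ σ).1 h2 (Finset.eq_univ_of_forall fun x => ?_)
      rw [← heq, mem_diagonalTube]
      simp only at h3 h4 ⊢
      have := x.isLt
      omega
  · rintro ⟨e, ⟨h1, h2⟩, rfl⟩
    have h3 := e.2.isLt
    have ha : (⟨e.1.val, by omega⟩ : Fin n) ∈ diagonalTube e :=
      mem_diagonalTube.2 ⟨le_rfl, by simp only; omega⟩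
    refine ⟨isTube_iff.2 ⟨⟨fun x hx y hy z hz => ?_⟩, ⟨_, ha⟩, fun A hA ⟨a, haA⟩ hcl y hy =>
      hcl a haA y hy (le_total a y)⟩, ?_, ?_⟩
    · have hx := mem_diagonalTube.1 (Finset.mem_coe.1 hx)
      have hy := mem_diagonalTube.1 (Finset.mem_coe.1 hy)
      have h4 : x.val ≤ z.val := hz.1
      have h5 : z.val ≤ y.val := hz.2
      exact Finset.mem_coe.2 (mem_diagonalTube.2 ⟨by omega, by omega⟩)
    · refine Finset.one_lt_card.2 ⟨_, ha, (⟨e.1.val + 1, by omega⟩ : Fin n),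
        mem_diagonalTube.2 ⟨by simp only; omega, by simp only; omega⟩, fun h => ?_⟩
      have := congrArg Fin.val h
      simp only at this
      omega
    · rw [Finset.card_lt_iff_ne_univ]
      intro hu
      have h4 := mem_diagonalTube.1 (hu ▸ Finset.mem_univ (⟨0, by omega⟩ : Fin n))
      have h5 := mem_diagonalTube.1 (hu ▸ Finset.mem_univ (⟨n - 1, by omega⟩ : Fin n))
      simp only at h4 h5
      exact h2 ⟨by omega, by omega⟩

/-- The proper tubings of a chain with `n` elements are the dissections of an `(n + 1)`-gon. -/
theorem exists_properTubing_fin_orderIso (n : ℕ) :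
    Nonempty (ProperTubing (Fin n) ≃o PolygonDissection (n + 1)) := by
  refine exists_properTubing_orderIso (c := diagonalTube)
    (compat := fun e f => ¬ DiagonalsCross e f)
    (fun e f he hf h => ?_) (fun σ => isProperTube_fin_iff) (fun e f he hf => ?_)
    fun T hT => not_transGen_tubingEdge_self fun σ hσ => (hT σ hσ).1
  · have h1 := (diagonalTube_subset_iff he).1 h.subset
    have h2 := (diagonalTube_subset_iff hf).1 h.superset
    exact Prod.ext (Fin.ext (by omega)) (Fin.ext (by omega))
  · rw [diagonalTube_subset_iff he, diagonalTube_subset_iff hf, disjoint_diagonalTube_iff he hf]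
    have h1 := he.1
    have h2 := hf.1
    simp only [DiagonalsCross, Fin.lt_def]
    omega

end Chain

namespace PosetAssociahedron

variable {P : Type*} [PartialOrder P] [Fintype P] {d : ℕ} (A : PosetAssociahedron P d)

theorem exists_facesIso : Nonempty ((ProperTubing P)ᵒᵈ ≃o NonemptyFaces A.carrier) := by
  rw [A.carrier_eq, ← subface_empty]
  refine ⟨(OrderIso.dual ?_).trans (A.isRealization.realizes.facesIso ∅)⟩
  exact {
    toFun := fun T => ⟨T.1, T.2, Finset.empty_subset _⟩
    invFun := fun S => ⟨S.1, S.2.1⟩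
    left_inv := fun _ => rfl
    right_inv := fun _ => rfl
    map_rel_iff' := Iff.rfl }

theorem isAssociahedron (hP : PosetConnected P) (hcard : 2 ≤ Fintype.card P)
    (hchain : IsChainPoset P) : IsAssociahedron (Fintype.card P - 2) A.carrier := by
  classical
  have hd := IsRealization.dim_add_two hP hcard A.isRealization
  refine ⟨A.carrier_eq ▸ A.isRealization.isPolytope_polyhedron, ?_, ?_⟩
  · rw [A.carrier_eq, A.isRealization.polytopeDim_polyhedron]
    omega
  · obtain ⟨k, hk⟩ := Nat.exists_eq_add_of_le' hcard
    let lin : LinearOrder P := { ‹PartialOrder P› with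
      le_total := fun a b => hchain a b
      toDecidableLE := Classical.decRel _ }
    let e : Fin (k + 2) ≃o P := Fintype.orderIsoFinOfCardEq P hk
    obtain ⟨f⟩ := A.exists_facesIso
    obtain ⟨g⟩ := exists_properTubing_fin_orderIso (k + 2)
    rw [hk, Nat.add_sub_cancel]
    exact ⟨f.symm.trans ((ProperTubing.congr e).trans g).dual⟩

end PosetAssociahedron

/-! ### Claws and permutohedra -/

section Permutohedron

variable {n : ℕ}

/-- The sets of pairwise nested, nonempty proper subsets of a set with `n` elements. -/
abbrev SubsetChain (n : ℕ) : Type :=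
  {C : Finset (Finset (Fin n)) // (∀ S ∈ C, S.Nonempty ∧ S ≠ Finset.univ) ∧
    ∀ S ∈ C, ∀ S' ∈ C, S ⊆ S' ∨ S' ⊆ S}

/-- The vertices of the permutohedron. -/
def permVertex (σ : Equiv.Perm (Fin n)) : EuclideanSpace ℝ (Fin n) :=
  WithLp.toLp 2 fun i : Fin n => ((σ i : ℕ) : ℝ) + 1

/-- The face of the permutohedron where the functional `⟨w, ·⟩` is maximal. -/
def permFace (w : EuclideanSpace ℝ (Fin n)) : Set (EuclideanSpace ℝ (Fin n)) :=
  {x ∈ permutohedron n | ∀ y ∈ permutohedron n, inner ℝ w y ≤ inner ℝ w x}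

theorem isFace_permFace (w : EuclideanSpace ℝ (Fin n)) : IsFace (permutohedron n) (permFace w) :=
  fun _ => ⟨innerSL ℝ w, rfl⟩

theorem exists_eq_permFace {F : Set (EuclideanSpace ℝ (Fin n))} (hF : IsFace (permutohedron n) F)
    (hne : F.Nonempty) : ∃ w, F = permFace w := by
  obtain ⟨l, hl⟩ := hF hne
  refine ⟨(InnerProductSpace.toDual ℝ _).symm l, ?_⟩
  simp only [permFace, InnerProductSpace.toDual_symm_apply]
  exact hl

theorem permVertex_mem (σ : Equiv.Perm (Fin n)) : permVertex σ ∈ permutohedron n :=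
  subset_convexHull ℝ _ ⟨σ, rfl⟩

theorem inner_permVertex (w : EuclideanSpace ℝ (Fin n)) (σ : Equiv.Perm (Fin n)) :
    inner ℝ w (permVertex σ) = ∑ i, w i * (((σ i : ℕ) : ℝ) + 1) := by
  simp [PiLp.inner_apply, permVertex, mul_comm]

theorem forall_inner_le_iff (w : EuclideanSpace ℝ (Fin n)) (b : ℝ) :
    (∀ y ∈ permutohedron n, inner ℝ w y ≤ b) ↔ ∀ σ, inner ℝ w (permVertex σ) ≤ b := by
  refine ⟨fun h σ => h _ (permVertex_mem σ), fun h y hy => ?_⟩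
  have hconv : Convex ℝ {y : EuclideanSpace ℝ (Fin n) | inner ℝ w y ≤ b} :=
    convex_halfSpace_le (innerSL ℝ w).isLinear b
  exact convexHull_min (by rintro _ ⟨σ, rfl⟩; exact h σ) hconv hy

/-- Sorting by the values of `w`, with ties broken against `j`, gives a permutation that orders the
indices like `w` and puts `j` last among the indices with the same value. -/
theorem exists_monovary (w : Fin n → ℝ) (j : Fin n) :
    ∃ σ : Equiv.Perm (Fin n), Monovary w σ ∧ ∀ i, i ≠ j → w i ≤ w j → σ i < σ j := by
  classical
  let f : Fin n → ℝ ×ₗ ℕ := fun k => toLex (w k, if k = j then 1 else 0)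
  have hf : ∀ a b, (Tuple.sort f).symm a < (Tuple.sort f).symm b → f a ≤ f b := by
    intro a b h
    have := Tuple.monotone_sort f h.le
    simpa using this
  refine ⟨(Tuple.sort f).symm, fun a b h => ?_, fun i hij hw => ?_⟩
  · rcases Prod.Lex.le_iff.1 (hf a b h) with h1 | h1
    · exact h1.le
    · exact h1.1.le
  · by_contra hlt
    have hlt' : (Tuple.sort f).symm j < (Tuple.sort f).symm i :=
      lt_of_le_of_ne (not_lt.1 hlt) fun h => hij ((Tuple.sort f).symm.injective h).symm
    refine absurd (hf j i hlt') (not_le.2 (Prod.Lex.lt_iff.2 ?_))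
    rcases hw.lt_or_eq with h | h
    · exact Or.inl h
    · exact Or.inr ⟨h, by simp [f, hij]⟩

/-- The rearrangement inequality determines the vertices of a face. -/
theorem permVertex_mem_permFace_iff {w : EuclideanSpace ℝ (Fin n)} {σ : Equiv.Perm (Fin n)} :
    permVertex σ ∈ permFace w ↔ Monovary w σ := by
  have hmono : ∀ {σ : Equiv.Perm (Fin n)}, Monovary w (fun i => ((σ i : ℕ) : ℝ) + 1) ↔
      Monovary w σ := by
    intro σ
    simp [Monovary]
  have hle : ∀ {σ : Equiv.Perm (Fin n)}, Monovary w σ → ∀ ρ : Equiv.Perm (Fin n),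
      inner ℝ w (permVertex ρ) ≤ inner ℝ w (permVertex σ) := by
    intro σ hσ ρ
    have := (hmono.2 hσ).sum_mul_comp_perm_le_sum_mul (σ := ρ.trans σ.symm)
    simpa [inner_permVertex] using this
  constructor
  · rintro ⟨-, h⟩
    rcases isEmpty_or_nonempty (Fin n) with hn | ⟨⟨j⟩⟩
    · exact fun i => hn.elim i
    obtain ⟨ρ, hρ, -⟩ := exists_monovary w j
    have heq := le_antisymm (hle hρ σ) (h _ (permVertex_mem ρ))
    have := (hmono.2 hρ).sum_mul_comp_perm_eq_sum_mul_iff (σ := σ.trans ρ.symm)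
    simp only [Equiv.trans_apply, Equiv.apply_symm_apply, inner_permVertex] at this heq
    exact hmono.1 (by simpa [Function.comp_def] using this.1 heq)
  · exact fun h => ⟨permVertex_mem σ, (forall_inner_le_iff w _).2 (hle h)⟩

theorem permFace_nonempty (w : EuclideanSpace ℝ (Fin n)) : (permFace w).Nonempty := by
  rcases isEmpty_or_nonempty (Fin n) with hn | ⟨⟨j⟩⟩
  · exact ⟨permVertex 1, permVertex_mem_permFace_iff.2 fun i => hn.elim i⟩
  · obtain ⟨σ, hσ, -⟩ := exists_monovary w j
    exact ⟨_, permVertex_mem_permFace_iff.2 hσ⟩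

theorem isCompact_permutohedron : IsCompact (permutohedron n) :=
  (Set.finite_range _).isCompact_convexHull ℝ

/-- A face is the convex hull of its vertices, by the Krein-Milman theorem. -/
theorem permFace_subset_iff {w w' : EuclideanSpace ℝ (Fin n)} :
    permFace w ⊆ permFace w' ↔ ∀ σ : Equiv.Perm (Fin n), Monovary w σ → Monovary w' σ := by
  constructor
  · exact fun h σ hσ => permVertex_mem_permFace_iff.1 (h (permVertex_mem_permFace_iff.2 hσ))
  · intro h
    have hexp : ∀ v : EuclideanSpace ℝ (Fin n), IsExposed ℝ (permutohedron n) (permFace v) :=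
      isFace_permFace
    have hconv : ∀ v : EuclideanSpace ℝ (Fin n), Convex ℝ (permFace v) := fun v =>
      (hexp v).convex (convex_convexHull ℝ _)
    have hcomp : ∀ v : EuclideanSpace ℝ (Fin n), IsCompact (permFace v) := fun v =>
      (hexp v).isCompact isCompact_permutohedron
    rw [← closure_convexHull_extremePoints (hcomp w) (hconv w)]
    refine closure_minimal (convexHull_min ?_ (hconv w')) (hcomp w').isClosed
    intro x hx
    obtain ⟨σ, rfl⟩ := extremePoints_convexHull_subset
      ((hexp w).isExtreme.extremePoints_subset_extremePoints hx)
    exact permVertex_mem_permFace_iff.2 (h σ (permVertex_mem_permFace_iff.1 hx.1))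

open Classical in
/-- The nonempty proper subsets that consist of the indices of the largest coordinates. -/
noncomputable def upperLevels (w : Fin n → ℝ) : Finset (Finset (Fin n)) :=
  Finset.univ.filter fun S => (S.Nonempty ∧ S ≠ Finset.univ) ∧ ∀ i ∈ S, ∀ j, j ∉ S → w j < w i

theorem mem_upperLevels {w : Fin n → ℝ} {S : Finset (Fin n)} :
    S ∈ upperLevels w ↔
      (S.Nonempty ∧ S ≠ Finset.univ) ∧ ∀ i ∈ S, ∀ j, j ∉ S → w j < w i := by
  simp [upperLevels]

theorem forall_monovary_iff {w w' : Fin n → ℝ} :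
    (∀ σ : Equiv.Perm (Fin n), Monovary w σ → Monovary w' σ) ↔
      upperLevels w' ⊆ upperLevels w := by
  constructor
  · intro h S hS
    rw [mem_upperLevels] at hS ⊢
    refine ⟨hS.1, fun i hi j hj => ?_⟩
    by_contra hij
    obtain ⟨σ, hσ, hlt⟩ := exists_monovary w j
    exact absurd (hS.2 i hi j hj)
      (not_lt.2 (h σ hσ (hlt i (fun he => hj (he ▸ hi)) (not_lt.1 hij))))
  · intro h σ hσ i j hij
    by_contra hlt
    rw [not_le] at hlt
    have hS : (Finset.univ.filter fun k => w' j < w' k) ∈ upperLevels w' := by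
      refine mem_upperLevels.2 ⟨⟨⟨i, by simpa using hlt⟩, fun hu => ?_⟩, fun a ha b hb => ?_⟩
      · have := hu ▸ Finset.mem_univ j
        simp at this
      · simp only [Finset.mem_filter, Finset.mem_univ, true_and, not_lt] at ha hb
        exact hb.trans_lt ha
    have := (mem_upperLevels.1 (h hS)).2 i (by simpa using hlt) j (by simp)
    exact absurd (hσ hij) (not_le.2 this)

open Classical in
/-- A vector whose upper level sets are the members of a given chain: it counts the members
containing an index. -/
noncomputable def countVector (C : Finset (Finset (Fin n))) : EuclideanSpace ℝ (Fin n) :=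
  WithLp.toLp 2 fun i => ((C.filter fun S => i ∈ S).card : ℝ)

theorem upperLevels_countVector (C : SubsetChain n) : upperLevels (countVector C.1) = C.1 := by
  classical
  have hlt : ∀ S ∈ C.1, ∀ i ∈ S, ∀ j, j ∉ S → countVector C.1 j < countVector C.1 i := by
    intro S hS i hi j hj
    simp only [countVector, Nat.cast_lt]
    refine Finset.card_lt_card (Finset.ssubset_iff_subset_ne.2 ⟨fun S' hS' => ?_, fun he => ?_⟩)
    · rw [Finset.mem_filter] at hS' ⊢
      refine ⟨hS'.1, ?_⟩
      rcases C.2.2 S hS S' hS'.1 with h | h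
      · exact h hi
      · exact absurd (h hS'.2) hj
    · have : S ∈ C.1.filter fun S => j ∈ S := he ▸ Finset.mem_filter.2 ⟨hS, hi⟩
      exact hj (Finset.mem_filter.1 this).2
  ext S
  rw [mem_upperLevels]
  refine ⟨fun ⟨⟨hne, hu⟩, h⟩ => ?_, fun hS => ⟨C.2.1 S hS, hlt S hS⟩⟩
  -- a member of `C` that separates the smallest value on `S` from the largest one outside is `S`
  obtain ⟨i, hi, himin⟩ := S.exists_min_image (countVector C.1) hne
  obtain ⟨j, hj, hjmax⟩ := Sᶜ.exists_max_image (countVector C.1)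
    (Finset.nonempty_iff_ne_empty.2 fun he => hu (Finset.compl_eq_empty_iff S |>.1 he))
  rw [Finset.mem_compl] at hj
  obtain ⟨S', hS', hiS', hjS'⟩ : ∃ S' ∈ C.1, i ∈ S' ∧ j ∉ S' := by
    by_contra hc
    push Not at hc
    refine absurd (h i hi j hj) (not_lt.2 ?_)
    simp only [countVector, Nat.cast_le]
    refine Finset.card_le_card fun S' hS' => ?_
    rw [Finset.mem_filter] at hS' ⊢
    exact ⟨hS'.1, hc S' hS'.1 hS'.2⟩
  have : S' = S := by
    ext k
    constructor
    · intro hk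
      by_contra hkS
      exact absurd (hlt S' hS' k hk j hjS') (not_lt.2 (hjmax k (Finset.mem_compl.2 hkS)))
    · intro hk
      by_contra hkS
      exact absurd (hlt S' hS' i hiS' k hkS) (not_lt.2 (himin k hk))
  exact this ▸ hS'

/-- The upper level sets of a vector form a chain. -/
noncomputable def levelChain (w : Fin n → ℝ) : SubsetChain n :=
  ⟨upperLevels w, fun _ hS => (mem_upperLevels.1 hS).1, fun S hS S' hS' => by
    by_contra hc
    push Not at hc
    obtain ⟨i, hi, hi'⟩ := Finset.not_subset.1 hc.1
    obtain ⟨j, hj, hj'⟩ := Finset.not_subset.1 hc.2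
    exact lt_asymm ((mem_upperLevels.1 hS).2 i hi j hj') ((mem_upperLevels.1 hS').2 j hj i hi')⟩

/-- The nonempty faces of the permutohedron correspond to the chains of nonempty proper subsets:
the face of a functional `w` corresponds to the chain of upper level sets of `w`. -/
theorem exists_permutohedron_facesIso (n : ℕ) :
    Nonempty ((SubsetChain n)ᵒᵈ ≃o NonemptyFaces (permutohedron n)) := by
  have hsub : ∀ w w' : EuclideanSpace ℝ (Fin n),
      permFace w ⊆ permFace w' ↔ upperLevels w' ⊆ upperLevels w := fun w w' =>
    permFace_subset_iff.trans forall_monovary_iff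
  let φ : (SubsetChain n)ᵒᵈ → NonemptyFaces (permutohedron n) := fun C =>
    ⟨permFace (countVector (OrderDual.ofDual C).1), isFace_permFace _, permFace_nonempty _⟩
  have hφ : ∀ C C', φ C ≤ φ C' ↔ C ≤ C' := by
    intro C C'
    refine (hsub _ _).trans ?_
    rw [upperLevels_countVector, upperLevels_countVector]
    exact Iff.rfl
  refine ⟨RelIso.ofSurjective (OrderEmbedding.ofMapLEIff φ hφ) fun F => ?_⟩
  obtain ⟨w, hw⟩ := exists_eq_permFace F.2.1 F.2.2
  refine ⟨OrderDual.toDual (levelChain w), Subtype.ext ?_⟩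
  have heq : upperLevels (countVector (levelChain w).1) = upperLevels w :=
    upperLevels_countVector _
  change permFace (countVector (levelChain w).1) = F.1
  rw [hw]
  exact subset_antisymm ((hsub _ _).2 heq.superset) ((hsub _ _).2 heq.subset)

end Permutohedron

section Cone

variable {P : Type*} {o : P} {n : ℕ}

/-- The tube of a claw with minimum `o` corresponding to a set of other elements. -/
def coneTube (f : Fin n ≃ {x : P // x ≠ o}) (S : Finset (Fin n)) : Finset P :=
  Finset.cons o (S.map (f.toEmbedding.trans (Function.Embedding.subtype fun x => x ≠ o)))
    fun h => by
      obtain ⟨i, -, hi⟩ := Finset.mem_map.1 h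
      exact (f i).2 hi

theorem mem_coneTube {f : Fin n ≃ {x : P // x ≠ o}} {S : Finset (Fin n)} {i : Fin n} :
    (f i).1 ∈ coneTube f S ↔ i ∈ S := by
  rw [coneTube, Finset.mem_cons, or_iff_right (f i).2, Finset.mem_map]
  exact ⟨fun ⟨j, hj, he⟩ => f.injective (Subtype.ext he) ▸ hj, fun hi => ⟨i, hi, rfl⟩⟩

theorem bot_mem_coneTube (f : Fin n ≃ {x : P // x ≠ o}) (S : Finset (Fin n)) :
    o ∈ coneTube f S :=
  Finset.mem_cons_self _ _

theorem coneTube_subset_iff {f : Fin n ≃ {x : P // x ≠ o}} {S S' : Finset (Fin n)} :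
    coneTube f S ⊆ coneTube f S' ↔ S ⊆ S' :=
  ⟨fun h _ hi => mem_coneTube.1 (h (mem_coneTube.2 hi)), fun h =>
    Finset.cons_subset_cons.2 (Finset.map_subset_map.2 h)⟩

end Cone

section Claw

variable {P : Type*} [PartialOrder P] [Fintype P] {o : P} {n : ℕ}

theorem isProperTube_claw_iff (ho : ∀ a, o ≤ a) (hclaw : ∀ a b : P, a ≠ o → b ≠ o → a ≤ b → a = b)
    (f : Fin n ≃ {x : P // x ≠ o}) {σ : Finset P} :
    IsProperTube σ ↔ ∃ S : Finset (Fin n), (S.Nonempty ∧ S ≠ Finset.univ) ∧ coneTube f S = σ := by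
  classical
  have hbot : ∀ {a}, a ≤ o → a = o := fun h => le_antisymm h (ho _)
  constructor
  · rintro ⟨hσ, h1, h2⟩
    have hoσ : o ∈ σ := by
      by_contra hoσ
      obtain ⟨x, hx, y, hy, hxy⟩ := Finset.one_lt_card.1 h1
      have hne : ∀ z ∈ σ, z ≠ o := fun z hz he => hoσ (he ▸ hz)
      refine hxy ((isTube_iff.1 hσ).2.2 {x} (Set.singleton_subset_iff.2 hx) ⟨x, rfl⟩ ?_ hy).symm
      rintro _ rfl z hz (h | h)
      · exact (hclaw _ _ (hne _ hx) (hne _ hz) h).symm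
      · exact hclaw _ _ (hne _ hz) (hne _ hx) h
    have heq : coneTube f (Finset.univ.filter fun i => (f i).1 ∈ σ) = σ := by
      ext x
      by_cases hx : x = o
      · rw [hx]
        exact iff_of_true (bot_mem_coneTube _ _) hoσ
      · obtain ⟨i, hi⟩ := f.surjective ⟨x, hx⟩
        have : x = (f i).1 := by rw [hi]
        rw [this, mem_coneTube]
        simp
    refine ⟨_, ⟨?_, fun hu => ?_⟩, heq⟩
    · obtain ⟨x, hx, hxo⟩ := Finset.exists_mem_ne h1 o
      exact ⟨f.symm ⟨x, hxo⟩, by simpa using hx⟩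
    · refine (Finset.card_lt_iff_ne_univ σ).1 h2 (Finset.eq_univ_of_forall fun x => ?_)
      by_cases hx : x = o
      · exact hx ▸ hoσ
      · have := hu ▸ Finset.mem_univ (f.symm ⟨x, hx⟩)
        simpa using this
  · rintro ⟨S, ⟨⟨i, hi⟩, hu⟩, rfl⟩
    have hoS := bot_mem_coneTube f S
    refine ⟨isTube_iff.2 ⟨⟨fun x hx y hy z hz => ?_⟩, ⟨o, hoS⟩, fun A hA ⟨a, ha⟩ hcl y hy =>
      hcl o (hcl a ha o hoS (Or.inr (ho a))) y hy (Or.inl (ho y))⟩, ?_, ?_⟩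
    · by_cases hzo : z = o
      · exact hzo ▸ hoS
      · have hyo : y ≠ o := fun he => hzo (hbot (he ▸ hz.2))
        exact hclaw z y hzo hyo hz.2 ▸ hy
    · exact Finset.one_lt_card.2 ⟨o, hoS, _, mem_coneTube.2 hi, (f i).2.symm⟩
    · rw [Finset.card_lt_iff_ne_univ]
      exact fun he => hu (Finset.eq_univ_of_forall fun j =>
        mem_coneTube.1 (he ▸ Finset.mem_univ (f j).1))

/-- Since all proper tubes of a claw contain the minimum, its proper tubings are the chains of
nonempty proper subsets of the set of other elements. -/
theorem exists_properTubing_claw_orderIso (ho : ∀ a, o ≤ a)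
    (hclaw : ∀ a b : P, a ≠ o → b ≠ o → a ≤ b → a = b) (f : Fin n ≃ {x : P // x ≠ o}) :
    Nonempty (ProperTubing P ≃o SubsetChain n) := by
  have hbot : ∀ {σ : Finset P}, IsProperTube σ → o ∈ σ := by
    intro σ hσ
    obtain ⟨S, -, rfl⟩ := (isProperTube_claw_iff ho hclaw f).1 hσ
    exact bot_mem_coneTube f S
  refine exists_properTubing_orderIso (c := coneTube f) (compat := fun S S' => S ⊆ S' ∨ S' ⊆ S)
    (fun S S' _ _ h => ?_) (fun σ => isProperTube_claw_iff ho hclaw f) (fun S S' _ _ => ?_)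
    fun T hT σ hσ => ?_
  · exact subset_antisymm (coneTube_subset_iff.1 h.subset) (coneTube_subset_iff.1 h.superset)
  · rw [coneTube_subset_iff, coneTube_subset_iff, or_iff_left
      (Finset.not_disjoint_iff.2 ⟨o, bot_mem_coneTube f S, bot_mem_coneTube f S'⟩)]
  · obtain ⟨σ', ⟨h1, h2, h3, -⟩, -⟩ := Relation.TransGen.head'_iff.1 hσ
    exact Finset.disjoint_left.1 h3 (hbot (hT σ h1)) (hbot (hT σ' h2))

end Claw

namespace PosetAssociahedron

variable {P : Type*} [PartialOrder P] [Fintype P] {d : ℕ} (A : PosetAssociahedron P d)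

theorem combEquiv_permutohedron (hclaw : IsClawPoset P) :
    CombEquiv A.carrier (permutohedron (Fintype.card P - 1)) := by
  classical
  obtain ⟨o, ho, hclaw⟩ := hclaw
  have hcard : Fintype.card {x : P // x ≠ o} = Fintype.card P - 1 := by
    rw [Fintype.card_subtype_compl, Fintype.card_subtype_eq]
  obtain ⟨f⟩ := A.exists_facesIso
  obtain ⟨g⟩ := exists_properTubing_claw_orderIso ho hclaw (Fintype.equivFinOfCardEq hcard).symm
  obtain ⟨h⟩ := exists_permutohedron_facesIso (Fintype.card P - 1)
  exact combEquiv_of_nonemptyFaces (f.symm.trans (g.dual.trans h))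

end PosetAssociahedron


/-! ### A poset associahedron whose dual is not flag -/

/-- The crown with three minimal elements `(i, false)` and three maximal elements `(i, true)`: the
minimal element `i` lies below the maximal elements `i` and `i + 1`. -/
def Crown : Type := Fin 3 × Bool

namespace Crown

noncomputable instance : Fintype Crown := inferInstanceAs (Fintype (Fin 3 × Bool))

instance : PartialOrder Crown where
  le a b := a = b ∨ a.2 = false ∧ b.2 = true ∧ (b.1 = a.1 ∨ b.1 = a.1 + 1)
  le_refl a := Or.inl rfl
  le_trans a b c := by
    rintro (rfl | ⟨h1, h2, h3⟩) (rfl | ⟨h4, h5, h6⟩)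
    · exact Or.inl rfl
    · exact Or.inr ⟨h4, h5, h6⟩
    · exact Or.inr ⟨h1, h2, h3⟩
    · exact absurd (h2.symm.trans h4) Bool.noConfusion
  le_antisymm a b := by
    rintro (rfl | ⟨h1, h2, h3⟩) (h | ⟨h4, h5, h6⟩)
    · rfl
    · rfl
    · exact h.symm
    · exact absurd (h2.symm.trans h4) Bool.noConfusion

theorem card_eq : Fintype.card Crown = 6 := by
  rw [show Fintype.card Crown = Fintype.card (Fin 3 × Bool) from rfl]
  simp

theorem eq_or_eq {a b c : Crown} (hab : a ≤ b) (hbc : b ≤ c) : b = a ∨ b = c := by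
  rcases hab with rfl | ⟨-, h, -⟩
  · exact Or.inl rfl
  rcases hbc with rfl | ⟨h', -⟩
  · exact Or.inr rfl
  · exact absurd (h.symm.trans h') Bool.noConfusion

/-- The minimal element `i`. -/
def lower (i : Fin 3) : Crown := (i, false)

/-- The maximal element `i`. -/
def upper (i : Fin 3) : Crown := (i, true)

theorem lower_le_upper (i : Fin 3) : lower i ≤ upper i := Or.inr ⟨rfl, rfl, Or.inl rfl⟩

theorem lower_le_upper_succ (i : Fin 3) : lower i ≤ upper (i + 1) :=
  Or.inr ⟨rfl, rfl, Or.inr rfl⟩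

theorem lower_ne_upper (i j : Fin 3) : lower i ≠ upper j := fun h =>
  Bool.noConfusion (congrArg Prod.snd h)

theorem posetConnected : PosetConnected Crown := by
  rw [posetConnected_iff]
  refine ⟨⟨lower 0, trivial⟩, fun A _ ⟨a, ha⟩ hcl y _ => ?_⟩
  have hcl : ∀ x ∈ A, ∀ y, x ≤ y ∨ y ≤ x → y ∈ A := fun x hx y h => hcl x hx y trivial h
  have hup : ∀ i, lower i ∈ A → upper i ∈ A := fun i h => hcl _ h _ (Or.inl (lower_le_upper i))
  have hdown : ∀ i, upper i ∈ A → lower i ∈ A := fun i h => hcl _ h _ (Or.inr (lower_le_upper i))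
  have hsucc : ∀ i, lower i ∈ A → lower (i + 1) ∈ A := fun i h =>
    hdown _ (hcl _ h _ (Or.inl (lower_le_upper_succ i)))
  have hcyc : ∀ i j : Fin 3, j = i ∨ j = i + 1 ∨ j = i + 1 + 1 := by decide
  have hlow : ∀ j, lower j ∈ A := by
    intro j
    have hi : lower a.1 ∈ A := by
      obtain ⟨i, b⟩ := a
      cases b
      · exact ha
      · exact hdown i ha
    rcases hcyc a.1 j with h | h | h
    · exact h ▸ hi
    · exact h ▸ hsucc _ hi
    · exact h ▸ hsucc _ (hsucc _ hi)
  obtain ⟨j, b⟩ := y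
  cases b
  · exact hlow j
  · exact hup j (hlow j)

/-- The tube consisting of the minimal element `i` and the maximal element `i`. -/
def pairTube (i : Fin 3) : Finset Crown :=
  Finset.cons (lower i) {upper i} fun h => lower_ne_upper i i (Finset.mem_singleton.1 h)

theorem mem_pairTube {i : Fin 3} {x : Crown} : x ∈ pairTube i ↔ x = lower i ∨ x = upper i := by
  rw [pairTube, Finset.mem_cons, Finset.mem_singleton]

theorem fst_eq_of_mem_pairTube {i : Fin 3} {x : Crown} (h : x ∈ pairTube i) : x.1 = i := by
  rcases mem_pairTube.1 h with rfl | rfl <;> rfl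

theorem ne_add_one : ∀ i : Fin 3, i ≠ i + 1 := by decide

theorem disjoint_pairTube {i j : Fin 3} (h : i ≠ j) : Disjoint (pairTube i) (pairTube j) :=
  Finset.disjoint_left.2 fun _ hi hj =>
    h ((fst_eq_of_mem_pairTube hi).symm.trans (fst_eq_of_mem_pairTube hj))

theorem isProperTube_pairTube (i : Fin 3) : IsProperTube (pairTube i) := by
  have hcard : (pairTube i).card = 2 := by rw [pairTube, Finset.card_cons, Finset.card_singleton]
  have hl : lower i ∈ pairTube i := mem_pairTube.2 (Or.inl rfl)
  refine ⟨isTube_iff.2 ⟨⟨fun x hx y hy z hz => ?_⟩, ⟨lower i, hl⟩, ?_⟩, ?_, ?_⟩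
  · rcases eq_or_eq hz.1 hz.2 with rfl | rfl
    · exact hx
    · exact hy
  · intro A hA ⟨a, ha⟩ hcl y hy
    refine hcl a ha y hy ?_
    have hle := lower_le_upper i
    rcases mem_pairTube.1 (hA ha) with rfl | rfl <;>
      rcases mem_pairTube.1 hy with rfl | rfl <;> simp [hle]
  · omega
  · rw [hcard, card_eq]
    omega

theorem tubingEdge_pairTube {T : Finset (Finset Crown)} {i : Fin 3} (h : pairTube i ∈ T)
    (h' : pairTube (i + 1) ∈ T) : TubingEdge T (pairTube i) (pairTube (i + 1)) :=
  ⟨h, h', disjoint_pairTube (ne_add_one i), lower i, mem_pairTube.2 (Or.inl rfl),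
    upper (i + 1), mem_pairTube.2 (Or.inr rfl),
    lt_of_le_of_ne (lower_le_upper_succ i) (lower_ne_upper _ _)⟩

open Classical in
/-- Two of the three tubes are compatible, since there is an edge between them in one direction
only. -/
theorem isProperTubing_pair (i : Fin 3) :
    IsProperTubing ({pairTube i, pairTube (i + 1)} : Finset (Finset Crown)) := by
  have hproper : ∀ σ ∈ ({pairTube i, pairTube (i + 1)} : Finset (Finset Crown)),
      IsProperTube σ := by
    intro σ hσ
    rcases Finset.mem_insert.1 hσ with rfl | hσ
    · exact isProperTube_pairTube i
    · exact Finset.mem_singleton.1 hσ ▸ isProperTube_pairTube (i + 1)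
  have hedge : ∀ σ σ', TubingEdge {pairTube i, pairTube (i + 1)} σ σ' →
      σ = pairTube i ∧ σ' = pairTube (i + 1) := by
    rintro σ σ' ⟨hσ, hσ', hd, x, hx, y, hy, hxy⟩
    simp only [Finset.mem_insert, Finset.mem_singleton] at hσ hσ'
    rcases hσ with rfl | rfl <;> rcases hσ' with rfl | rfl
    · exact absurd hx (fun hx => Finset.disjoint_left.1 hd hx hx)
    · exact ⟨rfl, rfl⟩
    · have h1 : ∀ i : Fin 3, ¬ (i = i + 1 ∨ i = i + 1 + 1) := by decide
      rcases hxy.le with rfl | ⟨-, -, h⟩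
      · exact absurd hxy (lt_irrefl _)
      · rw [fst_eq_of_mem_pairTube hx, fst_eq_of_mem_pairTube hy] at h
        exact absurd h (h1 i)
    · exact absurd hx (fun hx => Finset.disjoint_left.1 hd hx hx)
  refine ⟨⟨fun σ hσ => (hproper σ hσ).1, fun σ hσ σ' hσ' => ?_, fun σ h => ?_⟩, hproper⟩
  · simp only [Finset.mem_insert, Finset.mem_singleton] at hσ hσ'
    rcases hσ with rfl | rfl <;> rcases hσ' with rfl | rfl
    · exact Or.inl subset_rfl
    · exact Or.inr (Or.inr (disjoint_pairTube (ne_add_one i)))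
    · exact Or.inr (Or.inr (disjoint_pairTube (ne_add_one i).symm))
    · exact Or.inl subset_rfl
  · obtain ⟨_, h1, -⟩ := Relation.TransGen.head'_iff.1 h
    obtain ⟨_, -, h2⟩ := Relation.TransGen.tail'_iff.1 h
    have h3 := (hedge _ _ h1).1.symm.trans (hedge _ _ h2).2
    have h4 : lower i ∈ pairTube (i + 1) := h3 ▸ mem_pairTube.2 (Or.inl rfl)
    exact ne_add_one i (fst_eq_of_mem_pairTube h4)

/-- The three tubes form a directed cycle. -/
theorem not_isTubing {T : Finset (Finset Crown)} (h : ∀ i, pairTube i ∈ T) : ¬ IsTubing T :=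
  fun hT => hT.2.2 (pairTube 0) (((Relation.TransGen.single
    (tubingEdge_pairTube (h 0) (h 1))).tail (tubingEdge_pairTube (h 1) (h 2))).tail
    (tubingEdge_pairTube (h 2) (h 0)))

theorem not_isFlagPolytope {d : ℕ} (A : PosetAssociahedron Crown d) :
    ¬ IsFlagPolytope A.dual := by
  classical
  intro hflag
  have hr := A.isRealization
  have hface : ∀ F, IsFace A.dual F ∧ F ≠ A.dual ↔
      ∃ S ∈ tubingComplex Crown, F = convexHull ℝ (A.tubeVertex '' (S : Set (Finset Crown))) :=
    fun F => by
      have := hr.isBoundaryFace_iff (F := F)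
      rwa [A.hullZero_tubeVertex] at this
  let v : Fin 3 → EuclideanSpace ℝ (Fin d) := fun i => A.tubeVertex (pairTube i)
  have hpair : ∀ i j, ∃ S ∈ tubingComplex Crown,
      A.tubeVertex '' (S : Set (Finset Crown)) = {v i, v j} := by
    intro i j
    have hcyc : ∀ i j : Fin 3, j = i ∨ j = i + 1 ∨ i = j + 1 := by decide
    rcases hcyc i j with rfl | rfl | rfl
    · exact ⟨{pairTube j}, isProperTubing_singleton (isProperTube_pairTube j), by simp [v]⟩
    · exact ⟨_, isProperTubing_pair i, by simp [Set.image_insert_eq, v]⟩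
    · exact ⟨_, isProperTubing_pair j, by simp [Set.image_insert_eq, v, Set.pair_comm]⟩
  have h := hflag (Finset.univ.image v) fun x hx y hy => by
    obtain ⟨i, -, rfl⟩ := Finset.mem_image.1 hx
    obtain ⟨j, -, rfl⟩ := Finset.mem_image.1 hy
    obtain ⟨S, hS, heq⟩ := hpair i j
    exact (hface _).2 ⟨S, hS, by rw [heq]⟩
  obtain ⟨S, hS, heq⟩ := (hface _).1 h
  refine not_isTubing (fun i => ?_) (mem_tubingComplex.1 hS).1
  rw [← hr.mem_convexHull_image_iff hS, ← heq]
  exact subset_convexHull ℝ _ (Finset.mem_coe.2 (Finset.mem_image_of_mem v (Finset.mem_univ i)))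

end Crown

/-! ### The face structure of poset associahedra -/

namespace PosetAssociahedron

variable {P : Type*} [PartialOrder P] [Fintype P] {d : ℕ} (A : PosetAssociahedron P d)

theorem bijOn_face : Set.BijOn A.face Set.univ {F | IsFace A.carrier F ∧ F.Nonempty} := by
  refine ⟨fun T _ => ?_, fun T _ T' _ h => ?_, fun F ⟨hF, hne⟩ => ?_⟩
  · rw [face_eq, carrier_eq]
    exact ⟨isFace_subface _ _, A.isRealization.realizes.subface_nonempty T.2⟩
  · rw [face_eq, face_eq] at h
    exact Subtype.ext (A.isRealization.realizes.subface_injOn T.2 T'.2 h)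
  · rw [carrier_eq] at hF
    obtain ⟨S, hS, rfl⟩ := A.isRealization.exists_eq_subface hF hne
    exact ⟨⟨S, hS⟩, trivial, A.face_eq _⟩

theorem bijOn_face_vertices :
    Set.BijOn A.face {T | T.val.card = d} {F | ∃ v, IsVertex A.carrier v ∧ F = {v}} := by
  refine ⟨fun T hT => ?_, A.bijOn_face.injOn.mono (Set.subset_univ _), fun F hF => ?_⟩
  · rw [face_eq, carrier_eq]
    exact A.isRealization.exists_eq_singleton_iff.2 ⟨T.1, T.2, hT, rfl⟩
  · rw [carrier_eq] at hF
    obtain ⟨S, hS, hcard, rfl⟩ := A.isRealization.exists_eq_singleton_iff.1 hF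
    exact ⟨⟨S, hS⟩, hcard, A.face_eq _⟩

theorem bijOn_face_facets :
    Set.BijOn (fun τ : {τ : Finset P // IsProperTube τ} =>
      A.face (ProperTubing.single τ.val τ.property)) Set.univ {F | IsFacet A.carrier F} := by
  refine ⟨fun τ _ => ?_, fun τ _ τ' _ h => ?_, fun F hF => ?_⟩
  · rw [carrier_eq]
    exact A.isRealization.isFacet_iff.2
      ⟨τ.1, singleton_mem_tubingComplex.2 τ.2, A.face_eq _⟩
  · have := congrArg Subtype.val (A.bijOn_face.injOn trivial trivial h)
    exact Subtype.ext (Finset.singleton_injective this)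
  · rw [carrier_eq] at hF
    obtain ⟨τ, hτ, rfl⟩ := A.isRealization.isFacet_iff.1 hF
    exact ⟨⟨τ, singleton_mem_tubingComplex.1 hτ⟩, trivial, A.face_eq _⟩

theorem isSimplicialPolytope_dual : IsSimplicialPolytope A.dual :=
  A.hullZero_tubeVertex ▸ A.isRealization.isSimplicialPolytope

end PosetAssociahedron

theorem mainTheorem5 :
    (∀ (P : Type*) [PartialOrder P] [Fintype P], PosetConnected P → 2 ≤ Fintype.card P →
      -- the poset associahedron exists
      Nonempty (PosetAssociahedron P (Fintype.card P - 2)) ∧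
      ∀ (d : ℕ) (A : PosetAssociahedron P d),
        -- it is a simple polytope of dimension `|P| - 2`
        (IsSimplePolytope A.carrier ∧ polytopeDim A.carrier + 2 = Fintype.card P) ∧
        -- its polar dual is simplicial
        (polarDual A.carrier = A.dual ∧ IsSimplicialPolytope A.dual) ∧
        -- its nonempty faces are labelled by the proper tubings, reversing inclusion
        (Set.BijOn A.face Set.univ {F | IsFace A.carrier F ∧ F.Nonempty} ∧
          ∀ T T' : ProperTubing P, A.face T ⊆ A.face T' ↔ T' ≤ T) ∧
        -- the face labelled by `T` has dimension `|P| - |T| - 2`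
        (∀ T : ProperTubing P, polytopeDim (A.face T) + T.val.card + 2 = Fintype.card P) ∧
        -- the vertices correspond to the proper tubings of size `|P| - 2`
        Set.BijOn A.face {T | T.val.card + 2 = Fintype.card P}
          {F | ∃ v, IsVertex A.carrier v ∧ F = {v}} ∧
        -- the facets correspond to the proper tubes
        Set.BijOn (fun τ : {τ : Finset P // IsProperTube τ} =>
            A.face (ProperTubing.single τ.val τ.property)) Set.univ {F | IsFacet A.carrier F} ∧
        -- each nonempty face is a product of poset associahedra
        (∀ F, IsFace A.carrier F → F.Nonempty →
          ∃ (m : ℕ) (R : Fin m → Type) (_ : ∀ i, PartialOrder (R i)) (_ : ∀ i, Fintype (R i))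
            (e : Fin m → ℕ) (B : ∀ i, PosetAssociahedron (R i) (e i)),
            (∀ i, PosetConnected (R i) ∧ 2 ≤ Fintype.card (R i)) ∧
            CombEquiv F (Set.pi Set.univ fun i => (B i).carrier)) ∧
        -- chains give associahedra
        (IsChainPoset P → IsAssociahedron (Fintype.card P - 2) A.carrier) ∧
        -- claws give permutohedra
        (IsClawPoset P → CombEquiv A.carrier (permutohedron (Fintype.card P - 1)))) ∧
    -- in general the polar dual is not flag
    (∃ (P : Type) (_ : PartialOrder P) (_ : Fintype P),
      PosetConnected P ∧ 2 ≤ Fintype.card P ∧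
      (∃ d, Nonempty (PosetAssociahedron P d)) ∧
      ∀ (d : ℕ) (A : PosetAssociahedron P d),
        IsSimplicialPolytope A.dual ∧ ¬ IsFlagPolytope A.dual) := by
  refine ⟨fun P _ _ hP hcard => ?_, ?_⟩
  · obtain ⟨a, ha⟩ := exists_isRealization hP hcard
    refine ⟨⟨ha.posetAssociahedron⟩, fun d A => ?_⟩
    have hr := A.isRealization
    have hd : d + 2 = Fintype.card P := hr.dim_add_two hP hcard
    refine ⟨⟨A.carrier_eq ▸ hr.isSimplePolytope, ?_⟩,
      ⟨A.polarDual_carrier, A.isSimplicialPolytope_dual⟩, ⟨A.bijOn_face, fun T T' => ?_⟩,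
      fun T => ?_, ?_, A.bijOn_face_facets, fun F hF hne => ?_, A.isAssociahedron hP hcard,
      A.combEquiv_permutohedron⟩
    · rw [A.carrier_eq, hr.polytopeDim_polyhedron, hd]
    · rw [A.face_eq, A.face_eq]
      exact hr.realizes.subface_subset_iff T.2
    · rw [A.face_eq, hr.polytopeDim_subface T.2, hd]
    · have hset : {T : ProperTubing P | T.val.card + 2 = Fintype.card P} =
          {T | T.val.card = d} := by
        rw [← hd]
        exact Set.ext fun T => add_left_inj 2
      rw [hset]
      exact A.bijOn_face_vertices
    · obtain ⟨T, -, rfl⟩ := A.bijOn_face.surjOn ⟨hF, hne⟩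
      exact A.exists_combEquiv_pi hP hcard T
  · have hcard : 2 ≤ Fintype.card Crown := by rw [Crown.card_eq]; omega
    obtain ⟨a, ha⟩ := exists_isRealization Crown.posetConnected hcard
    exact ⟨Crown, inferInstance, inferInstance, Crown.posetConnected, hcard,
      ⟨_, ⟨ha.posetAssociahedron⟩⟩, fun d A =>
        ⟨A.isSimplicialPolytope_dual, Crown.not_isFlagPolytope A⟩⟩
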